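/- **Setting.** Let $n\ge 1$ and let $j_n:(0,\infty)\to\mathbb R$ be differentiable and nonincreasing with $\int_{\mathbb R^n\setminus\{0\}}\min\{1,|x|^2\}\,j_n(|x|)\,dx<\infty$. Put $j_{n+2}(r)=-\dfrac{j_n'(r)}{2\pi r}$ and, for $d\in\{n,n+2\}$, $$L_d u(x)=\int_{\mathbb R^d\setminus\{0\}}\bigl(u(x)-u(x+y)+\nabla u(x)\cdot y\,\chi_{B_1}(y)\bigr)\,j_d(|y|)\,dy .$$ Write $x_*=(-x_1,x_2,\dots,x_n)$, and call $u$ antisymmetric if $u(x_*)=-u(x)$ for all $x$. For antisymmetric $u$ and $x_1>0$, $L_nu(x)$ is understood by substituting $z=x+y$ and adding the values of the integrand at $z$ and at $z_*$ before integrating over $\{z_1>0\}$. (This agrees with the formula above whenever that integral converges absolutely, and it makes sense for antisymmetric functions with $x_1^{-1}u\in L^\infty$.) **Harnack inequality.** Let $V\subset\mathbb R^{n+2}$ be open, $Q\subset V$ compact and $M\ge0$. A number $C>0$ is called a *Harnack constant* of $L_{n+2}$ for $(V,Q,M)$ if $\sup_Q v\le C\inf_Q v$ for all $c\in L^\infty(V)$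 with $\|c\|_{L^\infty(V)}\le M$ and all $v\in C^2(V)\cap L^\infty(\mathbb R^{n+2})$ with $v\ge0$ in $\mathbb R^{n+2}$ that satisfy $L_{n+2}v+cv=0$ in $V$ in the weak sense, i.e. $\int_{\mathbb R^{n+2}}v\,L_{n+2}\varphi\,dx+\int_V cv\varphi\,dx=0$ for all $\varphi\in C_c^\infty(V)$. The operator $L_{n+2}$ *satisfies the Harnack inequality* if a Harnack constant exists for all $(V,Q,M)$ with $Q$ (nonempty and) connected. **Lifting.** Let $\pi:\mathbb R^{n+2}\to\mathbb R^n$, $\pi(\tilde x)=\bigl(\sqrt{\tilde x_1^2+\tilde x_2^2+\tilde x_3^2},\tilde x_4,\dots,\tilde x_{n+2}\bigr)$. Let $\Omega\subset\mathbb R^n$ be open, $\Omega_+=\{x\in\Omega:x_1>0\}$, and let $K\subset\Omega$ be compact such that $|K|:=\{(|x_1|,x_2,\dots,x_n):x\in K\}\subset\Omega$ (this is automatic if $\Omega$ is symmetric with respect to $\{x_1=0\}$). Set $\tilde\Omega=\pi^{-1}(\Omega)$, $\tilde K=\pi^{-1}(|K|)$ and $K_0=\{x\in K:x_1\neq0\}$.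 **Theorem.** Let $M\ge 0$. Consider all pairs $(c,u)$ such that $c$ is a bounded Borel function on $\Omega$ with $\|c\|_{L^\infty(\Omega_+)}\le M$, and $u:\mathbb R^n\to\mathbb R$ is antisymmetric with $u\in C^2(\Omega)$, $x_1^{-1}u\in L^\infty(\mathbb R^n)$, $x_1u(x)\ge0$ for all $x\in\mathbb R^n$, and $$L_nu+cu=0\quad\text{in }\Omega_+ .$$ 1. Suppose that $L_{n+2}$ satisfies the Harnack inequality, and that $|K|$ lies in a connected subset of $\{x\in\Omega:x_1\ge0\}$. Then there is a constant $C=C(K,\Omega,M)>0$, independent of $(c,u)$, such that for all these pairs $$\sup_{x\in K_0}\frac{u(x)}{x_1}\le C\inf_{x\in K_0}\frac{u(x)}{x_1}.\tag{$*$}$$ 2. The constant is that of the Harnack inequality for $L_{n+2}$. Precisely, without any connectedness assumption on $K$: - if $C$ is a Harnack constant of $L_{n+2}$ for $(\tilde\Omega,\tilde K,M)$, then $(*)$ holds with this $C$ for all the above pairs if $M>0$, and, if $M=0$, for those pairs for which $\tilde x\mapsto u(\pi(\tilde x))/\pi(\tilde x)_1$ extends to a $C^2$ function on $\tilde\Omega$;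 - for every $M\ge0$: if $U$ is open with $\tilde K\subset U$, $\overline U$ compact and $\overline U\subset\tilde\Omega$, and $C$ is a Harnack constant of $L_{n+2}$ for $(U,\tilde K,M)$, then $(*)$ holds with this $C$ for all the above pairs. -/

import Mathlib

open MeasureTheory Set
open scoped ContDiff ENNReal

noncomputable section

namespace AntisymHarnack

/-- Euclidean space `ℝᵈ`. -/
abbrev E (d : ℕ) := EuclideanSpace ℝ (Fin d)

/-- The integrand of the Lévy-type operator with radial kernel `j`, at the point `x` and with
increment `y`: `(u(x) - u(x + y) + ∇u(x)·y 1_{|y| < 1}) j(|y|)`. -/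
def levyIntegrand {d : ℕ} (j : ℝ → ℝ) (u : E d → ℝ) (x y : E d) : ℝ :=
  (u x - u (x + y) + (Metric.ball (0 : E d) 1).indicator (fun z => fderiv ℝ u x z) y) * j ‖y‖

/-- The Lévy-type operator `L_d` with radial kernel `j`. -/
def levyOp {d : ℕ} (j : ℝ → ℝ) (u : E d → ℝ) (x : E d) : ℝ :=
  ∫ y, levyIntegrand j u x y

/-- The kernel `j_{n+2}(r) = -j_n'(r) / (2πr)`. -/
def nextKernel (j : ℝ → ℝ) (r : ℝ) : ℝ := -deriv j r / (2 * Real.pi * r)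

/-- The reflection `x ↦ x_* = (-x₁, x₂, …, xₙ)`, where `n = m + 1`. -/
def reflect {m : ℕ} (x : E (m + 1)) : E (m + 1) :=
  WithLp.toLp 2 (Function.update x.ofLp 0 (-x 0))

/-- The folding `x ↦ (|x₁|, x₂, …, xₙ)`, where `n = m + 1`. -/
def fold {m : ℕ} (x : E (m + 1)) : E (m + 1) :=
  WithLp.toLp 2 (Function.update x.ofLp 0 |x 0|)

/-- The map `ℝⁿ⁺² → ℝⁿ`, `x ↦ (√(x₁² + x₂² + x₃²), x₄, …, xₙ₊₂)`, where `n = m + 1`. -/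
def collapse {m : ℕ} (x : E (m + 3)) : E (m + 1) :=
  WithLp.toLp 2 (Fin.cons (√(x 0 ^ 2 + x 1 ^ 2 + x 2 ^ 2)) fun i : Fin m => x (i.addNat 3))

/-- The operator `L_n` on antisymmetric functions. The integral over `ℝⁿ` that defines `L_n u(x)`
is written in the variable `z = x + y`, and the contributions of `z` and of its mirror image `z_*`
are added before integrating over the half-space `{z₁ > 0}`. This is `levyOp j u x` whenever the
integral over `ℝⁿ` converges absolutely (`levyOpAnti_eq_levyOp`), and it also makes sense for
antisymmetric functions of linear growth. -/
def levyOpAnti {m : ℕ} (j : ℝ → ℝ) (u : E (m + 1) → ℝ) (x : E (m + 1)) : ℝ :=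
  ∫ z in {z : E (m + 1) | 0 < z 0},
    (levyIntegrand j u x (z - x) + levyIntegrand j u x (reflect z - x))

lemma reflect_reflect {m : ℕ} (x : E (m + 1)) : reflect (reflect x) = x := by
  ext i
  by_cases h : i = 0
  · subst h; simp [reflect]
  · simp [reflect]

/-- The reflection as a linear isometry. -/
def reflectIso (m : ℕ) : E (m + 1) ≃ₗᵢ[ℝ] E (m + 1) where
  toFun := reflect
  invFun := reflect
  left_inv := reflect_reflect
  right_inv := reflect_reflect
  map_add' x y := by
    ext i
    by_cases h : i = 0
    · subst h; simp [reflect]; ring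
    · simp [reflect, h]
  map_smul' a x := by
    ext i
    by_cases h : i = 0
    · subst h; simp [reflect]
    · simp [reflect, h]
  norm_map' x := by
    simp only [EuclideanSpace.norm_eq]
    congr 1
    refine Finset.sum_congr rfl fun i _ => ?_
    by_cases h : i = 0
    · subst h; simp [reflect]
    · simp [reflect, h]

lemma measurePreserving_reflect {m : ℕ} :
    MeasurePreserving (reflect : E (m + 1) → E (m + 1)) volume volume :=
  (reflectIso m).measurePreserving

lemma levyOpAnti_eq_levyOp {m : ℕ} (j : ℝ → ℝ) (u : E (m + 1) → ℝ) (x : E (m + 1))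
    (h : Integrable (levyIntegrand j u x)) : levyOpAnti j u x = levyOp j u x := by
  have hF : Integrable (fun z => levyIntegrand j u x (z - x)) := h.comp_sub_right x
  have hR : Integrable (fun z => levyIntegrand j u x (reflect z - x)) :=
    (measurePreserving_reflect.integrable_comp_emb
      (reflectIso m).toHomeomorph.measurableEmbedding).2 hF
  have hpre : {z : E (m + 1) | 0 < z 0} = reflect ⁻¹' {z : E (m + 1) | z 0 < 0} := by
    ext z; simp [reflect]
  have hms : MeasurableSet {z : E (m + 1) | 0 < z 0} :=
    measurableSet_lt measurable_const (by fun_prop)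
  have hneg : ∫ z in {z : E (m + 1) | 0 < z 0}, levyIntegrand j u x (reflect z - x) =
      ∫ z in {z : E (m + 1) | z 0 < 0}, levyIntegrand j u x (z - x) := by
    rw [hpre]
    exact measurePreserving_reflect.setIntegral_preimage_emb
      (reflectIso m).toHomeomorph.measurableEmbedding (fun z => levyIntegrand j u x (z - x)) _
  have hnull : volume {z : E (m + 1) | z 0 = 0} = 0 := by
    have := Measure.addHaar_submodule (volume : Measure (E (m + 1)))
      (LinearMap.ker (EuclideanSpace.proj (𝕜 := ℝ) (0 : Fin (m + 1))).toLinearMap) (by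
        intro htop
        have := LinearMap.ker_eq_top.1 htop
        have h1 := LinearMap.congr_fun this (EuclideanSpace.single 0 1)
        simp at h1)
    convert this using 2
    ext z
    simp
  have hcompl : ({z : E (m + 1) | 0 < z 0}ᶜ : Set (E (m + 1))) =ᵐ[volume] {z | z 0 < 0} := by
    have : ∀ᵐ z : E (m + 1), z 0 ≠ 0 := by
      rw [ae_iff]; simpa using hnull
    filter_upwards [this] with z hz
    simp only [eq_iff_iff]
    change (¬ (0 < z 0)) ↔ z 0 < 0
    rw [not_lt]
    exact ⟨fun h => lt_of_le_of_ne h hz, le_of_lt⟩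
  unfold levyOpAnti levyOp
  rw [integral_add hF.integrableOn hR.integrableOn, hneg, ← setIntegral_congr_set hcompl,
    integral_add_compl hms hF]
  exact integral_sub_right_eq_self (levyIntegrand j u x) x

/-- `sup_K f ≤ A inf_K f` for a nonnegative function `f`, with the supremum and the infimum taken
in `[0, ∞]`. -/
def SupLeInf {X : Type*} (A : ℝ) (K : Set X) (f : X → ℝ) : Prop :=
  ⨆ x ∈ K, ENNReal.ofReal (f x) ≤ ENNReal.ofReal A * ⨅ x ∈ K, ENNReal.ofReal (f x)

/-- `L v + c v = 0` in `Ω` in the weak sense, for the Lévy-type operator `L` with kernel `j`. -/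
def WeakSolution {d : ℕ} (j : ℝ → ℝ) (Ω : Set (E d)) (c v : E d → ℝ) : Prop :=
  ∀ φ : E d → ℝ, ContDiff ℝ ∞ φ → HasCompactSupport φ → tsupport φ ⊆ Ω →
    (∫ x, v x * levyOp j φ x) + (∫ x in Ω, c x * v x * φ x) = 0

/-- `A` is a constant in the Harnack inequality on `K ⊆ Ω` for all solutions of `L v + c v = 0` in
`Ω`, `v ≥ 0` in `ℝᵈ`, with `‖c‖_{L^∞(Ω)} ≤ M`. -/
def HarnackConstant {d : ℕ} (j : ℝ → ℝ) (Ω K : Set (E d)) (M A : ℝ) : Prop :=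
  0 < A ∧ ∀ c v : E d → ℝ,
    MemLp c ∞ (volume.restrict Ω) → eLpNorm c ∞ (volume.restrict Ω) ≤ ENNReal.ofReal M →
    ContDiffOn ℝ 2 v Ω → MemLp v ∞ volume → (∀ x, 0 ≤ v x) →
    WeakSolution j Ω c v → SupLeInf A K v

/-- The Lévy-type operator with kernel `j` on `ℝᵈ` admits the Harnack inequality: for every compact
connected `K ⊆ Ω` there is a constant that depends only on `Ω`, `K` and the bound `M` for
`‖c‖_{L^∞(Ω)}`. -/
def SatisfiesHarnack (d : ℕ) (j : ℝ → ℝ) : Prop :=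
  ∀ (Ω K : Set (E d)) (M : ℝ), IsOpen Ω → IsCompact K → IsConnected K → K ⊆ Ω → 0 ≤ M →
    ∃ A : ℝ, HarnackConstant j Ω K M A

/-- `u` is antisymmetric with `x₁ u(x) ≥ 0` on `ℝⁿ`, `u ∈ C²(Ω)`, `x₁⁻¹ u ∈ L^∞(ℝⁿ)`, `c` is a
bounded Borel function on `Ω` with `‖c‖_{L^∞(Ω₊)} ≤ M`, and `L_n u + c u = 0` in
`Ω₊ = {x ∈ Ω : x₁ > 0}`. -/
structure AntisymSolution {m : ℕ} (j : ℝ → ℝ) (Ω : Set (E (m + 1))) (M : ℝ)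
    (c u : E (m + 1) → ℝ) : Prop where
  contDiffOn : ContDiffOn ℝ 2 u Ω
  memLp_div : MemLp (fun x => u x / x 0) ∞ volume
  antisymm : ∀ x, u (reflect x) = -u x
  nonneg : ∀ x, 0 ≤ x 0 * u x
  measurable : Measurable fun x : Ω => c x
  bounded : ∃ B : ℝ, ∀ x ∈ Ω, |c x| ≤ B
  norm_le : eLpNorm c ∞ (volume.restrict {x ∈ Ω | 0 < x 0}) ≤ ENNReal.ofReal M
  equation : ∀ x ∈ Ω, 0 < x 0 → levyOpAnti j u x + c x * u x = 0

/-- `sup_{K₀} u / x₁ ≤ A inf_{K₀} u / x₁` with `K₀ = {x ∈ K : x₁ ≠ 0}`. -/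
def AntisymHarnackBound {m : ℕ} (A : ℝ) (K : Set (E (m + 1))) (u : E (m + 1) → ℝ) : Prop :=
  SupLeInf A {x ∈ K | x 0 ≠ 0} fun x => u x / x 0

/-- The function `ṽ(x) = u(√(x₁² + x₂² + x₃²), x₄, …, xₙ₊₂) / √(x₁² + x₂² + x₃²)`, defined where
`(x₁, x₂, x₃) ≠ 0`, extends to a function of class `C²` in the preimage of `Ω`. -/
def LiftC2 {m : ℕ} (Ω : Set (E (m + 1))) (u : E (m + 1) → ℝ) : Prop :=
  ∃ v : E (m + 3) → ℝ, ContDiffOn ℝ 2 v (collapse ⁻¹' Ω) ∧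
    ∀ x ∈ collapse ⁻¹' Ω, collapse x 0 ≠ 0 → v x = u (collapse x) / collapse x 0

end AntisymHarnack

end

/-!
The theorem rests on a lifting. If `u` is antisymmetric, its lift `v = u / x₁ ∘ collapse` to
`ℝⁿ⁺²`, where the first coordinate is replaced by the distance in `ℝ³` to the origin, is a
nonnegative bounded weak solution of `L_{n+2} v + (c ∘ collapse) v = 0`, and the Harnack inequality
for `v` is the bound for `u / x₁`.

The equation for `v` comes from an identity for truncated kernels. Let `k_r` be the kernel
`j_{n+2}` restricted to increments of norm larger than `r`, and let `J_r(s) = j (max s r)`.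
Integrating `k_r` over the spheres that are the fibres of `collapse`, the substitution of the
distance for the angle turns `j_{n+2} = -j' / (2 π r)` into a difference of values of `J_r` at the
distances to a point and to its mirror image (`LevyProfile.lintegral_collapse_mul_cut`), which is
the kernel of the antisymmetric operator. Moreover `k_r` and `J_r` have the same mass
(`LevyProfile.lintegral_cut_nextKernel`). Hence `x₁` times the truncation of `L_{n+2} v` is the
truncation of `L_n u`. The latter converges to `L_n u` locally uniformly, by Taylor's formula
(`LevyProfile.abs_levyOpAnti_sub_le`), and the former converges weakly to `L_{n+2} v`, by the
symmetry of the truncated operators (`LevyKernel.tendsto_integral_mul_truncOp'`). No regularity of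
`v` across the axis `{x₁ = x₂ = x₃ = 0}` is needed, since `1 / √(x₁² + x₂² + x₃²)` is locally
integrable. This is `AntisymSolution.weakSolution_lift`.

A Harnack constant applies only to solutions of class `C²`, while the lift may fail to be `C²` at
the axis. On a relatively compact open subset `U` the mollifications of `v` are smooth and solve an
equation with a potential bounded by the same `M`, because `|f| ≤ M v` for the right-hand side
`f` is preserved by averaging (`BoundedWeakSolution.le_mul_of_subset`). The constants for `U` thus
carry over in the limit. The first assertion follows, with a compact connected set that contains
the lift of `K` and with a relatively compact neighbourhood of it.

For the constant of the whole lifted domain the mollification has to take place at scales that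
shrink towards the boundary, that is, along a partition of unity `χ_i`. This produces commutators of
`L_{n+2}` with `χ_i`, applied to the difference `w` of a mollification and `v`. They are
uniformly small: small increments are controlled by a Lipschitz bound for `v`, which holds because
`u / x₁` extends by `∂₁ u` to a locally Lipschitz function
(`AntisymSolution.exists_lipschitz_divExtend`), and large increments only see averages of `w`
against an integrable kernel (`BoundedWeakSolution.exists_mollify`). If `M > 0`, the remaining error
in the equation is absorbed into the potential after a small constant, which `L_{n+2}` annihilates,
has been added to the solution (`BoundedWeakSolution.exists_contDiffOn_approx`). If the lift is of
class `C²`, no approximation is needed.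
-/

noncomputable section

namespace AntisymHarnack

open Filter Topology

/-! ### The radial profile -/

/-- The assumptions on the profile `j` of the radial kernel in dimension `m + 1`. -/
structure LevyProfile (m : ℕ) (j : ℝ → ℝ) : Prop where
  integrable : Integrable (fun x : E (m + 1) => min 1 (‖x‖ ^ 2) * j ‖x‖) volume
  differentiable : ∀ r : ℝ, 0 < r → DifferentiableAt ℝ j r
  antitone : AntitoneOn j (Ioi 0)

/-- The density `-j'` cut off below the radius `r`. -/
def tailDensity (j : ℝ → ℝ) (r : ℝ) : ℝ → ℝ≥0∞ :=
  (Ioi r).indicator fun q => ENNReal.ofReal (-deriv j q)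

lemma measurable_nextKernel (j : ℝ → ℝ) : Measurable (nextKernel j) :=
  (measurable_deriv j).neg.div (by fun_prop)

lemma measurable_tailDensity (j : ℝ → ℝ) (r : ℝ) : Measurable (tailDensity j r) :=
  ((measurable_deriv j).neg.ennreal_ofReal).indicator measurableSet_Ioi

namespace LevyProfile

variable {m : ℕ} {j : ℝ → ℝ} (hj : LevyProfile m j)

include hj in
/-- Since `min 1 |x|² j(|x|)` is integrable and spheres of large radius fill a set of infinite
measure, `j` takes arbitrarily small values arbitrarily far out. -/
lemma exists_abs_lt {ε : ℝ} (hε : 0 < ε) (R : ℝ) : ∃ s, R ≤ s ∧ 1 ≤ s ∧ |j s| < ε := by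
  by_contra! h
  have hfin := hj.integrable.measure_norm_ge_lt_top hε
  have hsub : (Metric.ball (0 : E (m + 1)) (max R 1))ᶜ ⊆
      {x | ε ≤ ‖min 1 (‖x‖ ^ 2) * j ‖x‖‖} := by
    intro x hx
    simp only [mem_compl_iff, Metric.mem_ball, dist_zero_right, not_lt, max_le_iff] at hx
    have h1 : min 1 (‖x‖ ^ 2) = 1 := min_eq_left (by nlinarith [hx.2])
    simpa [h1] using h ‖x‖ hx.1 hx.2
  have h1 : volume (univ : Set (E (m + 1))) < ⊤ := by
    rw [← Set.union_compl_self (Metric.ball (0 : E (m + 1)) (max R 1))]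
    exact (measure_union_le _ _).trans_lt
      (ENNReal.add_lt_top.2 ⟨measure_ball_lt_top, (measure_mono hsub).trans_lt hfin⟩)
  simp at h1

include hj in
lemma nonneg {s : ℝ} (hs : 0 < s) : 0 ≤ j s := by
  by_contra! h
  obtain ⟨t, hst, -, ht⟩ := hj.exists_abs_lt (neg_pos.2 h) s
  have := hj.antitone (mem_Ioi.2 hs) (mem_Ioi.2 (hs.trans_le hst)) hst
  linarith [(abs_lt.1 ht).1]

include hj in
lemma tendsto_atTop : Tendsto j atTop (𝓝 0) := by
  rw [Metric.tendsto_atTop]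
  intro ε hε
  obtain ⟨t, -, h1, ht⟩ := hj.exists_abs_lt hε 0
  refine ⟨t, fun s hs => ?_⟩
  have h0 : 0 < t := by linarith
  have := hj.antitone (mem_Ioi.2 h0) (mem_Ioi.2 (h0.trans_le hs)) hs
  rw [Real.dist_eq, sub_zero, abs_of_nonneg (hj.nonneg (h0.trans_le hs))]
  exact this.trans_lt (lt_of_abs_lt ht)

include hj in
lemma deriv_nonpos {s : ℝ} (hs : 0 < s) : deriv j s ≤ 0 := by
  have h := (hj.differentiable s hs).hasDerivAt
  have h2 : HasDerivWithinAt j (deriv j s) (Ioi 0) s := h.hasDerivWithinAt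
  have := hj.antitone.derivWithin_nonpos (x := s)
  rwa [h2.derivWithin (isOpen_Ioi.uniqueDiffWithinAt hs)] at this

include hj in
lemma nextKernel_nonneg {s : ℝ} (hs : 0 ≤ s) : 0 ≤ nextKernel j s := by
  rcases hs.eq_or_lt with rfl | hs
  · simp [nextKernel]
  · have := hj.deriv_nonpos hs
    unfold nextKernel
    exact div_nonneg (by linarith) (by positivity)

include hj in
/-- The fundamental theorem of calculus needs no continuity of `j'`, since `j'` has a sign. -/
lemma lintegral_Ioo_deriv {a b : ℝ} (ha : 0 < a) (hb : 0 < b) :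
    ∫⁻ q in Ioo a b, ENNReal.ofReal (-deriv j q) = ENNReal.ofReal (j a - j b) := by
  rcases le_or_gt b a with hab | hab
  · have := hj.antitone (mem_Ioi.2 hb) (mem_Ioi.2 ha) hab
    rw [Ioo_eq_empty (not_lt.2 hab), ENNReal.ofReal_of_nonpos (by linarith)]
    simp
  have hc : ContinuousOn (fun q => -j q) (Icc a b) := fun x hx =>
    (hj.differentiable x (ha.trans_le hx.1)).continuousAt.neg.continuousWithinAt
  have hd : ∀ x ∈ Ioo a b, HasDerivAt (fun q => -j q) (-deriv j x) x := fun x hx =>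
    (hj.differentiable x (ha.trans hx.1)).hasDerivAt.neg
  have hp : ∀ x ∈ Ioo a b, 0 ≤ -deriv j x := fun x hx => by
    have := hj.deriv_nonpos (ha.trans hx.1); linarith
  have hi := intervalIntegral.integrableOn_deriv_of_nonneg hc hd hp
  have := intervalIntegral.integral_eq_sub_of_hasDerivAt_of_le hab.le hc hd
    ((intervalIntegrable_iff_integrableOn_Ioc_of_le hab.le).2 hi)
  rw [intervalIntegral.integral_of_le hab.le, integral_Ioc_eq_integral_Ioo] at this
  rw [← ofReal_integral_eq_lintegral_ofReal (hi.mono_set Ioo_subset_Ioc_self), this]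
  · congr 1; ring
  · exact (ae_restrict_mem measurableSet_Ioo).mono hp

include hj in
lemma lintegral_Ioi_deriv {a : ℝ} (ha : 0 < a) :
    ∫⁻ q in Ioi a, ENNReal.ofReal (-deriv j q) = ENNReal.ofReal (j a) := by
  have hc : ContinuousWithinAt (fun q => -j q) (Ici a) a :=
    (hj.differentiable a ha).continuousAt.neg.continuousWithinAt
  have hd : ∀ x ∈ Ioi a, HasDerivAt (fun q => -j q) (-deriv j x) x := fun x hx =>
    (hj.differentiable x (ha.trans hx)).hasDerivAt.neg
  have hp : ∀ x ∈ Ioi a, 0 ≤ -deriv j x := fun x hx => by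
    have := hj.deriv_nonpos (ha.trans hx); linarith
  have ht : Tendsto (fun q => -j q) atTop (𝓝 0) := by simpa using hj.tendsto_atTop.neg
  have := integral_Ioi_of_hasDerivAt_of_nonneg hc hd hp ht
  rw [← ofReal_integral_eq_lintegral_ofReal (integrableOn_Ioi_deriv_of_nonneg hc hd hp ht), this]
  · congr 1; ring
  · exact (ae_restrict_mem measurableSet_Ioi).mono hp

include hj in
/-- The density `-j'` cut off below `r` has the primitive `-j (max s r)`. -/
lemma lintegral_Ioo_tailDensity {r a b : ℝ} (hr : 0 < r) :
    ∫⁻ q in Ioo a b, tailDensity j r q = ENNReal.ofReal (j (max a r) - j (max b r)) := by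
  rw [tailDensity, setLIntegral_indicator measurableSet_Ioi,
    ← hj.lintegral_Ioo_deriv (lt_max_of_lt_right hr) (lt_max_of_lt_right hr)]
  congr 2
  ext q
  simp only [mem_inter_iff, mem_Ioi, mem_Ioo, max_lt_iff, lt_max_iff]
  constructor
  · rintro ⟨h1, h2, h3⟩; exact ⟨⟨h2, h1⟩, Or.inl h3⟩
  · rintro ⟨⟨h1, h2⟩, h3⟩; exact ⟨h2, h1, h3.resolve_right (not_lt.2 h2.le)⟩

include hj in
lemma lintegral_Ioi_tailDensity {r a : ℝ} (ha : 0 < a) :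
    ∫⁻ q in Ioi a, tailDensity j r q = ENNReal.ofReal (j (max a r)) := by
  rw [tailDensity, setLIntegral_indicator measurableSet_Ioi,
    ← hj.lintegral_Ioi_deriv (lt_max_of_lt_left ha), Ioi_inter_Ioi, max_comm]

end LevyProfile

/-- Integration in polar coordinates of a nonnegative radial function. -/
lemma lintegral_fun_norm {d : ℕ} (f : ℝ → ℝ≥0∞) (hf : Measurable f) :
    ∫⁻ x : E (d + 1), f ‖x‖ = (d + 1 : ℝ≥0∞) * volume (Metric.ball (0 : E (d + 1)) 1) *
      ∫⁻ r in Ioi (0 : ℝ), ENNReal.ofReal (r ^ d) * f r := by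
  have hd : Module.finrank ℝ (E (d + 1)) = d + 1 := by simp
  have hmp := (volume : Measure (E (d + 1))).measurePreserving_homeomorphUnitSphereProd
  calc ∫⁻ x : E (d + 1), f ‖x‖
      = ∫⁻ x : ({0}ᶜ : Set (E (d + 1))), f ‖x.1‖ ∂(volume.comap Subtype.val) := by
        rw [lintegral_subtype_comap (measurableSet_singleton _).compl fun x => f ‖x‖,
          restrict_compl_singleton]
    _ = ∫⁻ x, f x.2.1 ∂(volume : Measure (E (d + 1))).toSphere.prod (.volumeIoiPow d) := by
        have := hmp.lintegral_comp_emb (Homeomorph.measurableEmbedding _)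
          (fun x => f x.2.1)
        simpa [hd] using this
    _ = (volume : Measure (E (d + 1))).toSphere univ *
          ∫⁻ x : Ioi (0 : ℝ), f x.1 ∂.volumeIoiPow d := by
        rw [lintegral_prod _ (by fun_prop)]
        simp [mul_comm]
    _ = _ := by
        rw [Measure.volumeIoiPow, lintegral_withDensity_eq_lintegral_mul _ (by fun_prop)
          (by fun_prop), Measure.toSphere_apply_univ, hd]
        congr 1
        · push_cast; rfl
        · exact lintegral_subtype_comap measurableSet_Ioi
            (fun r => ENNReal.ofReal (r ^ d) * f r)

/-- Exchanging the order of integration over `0 < s < r`. -/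
lemma lintegral_mul_lintegral_Ioo (g D : ℝ → ℝ≥0∞) (hg : Measurable g) (hD : Measurable D) :
    ∫⁻ r in Ioi (0 : ℝ), (∫⁻ s in Ioo 0 r, g s) * D r =
      ∫⁻ s in Ioi (0 : ℝ), g s * ∫⁻ r in Ioi s, D r := by
  have h1 : ∀ r ∈ Ioi (0 : ℝ), (∫⁻ s in Ioo 0 r, g s) * D r =
      ∫⁻ s in Ioi (0 : ℝ), {p : ℝ × ℝ | p.2 < p.1}.indicator (fun p => g p.2 * D p.1) (r, s) := by
    intro r _
    rw [← lintegral_mul_const _ hg, ← Ioi_inter_Iio, inter_comm,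
      ← setLIntegral_indicator measurableSet_Iio]
    rfl
  have h2 : ∀ s ∈ Ioi (0 : ℝ), g s * ∫⁻ r in Ioi s, D r =
      ∫⁻ r in Ioi (0 : ℝ), {p : ℝ × ℝ | p.2 < p.1}.indicator (fun p => g p.2 * D p.1) (r, s) := by
    intro s hs
    rw [← lintegral_const_mul _ hD, ← inter_eq_left.2 (Ioi_subset_Ioi (le_of_lt hs)),
      ← setLIntegral_indicator measurableSet_Ioi]
    rfl
  rw [setLIntegral_congr_fun measurableSet_Ioi h1, setLIntegral_congr_fun measurableSet_Ioi h2]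
  refine lintegral_lintegral_swap (Measurable.aemeasurable ?_)
  refine Measurable.indicator (by fun_prop) (measurableSet_lt measurable_snd measurable_fst)

/-! ### The kernel in dimension `n + 2` -/

lemma ofReal_cut_nextKernel {j : ℝ → ℝ} {r q : ℝ} (hq : 0 < q) :
    ENNReal.ofReal ((Ioi r).indicator (nextKernel j) q) =
      ENNReal.ofReal (2 * Real.pi * q)⁻¹ * tailDensity j r q := by
  by_cases h : q ∈ Ioi r
  · rw [tailDensity, indicator_of_mem h, indicator_of_mem h, nextKernel,
      ← ENNReal.ofReal_mul (by positivity), div_eq_inv_mul]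
  · simp [tailDensity, indicator_of_notMem h]

/-- The recursion `(d + 2) |B^{d+2}| = 2π |B^d|` for the volume of the unit ball. -/
lemma volume_ball_add_two (m : ℕ) :
    ((m : ℝ≥0∞) + 3) * volume (Metric.ball (0 : E (m + 3)) 1) =
      ENNReal.ofReal (2 * Real.pi) * volume (Metric.ball (0 : E (m + 1)) 1) := by
  rw [EuclideanSpace.volume_ball, EuclideanSpace.volume_ball]
  simp only [Fintype.card_fin, ENNReal.ofReal_one, one_pow, one_mul]
  have h3 : ((m : ℝ≥0∞) + 3) = ENNReal.ofReal (m + 3) := by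
    rw [ENNReal.ofReal_add (by positivity) (by positivity)]; simp
  rw [h3, ← ENNReal.ofReal_mul (by positivity), ← ENNReal.ofReal_mul (by positivity)]
  congr 1
  have hg : Real.Gamma (((m + 3 : ℕ) : ℝ) / 2 + 1) =
      (((m : ℝ) + 3) / 2) * Real.Gamma (((m + 1 : ℕ) : ℝ) / 2 + 1) := by
    rw [Real.Gamma_add_one (by positivity)]
    congr 1
    · push_cast; ring
    · congr 1; push_cast; ring
  have hp : √Real.pi ^ (m + 3) = Real.pi * √Real.pi ^ (m + 1) := by
    rw [pow_add _ (m + 1) 2, Real.sq_sqrt Real.pi_pos.le]; ring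
  have hG : Real.Gamma (((m + 1 : ℕ) : ℝ) / 2 + 1) ≠ 0 :=
    (Real.Gamma_pos_of_pos (by positivity)).ne'
  rw [hg, hp]
  field_simp

namespace LevyProfile

variable {m : ℕ} {j : ℝ → ℝ} (hj : LevyProfile m j)

include hj in
lemma cut_nextKernel_nonneg (r : ℝ) {q : ℝ} (hq : 0 ≤ q) :
    0 ≤ (Ioi r).indicator (nextKernel j) q := by
  by_cases h : q ∈ Ioi r
  · rw [indicator_of_mem h]; exact hj.nextKernel_nonneg hq
  · rw [indicator_of_notMem h]

include hj in
lemma measurable_max {r : ℝ} (hr : 0 < r) : Measurable (fun s => j (max s r)) := by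
  have : Continuous (fun s => j (max s r)) := by
    rw [continuous_iff_continuousAt]
    intro s
    exact ContinuousAt.comp (f := fun s => max s r)
      (hj.differentiable _ (lt_max_of_lt_right hr)).continuousAt (by fun_prop)
  exact this.measurable

lemma lintegral_pow_Ioo (m : ℕ) {r : ℝ} (hr : 0 < r) :
    ∫⁻ s in Ioo 0 r, ENNReal.ofReal ((m + 1) * s ^ m) = ENNReal.ofReal (r ^ (m + 1)) := by
  have hi : IntegrableOn (fun s : ℝ => ((m : ℝ) + 1) * s ^ m) (Ioo 0 r) :=
    (Continuous.integrableOn_Icc (by fun_prop)).mono_set Ioo_subset_Icc_self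
  rw [← ofReal_integral_eq_lintegral_ofReal hi, ← integral_Ioc_eq_integral_Ioo,
    ← intervalIntegral.integral_of_le hr.le, intervalIntegral.integral_const_mul, integral_pow]
  · congr 1
    field_simp
    simp
  · refine (ae_restrict_mem measurableSet_Ioo).mono fun s hs => ?_
    have := hs.1
    positivity

include hj in
/-- The masses of the truncated kernels in dimensions `m + 3` and `m + 1` agree. -/
lemma lintegral_cut_nextKernel {r : ℝ} (hr : 0 < r) :
    ∫⁻ y : E (m + 3), ENNReal.ofReal ((Ioi r).indicator (nextKernel j) ‖y‖) =
      ∫⁻ x : E (m + 1), ENNReal.ofReal (j (max ‖x‖ r)) := by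
  rw [lintegral_fun_norm (d := m + 2)
      (fun q => ENNReal.ofReal ((Ioi r).indicator (nextKernel j) q))
      (((measurable_nextKernel j).indicator measurableSet_Ioi).ennreal_ofReal),
    lintegral_fun_norm (d := m) (fun q => ENNReal.ofReal (j (max q r)))
      (hj.measurable_max hr).ennreal_ofReal]
  have h1 : ∫⁻ q in Ioi (0 : ℝ), ENNReal.ofReal (q ^ (m + 2)) *
      ENNReal.ofReal ((Ioi r).indicator (nextKernel j) q) =
      ENNReal.ofReal (2 * Real.pi)⁻¹ * ∫⁻ q in Ioi (0 : ℝ),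
        (∫⁻ s in Ioo 0 q, ENNReal.ofReal ((m + 1) * s ^ m)) * tailDensity j r q := by
    rw [← lintegral_const_mul' _ _ ENNReal.ofReal_ne_top]
    refine setLIntegral_congr_fun measurableSet_Ioi fun q (hq : 0 < q) => ?_
    rw [ofReal_cut_nextKernel hq, lintegral_pow_Ioo m hq, ← mul_assoc, ← mul_assoc,
      ← ENNReal.ofReal_mul (by positivity), ← ENNReal.ofReal_mul (by positivity)]
    congr 2
    field_simp
    ring
  rw [h1, lintegral_mul_lintegral_Ioo _ _ (by fun_prop) (measurable_tailDensity j r)]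
  have h2 : ∫⁻ s in Ioi (0 : ℝ), ENNReal.ofReal ((m + 1) * s ^ m) *
      ∫⁻ q in Ioi s, tailDensity j r q = ENNReal.ofReal (m + 1) *
      ∫⁻ s in Ioi (0 : ℝ), ENNReal.ofReal (s ^ m) * ENNReal.ofReal (j (max s r)) := by
    rw [← lintegral_const_mul' _ _ ENNReal.ofReal_ne_top]
    refine setLIntegral_congr_fun measurableSet_Ioi fun s hs => ?_
    rw [hj.lintegral_Ioi_tailDensity hs, ENNReal.ofReal_mul (by positivity), mul_assoc]
  have h3 := volume_ball_add_two m
  have h4 : ((m + 2 : ℕ) : ℝ≥0∞) + 1 = (m : ℝ≥0∞) + 3 := by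
    push_cast; rw [add_assoc]; norm_num
  have h5 : ENNReal.ofReal ((m : ℝ) + 1) = (m : ℝ≥0∞) + 1 := by
    rw [ENNReal.ofReal_add (by positivity) (by positivity)]; simp
  have h6 : ENNReal.ofReal (2 * Real.pi) * ENNReal.ofReal (2 * Real.pi)⁻¹ = 1 := by
    rw [← ENNReal.ofReal_mul (by positivity), mul_inv_cancel₀ (by positivity)]; simp
  rw [h2, h4, h3, h5]
  calc _ = (ENNReal.ofReal (2 * Real.pi) * ENNReal.ofReal (2 * Real.pi)⁻¹) *
        (((m : ℝ≥0∞) + 1) * volume (Metric.ball (0 : E (m + 1)) 1) *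
        ∫⁻ s in Ioi (0 : ℝ), ENNReal.ofReal (s ^ m) * ENNReal.ofReal (j (max s r))) := by ring
    _ = _ := by rw [h6, one_mul]

include hj in
lemma integrable_max {r : ℝ} (hr : 0 < r) :
    Integrable (fun x : E (m + 1) => j (max ‖x‖ r)) := by
  have hm := hj.measurable_max hr
  have hc : 0 < min 1 (r ^ 2) := by positivity
  have h1 : Integrable (fun x : E (m + 1) =>
      (Metric.closedBall (0 : E (m + 1)) r).indicator (fun _ => j r) x +
        (min 1 (r ^ 2))⁻¹ * (min 1 (‖x‖ ^ 2) * j ‖x‖)) :=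
    ((integrable_indicator_iff measurableSet_closedBall).2
      (integrableOn_const measure_closedBall_lt_top.ne)).add (hj.integrable.const_mul _)
  refine h1.mono' (hm.comp measurable_norm).aestronglyMeasurable ?_
  have hne : ∀ᵐ x : E (m + 1), x ≠ 0 := by simp [ae_iff]
  filter_upwards [hne] with x hx
  have hx0 : 0 < ‖x‖ := norm_pos_iff.2 hx
  have hjx := hj.nonneg hx0
  have hmx := hj.nonneg (lt_max_of_lt_right hr : 0 < max ‖x‖ r)
  rw [Real.norm_eq_abs, abs_of_nonneg hmx]
  rcases le_or_gt ‖x‖ r with h | h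
  · rw [max_eq_right h, indicator_of_mem (by simpa using h)]
    have : 0 ≤ (min 1 (r ^ 2))⁻¹ * (min 1 (‖x‖ ^ 2) * j ‖x‖) := by positivity
    linarith
  · rw [max_eq_left h.le, indicator_of_notMem (by simpa using h), zero_add, ← mul_assoc]
    refine le_mul_of_one_le_left hjx ?_
    rw [inv_mul_eq_div, one_le_div hc]
    gcongr

include hj in
lemma integrable_cut_nextKernel {r : ℝ} (hr : 0 < r) :
    Integrable (fun y : E (m + 3) => (Ioi r).indicator (nextKernel j) ‖y‖) := by
  refine ⟨(((measurable_nextKernel j).indicator measurableSet_Ioi).comp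
    measurable_norm).aestronglyMeasurable, ?_⟩
  rw [hasFiniteIntegral_iff_ofReal, hj.lintegral_cut_nextKernel hr]
  · exact (hasFiniteIntegral_iff_ofReal (.of_forall fun x =>
      hj.nonneg (lt_max_of_lt_right hr))).1 (hj.integrable_max hr).2
  · exact .of_forall fun y => cut_nextKernel_nonneg hj r (norm_nonneg y)

include hj in
lemma integral_cut_nextKernel {r : ℝ} (hr : 0 < r) :
    ∫ y : E (m + 3), (Ioi r).indicator (nextKernel j) ‖y‖ =
      ∫ x : E (m + 1), j (max ‖x‖ r) := by
  rw [integral_eq_lintegral_of_nonneg_ae, integral_eq_lintegral_of_nonneg_ae,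
    hj.lintegral_cut_nextKernel hr]
  · exact .of_forall fun x => hj.nonneg (lt_max_of_lt_right hr)
  · exact (hj.integrable_max hr).1
  · exact .of_forall fun y => cut_nextKernel_nonneg hj r (norm_nonneg y)
  · exact (hj.integrable_cut_nextKernel hr).1

/-- Up to a constant, the weight `r^{m+1} min(1, r²)` is at most the primitive of
`s^m min(1, s²)`. -/
lemma weight_le_lintegral (m : ℕ) {r : ℝ} (hr : 0 < r) :
    ENNReal.ofReal (r ^ (m + 1) * min 1 (r ^ 2)) ≤ ENNReal.ofReal (2 ^ (m + 3)) *
      ∫⁻ s in Ioo 0 r, ENNReal.ofReal (s ^ m * min 1 (s ^ 2)) := by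
  have hle : ENNReal.ofReal ((r / 2) ^ m * min 1 ((r / 2) ^ 2)) * ENNReal.ofReal (r / 2) ≤
      ∫⁻ s in Ioo 0 r, ENNReal.ofReal (s ^ m * min 1 (s ^ 2)) := by
    have hv : ENNReal.ofReal (r / 2) = volume (Ioo (r / 2) r) := by
      rw [Real.volume_Ioo]; congr 1; ring
    rw [hv, ← setLIntegral_const]
    refine (setLIntegral_mono' measurableSet_Ioo fun s hs => ?_).trans
      (lintegral_mono_set (Ioo_subset_Ioo_left (by positivity)))
    have h1 : r / 2 ≤ s := hs.1.le
    have h0 : 0 < s := by linarith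
    gcongr
  refine le_trans ?_ (mul_le_mul_right hle _)
  rw [← ENNReal.ofReal_mul (by positivity), ← ENNReal.ofReal_mul (by positivity)]
  refine ENNReal.ofReal_le_ofReal ?_
  have h4 : min 1 (r ^ 2) ≤ 4 * min 1 ((r / 2) ^ 2) := by
    rcases min_cases 1 ((r / 2) ^ 2) with h | h <;> rw [h.1]
    · exact (min_le_left _ _).trans (by norm_num)
    · exact (min_le_right _ _).trans (by ring_nf; rfl)
  calc r ^ (m + 1) * min 1 (r ^ 2) ≤ r ^ (m + 1) * (4 * min 1 ((r / 2) ^ 2)) := by gcongr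
    _ = 2 ^ (m + 3) * ((r / 2) ^ m * min 1 ((r / 2) ^ 2) * (r / 2)) := by
      rw [div_pow r 2 m]; field_simp; ring

include hj in
/-- `j_{n+2}` is again the kernel of a Lévy-type operator. -/
lemma integrable_nextKernel :
    Integrable (fun y : E (m + 3) => min 1 (‖y‖ ^ 2) * nextKernel j ‖y‖) := by
  have hmeas : Measurable (fun q : ℝ => min 1 (q ^ 2) * nextKernel j q) :=
    Measurable.mul (by fun_prop) (measurable_nextKernel j)
  refine ⟨(hmeas.comp measurable_norm).aestronglyMeasurable, ?_⟩
  rw [hasFiniteIntegral_iff_ofReal (.of_forall fun y =>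
      mul_nonneg (by positivity) (hj.nextKernel_nonneg (norm_nonneg y))),
    lintegral_fun_norm (d := m + 2) (fun q => ENNReal.ofReal (min 1 (q ^ 2) * nextKernel j q))
      hmeas.ennreal_ofReal]
  refine ENNReal.mul_lt_top (ENNReal.mul_lt_top (by finiteness) measure_ball_lt_top) ?_
  have h1 : ∀ q ∈ Ioi (0 : ℝ), ENNReal.ofReal (q ^ (m + 2)) *
      ENNReal.ofReal (min 1 (q ^ 2) * nextKernel j q) ≤
      (ENNReal.ofReal (2 * Real.pi)⁻¹ * ENNReal.ofReal (2 ^ (m + 3))) *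
        ((∫⁻ s in Ioo 0 q, ENNReal.ofReal (s ^ m * min 1 (s ^ 2))) * tailDensity j 0 q) := by
    intro q (hq : 0 < q)
    have h := ofReal_cut_nextKernel (j := j) (r := 0) hq
    rw [indicator_of_mem (by exact hq)] at h
    calc _ = ENNReal.ofReal (2 * Real.pi)⁻¹ * (ENNReal.ofReal (q ^ (m + 1) * min 1 (q ^ 2)) *
          tailDensity j 0 q) := by
          rw [ENNReal.ofReal_mul (by positivity), h, ← mul_assoc, ← mul_assoc, ← mul_assoc,
            ← ENNReal.ofReal_mul (by positivity), ← ENNReal.ofReal_mul (by positivity),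
            ← ENNReal.ofReal_mul (by positivity)]
          congr 2
          field_simp
          ring
      _ ≤ ENNReal.ofReal (2 * Real.pi)⁻¹ * ((ENNReal.ofReal (2 ^ (m + 3)) *
          ∫⁻ s in Ioo 0 q, ENNReal.ofReal (s ^ m * min 1 (s ^ 2))) * tailDensity j 0 q) := by
          gcongr
          exact weight_le_lintegral m hq
      _ = _ := by ring
  refine (setLIntegral_mono' measurableSet_Ioi h1).trans_lt ?_
  rw [lintegral_const_mul' _ _ (by finiteness), lintegral_mul_lintegral_Ioo _ _ (by fun_prop)
    (measurable_tailDensity j 0)]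
  refine ENNReal.mul_lt_top (by finiteness) ?_
  have h2 : ∫⁻ s in Ioi (0 : ℝ), ENNReal.ofReal (s ^ m * min 1 (s ^ 2)) *
      ∫⁻ q in Ioi s, tailDensity j 0 q =
      ∫⁻ s in Ioi (0 : ℝ), ‖s ^ m • (min 1 (s ^ 2) * j s)‖ₑ := by
    refine setLIntegral_congr_fun measurableSet_Ioi fun s (hs : 0 < s) => ?_
    have := hj.nonneg hs
    rw [hj.lintegral_Ioi_tailDensity hs, max_eq_left hs.le, Real.enorm_of_nonneg (by positivity),
      ← ENNReal.ofReal_mul (by positivity), smul_eq_mul, mul_assoc]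
  rw [h2]
  have := (integrable_fun_norm_addHaar (E := E (m + 1)) volume
    (f := fun s => min 1 (s ^ 2) * j s)).1 hj.integrable
  have h3 := this.2
  rw [hasFiniteIntegral_iff_enorm] at h3
  simpa only [finrank_euclideanSpace_fin, Nat.add_sub_cancel] using h3

end LevyProfile

/-! ### Spherical coordinates in `ℝ³` -/

/-- The point of `ℝ^{d+1}` with first coordinate `t` and remaining coordinates `y`. -/
def consE {d : ℕ} (t : ℝ) (y : E d) : E (d + 1) := WithLp.toLp 2 (Fin.cons t y.ofLp)

@[simp] lemma consE_zero {d : ℕ} (t : ℝ) (y : E d) : consE t y 0 = t := rfl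

@[simp] lemma consE_succ {d : ℕ} (t : ℝ) (y : E d) (i : Fin d) : consE t y i.succ = y i := rfl

lemma norm_sq_consE {d : ℕ} (t : ℝ) (y : E d) : ‖consE t y‖ ^ 2 = t ^ 2 + ‖y‖ ^ 2 := by
  simp [EuclideanSpace.norm_sq_eq, Fin.sum_univ_succ]

lemma consE_sub {d : ℕ} (t s : ℝ) (y z : E d) : consE t y - consE s z = consE (t - s) (y - z) := by
  ext i
  refine Fin.cases ?_ (fun i => ?_) i <;> simp

lemma norm_consE_sub {d : ℕ} (t s : ℝ) (y z : E d) :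
    ‖consE t y - consE s z‖ = √((t - s) ^ 2 + ‖y - z‖ ^ 2) := by
  rw [consE_sub, ← norm_sq_consE, Real.sqrt_sq (norm_nonneg _)]

lemma reflect_consE {d : ℕ} (t : ℝ) (y : E d) : reflect (consE t y) = consE (-t) y := by
  ext i
  refine Fin.cases ?_ (fun i => ?_) i
  · simp [reflect]
  · simp [reflect]

lemma measurePreserving_consE (d : ℕ) :
    MeasurePreserving (fun p : ℝ × E d => consE p.1 p.2) (volume.prod volume) volume := by
  have h1 : MeasurePreserving (fun p : ℝ × E d => (p.1, p.2.ofLp))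
      (volume.prod volume) (volume.prod volume) :=
    (MeasurePreserving.id volume).prod (PiLp.volume_preserving_ofLp (Fin d))
  have h2 := (volume_preserving_piFinSuccAbove (fun _ : Fin (d + 1) => ℝ) 0).symm
  have h3 := PiLp.volume_preserving_toLp (Fin (d + 1))
  have := h3.comp (h2.comp h1)
  have hfun : (fun p : ℝ × E d => consE p.1 p.2) = WithLp.toLp 2 ∘
      (MeasurableEquiv.piFinSuccAbove (fun _ : Fin (d + 1) => ℝ) 0).symm ∘
        fun p : ℝ × E d => (p.1, p.2.ofLp) := by
    funext p
    simp [consE, MeasurableEquiv.piFinSuccAbove, Fin.insertNthEquiv]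
  rw [hfun]
  exact this

lemma measurable_consE (d : ℕ) : Measurable (fun p : ℝ × E d => consE p.1 p.2) :=
  (measurePreserving_consE d).measurable

lemma lintegral_consE {d : ℕ} {f : E (d + 1) → ℝ≥0∞} (hf : Measurable f) :
    ∫⁻ x, f x = ∫⁻ t : ℝ, ∫⁻ y : E d, f (consE t y) := by
  rw [← (measurePreserving_consE d).lintegral_comp hf, lintegral_prod]
  exact (hf.comp (measurable_consE d)).aemeasurable

lemma measurable_consE_left {d : ℕ} (t : ℝ) : Measurable (fun y : E d => consE t y) :=
  (measurable_consE d).comp measurable_prodMk_left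

/-- The point of `ℝ^{m+3} = ℝ³ × ℝᵐ` with components `w` and `y`. -/
def glue {m : ℕ} (w : E 3) (y : E m) : E (m + 3) := consE (w 0) (consE (w 1) (consE (w 2) y))

lemma measurable_glue (m : ℕ) : Measurable (fun p : E 3 × E m => glue p.1 p.2) := by
  unfold glue
  refine (measurable_consE _).comp (Measurable.prodMk (by fun_prop) ?_)
  refine (measurable_consE _).comp (Measurable.prodMk (by fun_prop) ?_)
  exact (measurable_consE _).comp (Measurable.prodMk (by fun_prop) (by fun_prop))

lemma lintegral_E_three {f : E 3 → ℝ≥0∞} (hf : Measurable f) :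
    ∫⁻ w, f w = ∫⁻ a : ℝ, ∫⁻ b : ℝ, ∫⁻ c : ℝ, f (consE a (consE b (consE c 0))) := by
  rw [lintegral_consE hf]
  refine lintegral_congr fun a => ?_
  have h1 := hf.comp (measurable_consE_left a)
  rw [show (fun y => f (consE a y)) = f ∘ fun y => consE a y from rfl, lintegral_consE h1]
  refine lintegral_congr fun b => ?_
  have h2 := h1.comp (measurable_consE_left b)
  rw [show (fun y => (f ∘ fun y => consE a y) (consE b y)) =
    (f ∘ fun y => consE a y) ∘ fun y => consE b y from rfl, lintegral_consE h2]
  refine lintegral_congr fun c => ?_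
  rw [volume_euclideanSpace_eq_dirac, lintegral_dirac]
  rfl

lemma lintegral_glue {m : ℕ} {f : E (m + 3) → ℝ≥0∞} (hf : Measurable f) :
    ∫⁻ x, f x = ∫⁻ w : E 3, ∫⁻ y : E m, f (glue w y) := by
  have h0 : Measurable fun w : E 3 => ∫⁻ y : E m, f (glue w y) :=
    (hf.comp (measurable_glue m)).lintegral_prod_right'
  rw [lintegral_E_three h0, lintegral_consE hf]
  refine lintegral_congr fun a => ?_
  have h1 := hf.comp (measurable_consE_left a)
  rw [show (fun y => f (consE a y)) = f ∘ fun y => consE a y from rfl, lintegral_consE h1]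
  refine lintegral_congr fun b => ?_
  have h2 := h1.comp (measurable_consE_left b)
  rw [show (fun y => (f ∘ fun y => consE a y) (consE b y)) =
    (f ∘ fun y => consE a y) ∘ fun y => consE b y from rfl, lintegral_consE h2]
  rfl

lemma collapse_glue {m : ℕ} (w : E 3) (y : E m) : collapse (glue w y) = consE ‖w‖ y := by
  have h : ‖w‖ = √(w 0 ^ 2 + w 1 ^ 2 + w 2 ^ 2) := by
    simp [EuclideanSpace.norm_eq, Fin.sum_univ_three]
  rw [h]
  ext i
  refine Fin.cases ?_ (fun i => ?_) i
  · simp [collapse, glue, consE]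
    rfl
  · simp [collapse, glue, consE]
    rfl

lemma exists_glue {m : ℕ} (x : E (m + 3)) : ∃ w y, x = glue (m := m) w y := by
  refine ⟨!₂[x 0, x 1, x 2], WithLp.toLp 2 fun i => x (i.addNat 3), ?_⟩
  ext i
  refine Fin.cases rfl (fun i => Fin.cases rfl (fun i => Fin.cases rfl (fun i => rfl) i) i) i

lemma norm_glue_sub {m : ℕ} (w p : E 3) (y z : E m) :
    ‖glue w y - glue p z‖ = √(‖w - p‖ ^ 2 + ‖y - z‖ ^ 2) := by
  unfold glue
  rw [norm_consE_sub, consE_sub, norm_sq_consE, consE_sub, norm_sq_consE,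
    EuclideanSpace.norm_sq_eq (w - p), Fin.sum_univ_three]
  simp
  congr 1; ring

/-- Integration in `ℝ³` of a nonnegative function of `|w|` and of the component of `w` in a fixed
direction, in spherical coordinates with that direction as axis. -/
lemma lintegral_spherical (G : ℝ × ℝ → ℝ≥0∞) (hG : Measurable G) {p : E 3} (hp : ‖p‖ = 1) :
    ∫⁻ w : E 3, G (‖w‖, inner ℝ w p) = ∫⁻ s in Ioi (0 : ℝ), ∫⁻ α in Ioo 0 Real.pi,
      ENNReal.ofReal (2 * Real.pi * s ^ 2 * Real.sin α) * G (s, s * Real.cos α) := by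
  -- a reflection moves the axis to the first coordinate axis
  set e : E 3 := EuclideanSpace.single 0 1 with he
  have hep : ‖p‖ = ‖e‖ := by simp [he, hp]
  set R : E 3 ≃ₗᵢ[ℝ] E 3 := (ℝ ∙ (p - e))ᗮ.reflection
  have hR : R p = e := Submodule.reflection_sub hep
  have h1 : ∫⁻ w : E 3, G (‖w‖, inner ℝ w p) = ∫⁻ w : E 3, G (‖w‖, w 0) := by
    have hm : Measurable fun w : E 3 => G (‖w‖, w 0) := by fun_prop
    rw [← R.measurePreserving.lintegral_comp hm]
    refine lintegral_congr fun w => ?_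
    have : inner ℝ w p = R w 0 := by
      rw [← R.inner_map_map w p, hR, he, EuclideanSpace.inner_single_right]; simp
    rw [R.norm_map, this]
  have h2 : ∀ a b c : ℝ, ‖consE a (consE b (consE c (0 : E 0)))‖ = √(a ^ 2 + (b ^ 2 + c ^ 2)) := by
    intro a b c
    rw [← Real.sqrt_sq (norm_nonneg _), norm_sq_consE, norm_sq_consE, norm_sq_consE]
    simp
  rw [h1, lintegral_E_three (by fun_prop)]
  simp only [h2, consE_zero]
  -- polar coordinates in the plane orthogonal to the axis
  have h3 : ∀ a : ℝ, ∫⁻ b : ℝ, ∫⁻ c : ℝ, G (√(a ^ 2 + (b ^ 2 + c ^ 2)), a) =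
      ENNReal.ofReal (2 * Real.pi) * ∫⁻ τ : ℝ, (Ioi (0 : ℝ)).indicator
        (fun τ => ENNReal.ofReal τ * G (√(a ^ 2 + τ ^ 2), a)) τ := by
    intro a
    have hm : Measurable fun q : ℝ × ℝ => G (√(a ^ 2 + (q.1 ^ 2 + q.2 ^ 2)), a) := by fun_prop
    have h4 := lintegral_prod (μ := volume) (ν := volume) _ hm.aemeasurable
    simp only at h4
    rw [← h4, ← Measure.volume_eq_prod, ← lintegral_comp_polarCoord_symm]
    have h5 : ∀ q : ℝ × ℝ, ENNReal.ofReal q.1 • G (√(a ^ 2 + ((polarCoord.symm q).1 ^ 2 +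
        (polarCoord.symm q).2 ^ 2)), a) = ENNReal.ofReal q.1 * G (√(a ^ 2 + q.1 ^ 2), a) := by
      intro q
      have : (q.1 * Real.cos q.2) ^ 2 + (q.1 * Real.sin q.2) ^ 2 = q.1 ^ 2 := by
        linear_combination q.1 ^ 2 * Real.sin_sq_add_cos_sq q.2
      simp [this]
    simp only [h5]
    rw [polarCoord_target, Measure.volume_eq_prod, ← Measure.prod_restrict, lintegral_prod _
      (by fun_prop)]
    simp only [lintegral_const, Measure.restrict_apply MeasurableSet.univ, univ_inter,
      Real.volume_Ioo]
    rw [lintegral_mul_const _ (by fun_prop), lintegral_indicator measurableSet_Ioi, mul_comm]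
    congr 2
    ring
  simp only [h3]
  rw [lintegral_const_mul' _ _ ENNReal.ofReal_ne_top]
  -- polar coordinates in the half-plane of the axial and the radial coordinate
  have hm : Measurable fun q : ℝ × ℝ => (Ioi (0 : ℝ)).indicator
      (fun τ => ENNReal.ofReal τ * G (√(q.1 ^ 2 + τ ^ 2), q.1)) q.2 := by
    have : (fun q : ℝ × ℝ => (Ioi (0 : ℝ)).indicator
        (fun τ => ENNReal.ofReal τ * G (√(q.1 ^ 2 + τ ^ 2), q.1)) q.2) =
        (Prod.snd ⁻¹' Ioi (0 : ℝ)).indicator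
        (fun q : ℝ × ℝ => ENNReal.ofReal q.2 * G (√(q.1 ^ 2 + q.2 ^ 2), q.1)) := by
      ext q; rfl
    rw [this]
    exact Measurable.indicator (by fun_prop) (measurable_snd measurableSet_Ioi)
  have h4 := lintegral_prod (μ := volume) (ν := volume) _ hm.aemeasurable
  simp only at h4
  rw [← h4, ← Measure.volume_eq_prod, ← lintegral_comp_polarCoord_symm, polarCoord_target,
    Measure.volume_eq_prod, ← Measure.prod_restrict, lintegral_prod,
    ← lintegral_const_mul' _ _ ENNReal.ofReal_ne_top]
  · refine setLIntegral_congr_fun measurableSet_Ioi fun s (hs : 0 < s) => ?_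
    rw [← lintegral_const_mul' _ _ ENNReal.ofReal_ne_top,
      ← inter_eq_left.2 (Ioo_subset_Ioo_left (neg_nonpos.2 Real.pi_pos.le) :
        Ioo 0 Real.pi ⊆ Ioo (-Real.pi) Real.pi),
      ← setLIntegral_indicator measurableSet_Ioo]
    refine setLIntegral_congr_fun measurableSet_Ioo fun α hα => ?_
    simp only [polarCoord_symm_apply]
    by_cases h : 0 < α
    · have hsin := Real.sin_pos_of_pos_of_lt_pi h hα.2
      rw [indicator_of_mem (by simp; positivity), indicator_of_mem (by exact ⟨h, hα.2⟩)]
      have : (s * Real.cos α) ^ 2 + (s * Real.sin α) ^ 2 = s ^ 2 := by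
        linear_combination s ^ 2 * Real.sin_sq_add_cos_sq α
      rw [this, Real.sqrt_sq hs.le, smul_eq_mul, ← mul_assoc, ← mul_assoc,
        ← ENNReal.ofReal_mul (by positivity), ← ENNReal.ofReal_mul (by positivity)]
      congr 2
      ring
    · have hsin := Real.sin_nonpos_of_nonpos_of_neg_pi_le (not_lt.1 h) hα.1.le
      rw [indicator_of_notMem (by simp; nlinarith), indicator_of_notMem (by simp [h])]
      simp
  · have : Measurable fun q : ℝ × ℝ => polarCoord.symm q := continuous_polarCoord_symm.measurable
    exact (measurable_fst.ennreal_ofReal.smul (hm.comp this)).aemeasurable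

/-! ### Integration over the fibres of the lifting map -/

lemma measurable_collapse (m : ℕ) : Measurable (collapse : E (m + 3) → E (m + 1)) := by
  have h : (collapse : E (m + 3) → E (m + 1)) = fun x =>
      consE (√(x 0 ^ 2 + x 1 ^ 2 + x 2 ^ 2)) (WithLp.toLp 2 fun i : Fin m => x (i.addNat 3)) := rfl
  rw [h]
  refine (measurable_consE _).comp (Measurable.prodMk (by fun_prop) ?_)
  exact (by fun_prop : Continuous fun x : E (m + 3) =>
    WithLp.toLp 2 fun i : Fin m => x (i.addNat 3)).measurable

lemma measurableSet_halfspace (m : ℕ) : MeasurableSet {z : E (m + 1) | 0 < z 0} :=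
  measurableSet_lt measurable_const (by fun_prop)

lemma setLIntegral_halfspace {m : ℕ} {f : E (m + 1) → ℝ≥0∞} (hf : Measurable f) :
    ∫⁻ z in {z : E (m + 1) | 0 < z 0}, f z = ∫⁻ y : E m, ∫⁻ s in Ioi (0 : ℝ), f (consE s y) := by
  rw [← lintegral_indicator (measurableSet_halfspace m),
    lintegral_consE (hf.indicator (measurableSet_halfspace m)), lintegral_lintegral_swap]
  · refine lintegral_congr fun y => ?_
    rw [← lintegral_indicator measurableSet_Ioi]
    rfl
  · exact ((hf.indicator (measurableSet_halfspace m)).comp (measurable_consE m)).aemeasurable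

/-- Integration in spherical coordinates of a function on `ℝ^{m+3}` that depends on `w ∈ ℝ³` only
through `|w|` and its component in a fixed direction. -/
lemma lintegral_glue_spherical {m : ℕ} (G : (ℝ × ℝ) × E m → ℝ≥0∞) (hG : Measurable G) {p : E 3}
    (hp : ‖p‖ = 1) :
    ∫⁻ w : E 3, ∫⁻ y : E m, G ((‖w‖, inner ℝ w p), y) = ∫⁻ y : E m, ∫⁻ s in Ioi (0 : ℝ),
      ∫⁻ α in Ioo 0 Real.pi,
        ENNReal.ofReal (2 * Real.pi * s ^ 2 * Real.sin α) * G ((s, s * Real.cos α), y) := by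
  rw [lintegral_lintegral_swap]
  · refine lintegral_congr fun y => ?_
    exact lintegral_spherical (fun q => G (q, y)) (hG.comp measurable_prodMk_right) hp
  · have : Measurable fun q : E 3 × E m => ((‖q.1‖, inner ℝ q.1 p), q.2) := by fun_prop
    exact (hG.comp this).aemeasurable

lemma lintegral_sin (c : ℝ) (hc : 0 ≤ c) :
    ∫⁻ α in Ioo 0 Real.pi, ENNReal.ofReal (c * Real.sin α) = ENNReal.ofReal (2 * c) := by
  have hi : IntegrableOn (fun α => c * Real.sin α) (Ioo 0 Real.pi) :=
    (Continuous.integrableOn_Icc (by fun_prop)).mono_set Ioo_subset_Icc_self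
  rw [← ofReal_integral_eq_lintegral_ofReal hi, ← integral_Ioc_eq_integral_Ioo,
    ← intervalIntegral.integral_of_le Real.pi_pos.le, intervalIntegral.integral_const_mul,
    integral_sin]
  · congr 1
    simp; ring
  · refine (ae_restrict_mem measurableSet_Ioo).mono fun s hs => ?_
    exact mul_nonneg hc (Real.sin_pos_of_pos_of_lt_pi hs.1 hs.2).le

/-- The image of Lebesgue measure under `collapse` has density `4π z₁²` on the half-space. -/
lemma lintegral_collapse {m : ℕ} {F : E (m + 1) → ℝ≥0∞} (hF : Measurable F) :
    ∫⁻ x : E (m + 3), F (collapse x) =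
      ∫⁻ z in {z : E (m + 1) | 0 < z 0}, ENNReal.ofReal (4 * Real.pi * z 0 ^ 2) * F z := by
  have hp : ‖(EuclideanSpace.single 0 1 : E 3)‖ = 1 := by simp
  rw [lintegral_glue (f := fun x => F (collapse x)) (hF.comp (measurable_collapse m)),
    setLIntegral_halfspace (f := fun z => ENNReal.ofReal (4 * Real.pi * z 0 ^ 2) * F z)
      (Measurable.mul (by fun_prop) hF)]
  simp only [collapse_glue, consE_zero]
  have hG : Measurable fun q : (ℝ × ℝ) × E m => F (consE q.1.1 q.2) := by
    have h1 : Measurable fun q : (ℝ × ℝ) × E m => (q.1.1, q.2) := by fun_prop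
    exact hF.comp ((measurable_consE m).comp h1)
  rw [lintegral_glue_spherical _ hG hp]
  refine lintegral_congr fun y => setLIntegral_congr_fun measurableSet_Ioi fun s hs => ?_
  simp only
  rw [lintegral_mul_const _ (by fun_prop), lintegral_sin _ (by positivity)]
  congr 2
  ring

/-- The integral of the truncated kernel `j_{n+2}` over a sphere of radius `s` in `ℝ³`. The
substitution of the distance `q` for the angle `α` has the Jacobian `ρ s sin α / q`, which cancels
the factor `1 / q` in `j_{n+2}(q) = -j'(q) / (2 π q)`. -/
lemma LevyProfile.lintegral_angle {m : ℕ} {j : ℝ → ℝ} (hj : LevyProfile m j) {r s ρ b : ℝ}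
    (hr : 0 < r) (hs : 0 < s) (hρ : 0 < ρ) (hb : 0 ≤ b) :
    ∫⁻ α in Ioo 0 Real.pi, ENNReal.ofReal (2 * Real.pi * s ^ 2 * Real.sin α) *
      ENNReal.ofReal ((Ioi r).indicator (nextKernel j)
        (√(s ^ 2 + ρ ^ 2 - 2 * ρ * (s * Real.cos α) + b))) =
      ENNReal.ofReal (s / ρ *
        (j (max (√((s - ρ) ^ 2 + b)) r) - j (max (√((s + ρ) ^ 2 + b)) r))) := by
  set q : ℝ → ℝ := fun α => √(s ^ 2 + ρ ^ 2 - 2 * ρ * (s * Real.cos α) + b) with hq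
  have hpos : ∀ α ∈ Ioo 0 Real.pi, 0 < s ^ 2 + ρ ^ 2 - 2 * ρ * (s * Real.cos α) + b := by
    intro α hα
    have h1 : Real.cos α < 1 := by
      rw [← Real.cos_zero]
      exact Real.cos_lt_cos_of_nonneg_of_le_pi le_rfl hα.2.le hα.1
    have : 0 < 2 * ρ * s * (1 - Real.cos α) := by
      have : 0 < 1 - Real.cos α := by linarith
      positivity
    nlinarith [sq_nonneg (s - ρ)]
  have hmono : StrictMonoOn q (Icc 0 Real.pi) := by
    intro α hα β hβ hαβ
    have h1 : Real.cos β < Real.cos α := Real.strictAntiOn_cos hα hβ hαβ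
    refine Real.sqrt_lt_sqrt ?_ ?_
    · have : 0 ≤ 2 * ρ * s * (1 - Real.cos α) := by
        have : 0 ≤ 1 - Real.cos α := by linarith [Real.cos_le_one α]
        positivity
      nlinarith [sq_nonneg (s - ρ)]
    · have : 0 < 2 * ρ * s * (Real.cos α - Real.cos β) := by
        have : 0 < Real.cos α - Real.cos β := by linarith
        positivity
      nlinarith
  have hcont : ContinuousOn q (Icc 0 Real.pi) := by fun_prop
  have himg : q '' Ioo 0 Real.pi = Ioo (q 0) (q Real.pi) := by
    refine Subset.antisymm ?_ (intermediate_value_Ioo Real.pi_pos.le hcont)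
    rintro _ ⟨α, hα, rfl⟩
    exact ⟨hmono (left_mem_Icc.2 Real.pi_pos.le) (Ioo_subset_Icc_self hα) hα.1,
      hmono (Ioo_subset_Icc_self hα) (right_mem_Icc.2 Real.pi_pos.le) hα.2⟩
  have hderiv : ∀ α ∈ Ioo 0 Real.pi,
      HasDerivWithinAt q (ρ * s * Real.sin α / q α) (Ioo 0 Real.pi) α := by
    intro α hα
    have h1 : HasDerivAt (fun α => s ^ 2 + ρ ^ 2 - 2 * ρ * (s * Real.cos α) + b)
        (-(2 * ρ * (s * -Real.sin α))) α :=
      ((((Real.hasDerivAt_cos α).const_mul s).const_mul (2 * ρ)).const_sub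
        (s ^ 2 + ρ ^ 2)).add_const b
    have h2 := h1.sqrt (hpos α hα).ne'
    refine h2.hasDerivWithinAt.congr_deriv ?_
    change _ = ρ * s * Real.sin α / √(s ^ 2 + ρ ^ 2 - 2 * ρ * (s * Real.cos α) + b)
    field_simp
  have hcv := lintegral_image_eq_lintegral_abs_deriv_mul measurableSet_Ioo hderiv
    (hmono.injOn.mono Ioo_subset_Icc_self) (tailDensity j r)
  have hq0 : q 0 = √((s - ρ) ^ 2 + b) := by
    simp only [hq, Real.cos_zero]; congr 1; ring
  have hqp : q Real.pi = √((s + ρ) ^ 2 + b) := by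
    simp only [hq, Real.cos_pi]; congr 1; ring
  rw [ENNReal.ofReal_mul (by positivity), ← hq0, ← hqp, ← hj.lintegral_Ioo_tailDensity hr, ← himg,
    hcv, ← lintegral_const_mul' _ _ ENNReal.ofReal_ne_top]
  refine setLIntegral_congr_fun measurableSet_Ioo fun α hα => ?_
  have hqα : 0 < q α := Real.sqrt_pos.2 (hpos α hα)
  have hsin := Real.sin_pos_of_pos_of_lt_pi hα.1 hα.2
  rw [ofReal_cut_nextKernel hqα, abs_of_nonneg (by positivity), ← mul_assoc, ← mul_assoc,
    ← ENNReal.ofReal_mul (by positivity), ← ENNReal.ofReal_mul (by positivity)]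
  congr 2
  field_simp

/-- Integrating the truncated kernel `j_{n+2}` over the fibres of `collapse` gives the difference
of the values of `j` at the two mirror images. -/
lemma LevyProfile.lintegral_collapse_mul_cut {m : ℕ} {j : ℝ → ℝ} (hj : LevyProfile m j) {r : ℝ}
    (hr : 0 < r) {F : E (m + 1) → ℝ≥0∞} (hF : Measurable F) {x : E (m + 3)}
    (hx : 0 < collapse x 0) :
    ∫⁻ z, F (collapse z) * ENNReal.ofReal ((Ioi r).indicator (nextKernel j) ‖z - x‖) =
      ∫⁻ z in {z : E (m + 1) | 0 < z 0}, F z * ENNReal.ofReal (z 0 / collapse x 0 *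
        (j (max ‖z - collapse x‖ r) - j (max ‖reflect z - collapse x‖ r))) := by
  obtain ⟨p, x', rfl⟩ := exists_glue x
  rw [collapse_glue, consE_zero] at hx
  set k := (Ioi r).indicator (nextKernel j) with hk
  have hkm : Measurable k := (measurable_nextKernel j).indicator measurableSet_Ioi
  have hm1 : Measurable fun z => F (collapse z) * ENNReal.ofReal (k ‖z - glue p x'‖) :=
    (hF.comp (measurable_collapse m)).mul (hkm.comp (by fun_prop)).ennreal_ofReal
  have hjm := hj.measurable_max hr
  have hm2 : Measurable fun z : E (m + 1) => F z * ENNReal.ofReal (z 0 / ‖p‖ *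
      (j (max ‖z - consE ‖p‖ x'‖ r) - j (max ‖reflect z - consE ‖p‖ x'‖ r))) := by
    refine hF.mul (Measurable.ennreal_ofReal (Measurable.mul (by fun_prop) (Measurable.sub ?_ ?_)))
    · exact hjm.comp (g := fun s => j (max s r)) (f := fun z : E (m + 1) => ‖z - consE ‖p‖ x'‖)
        (by fun_prop)
    · exact hjm.comp (g := fun s => j (max s r))
        (f := fun z : E (m + 1) => ‖reflect z - consE ‖p‖ x'‖)
        ((measurePreserving_reflect.measurable.sub_const _).norm)
  rw [lintegral_glue hm1, collapse_glue, consE_zero, setLIntegral_halfspace hm2]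
  simp only [collapse_glue, norm_glue_sub, reflect_consE, consE_zero, norm_consE_sub]
  have hunit : ‖(‖p‖⁻¹ : ℝ) • p‖ = 1 := by
    rw [norm_smul, norm_inv, norm_norm, inv_mul_cancel₀ hx.ne']
  -- the law of cosines, with the direction of `p` as axis of the spherical coordinates
  have hw : ∀ w : E 3, ‖w - p‖ ^ 2 = ‖w‖ ^ 2 + ‖p‖ ^ 2 -
      2 * ‖p‖ * inner ℝ w ((‖p‖⁻¹ : ℝ) • p) := by
    intro w
    rw [norm_sub_sq_real, inner_smul_right]
    field_simp
    ring
  simp only [hw]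
  have hG : Measurable fun q : (ℝ × ℝ) × E m => F (consE q.1.1 q.2) *
      ENNReal.ofReal (k (√(q.1.1 ^ 2 + ‖p‖ ^ 2 - 2 * ‖p‖ * q.1.2 + ‖q.2 - x'‖ ^ 2))) := by
    have h1 : Measurable fun q : (ℝ × ℝ) × E m => (q.1.1, q.2) := by fun_prop
    have h2 : Measurable fun q : (ℝ × ℝ) × E m =>
      √(q.1.1 ^ 2 + ‖p‖ ^ 2 - 2 * ‖p‖ * q.1.2 + ‖q.2 - x'‖ ^ 2) := by fun_prop
    exact (hF.comp ((measurable_consE m).comp h1)).mul (hkm.comp h2).ennreal_ofReal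
  rw [lintegral_glue_spherical _ hG hunit]
  refine lintegral_congr fun y => setLIntegral_congr_fun measurableSet_Ioi fun s (hs : 0 < s) => ?_
  simp only
  have h1 : (-s - ‖p‖) ^ 2 = (s + ‖p‖) ^ 2 := by ring
  rw [h1, ← hj.lintegral_angle hr hs hx (sq_nonneg ‖y - x'‖), ← lintegral_const_mul]
  · refine lintegral_congr fun α => ?_
    exact mul_left_comm _ _ _
  · have h2 : Measurable fun α =>
      √(s ^ 2 + ‖p‖ ^ 2 - 2 * ‖p‖ * (s * Real.cos α) + ‖y - x'‖ ^ 2) := by fun_prop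
    exact Measurable.mul (by fun_prop) (hkm.comp h2).ennreal_ofReal

/-! ### Lévy-type operators on test functions and their truncations -/

/-- The second order Taylor expansion of a function of class `C²`, uniformly on compact sets. -/
lemma exists_taylor_bound {d : ℕ} {f : E d → ℝ} {Ω S : Set (E d)} (hΩ : IsOpen Ω)
    (hf : ContDiffOn ℝ 2 f Ω) (hS : IsCompact S) (hSΩ : S ⊆ Ω) :
    ∃ C a : ℝ, 0 ≤ C ∧ 0 < a ∧ ∀ x ∈ S, ∀ y, ‖y‖ < a →
      |f (x + y) - f x - fderiv ℝ f x y| ≤ C * ‖y‖ ^ 2 := by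
  refine hS.induction_on (p := fun S => ∃ C a : ℝ, 0 ≤ C ∧ 0 < a ∧ ∀ x ∈ S, ∀ y, ‖y‖ < a →
      |f (x + y) - f x - fderiv ℝ f x y| ≤ C * ‖y‖ ^ 2) ?_ ?_ ?_ ?_
  · exact ⟨0, 1, le_rfl, one_pos, fun x hx => hx.elim⟩
  · rintro s t hst ⟨C, a, hC, ha, h⟩
    exact ⟨C, a, hC, ha, fun x hx => h x (hst hx)⟩
  · rintro s t ⟨C, a, hC, ha, h⟩ ⟨C', a', hC', ha', h'⟩
    refine ⟨max C C', min a a', le_max_of_le_left hC, lt_min ha ha', ?_⟩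
    rintro x (hx | hx) y hy
    · exact (h x hx y (hy.trans_le (min_le_left _ _))).trans (by gcongr; exact le_max_left _ _)
    · exact (h' x hx y (hy.trans_le (min_le_right _ _))).trans (by gcongr; exact le_max_right _ _)
  · intro x₀ hx₀
    have h1 : ContDiffAt ℝ 1 (fderiv ℝ f) x₀ :=
      (hf.fderiv_of_isOpen hΩ (by norm_num)).contDiffAt (hΩ.mem_nhds (hSΩ hx₀))
    obtain ⟨K, t, ht, hK⟩ := h1.exists_lipschitzOnWith
    obtain ⟨a, ha, hat⟩ := Metric.mem_nhds_iff.1 (inter_mem ht (hΩ.mem_nhds (hSΩ hx₀)))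
    refine ⟨Metric.ball x₀ (a / 2),
      mem_nhdsWithin_of_mem_nhds (Metric.ball_mem_nhds _ (by positivity)), K, a / 2, K.2,
      by positivity, fun x hx y hy => ?_⟩
    have hsub : Metric.closedBall x ‖y‖ ⊆ t ∩ Ω := by
      refine Subset.trans ?_ hat
      intro z hz
      rw [Metric.mem_closedBall] at hz
      rw [Metric.mem_ball] at hx ⊢
      linarith [dist_triangle z x x₀]
    have hx' : x ∈ Metric.closedBall x ‖y‖ := Metric.mem_closedBall_self (norm_nonneg _)
    have hb : ∀ z ∈ Metric.closedBall x ‖y‖, ‖fderiv ℝ f z - fderiv ℝ f x‖ ≤ K * ‖y‖ := by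
      intro z hz
      rw [← dist_eq_norm]
      refine (hK.dist_le_mul z (hsub hz).1 x (hsub hx').1).trans ?_
      gcongr
      exact hz
    have := (convex_closedBall x ‖y‖).norm_image_sub_le_of_norm_fderiv_le'
      (f := f) (φ := fderiv ℝ f x) (C := K * ‖y‖) (y := x + y)
      (fun z hz => (hf.contDiffAt (hΩ.mem_nhds (hsub hz).2)).differentiableAt (by norm_num))
      hb hx' (by simp)
    rw [add_sub_cancel_left, Real.norm_eq_abs] at this
    calc _ ≤ _ := this
      _ = _ := by ring

/-- A test function: smooth with compact support. -/
structure IsTest {d : ℕ} (φ : E d → ℝ) : Prop where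
  contDiff : ContDiff ℝ ∞ φ
  compact : HasCompactSupport φ

/-- The assumptions on the profile of the kernel of a Lévy-type operator on `ℝᵈ`. The value at `0`
plays no role; nonnegativity is required there for convenience, and the convention for division
gives `nextKernel j 0 = 0`. -/
structure LevyKernel (d : ℕ) (k : ℝ → ℝ) : Prop where
  measurable : Measurable k
  nonneg : ∀ s, 0 ≤ s → 0 ≤ k s
  integrable : Integrable (fun y : E d => min 1 (‖y‖ ^ 2) * k ‖y‖)

lemma LevyProfile.levyKernel {m : ℕ} {j : ℝ → ℝ} (hj : LevyProfile m j) :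
    LevyKernel (m + 3) (nextKernel j) :=
  ⟨measurable_nextKernel j, fun _ => hj.nextKernel_nonneg, hj.integrable_nextKernel⟩

namespace IsTest

variable {d : ℕ} {φ : E d → ℝ} (hφ : IsTest φ)

include hφ in
lemma continuous : Continuous φ := hφ.contDiff.continuous

include hφ in
lemma continuous_fderiv : Continuous (fderiv ℝ φ) := hφ.contDiff.continuous_fderiv (by simp)

include hφ in
lemma integrable : Integrable φ := hφ.continuous.integrable_of_hasCompactSupport hφ.compact

include hφ in
lemma exists_bound : ∃ B, 0 ≤ B ∧ ∀ x, |φ x| ≤ B := by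
  obtain ⟨B, hB⟩ := hφ.continuous.bounded_above_of_compact_support hφ.compact
  exact ⟨B, (norm_nonneg _).trans (hB 0), hB⟩

include hφ in
/-- The second order difference in the Lévy operator applied to a test function. -/
lemma exists_second_difference_bound : ∃ C, 0 ≤ C ∧ ∀ x y,
    |φ x - φ (x + y) + (Metric.ball (0 : E d) 1).indicator (fun z => fderiv ℝ φ x z) y| ≤
      C * min 1 (‖y‖ ^ 2) *
        ((tsupport φ).indicator 1 x + (tsupport φ).indicator 1 (x + y)) := by
  obtain ⟨B, hB0, hB⟩ := hφ.exists_bound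
  obtain ⟨D, hD⟩ := hφ.continuous_fderiv.bounded_above_of_compact_support
    (hφ.compact.fderiv (𝕜 := ℝ))
  have hD0 : 0 ≤ D := (norm_nonneg _).trans (hD 0)
  have hT : IsCompact (Metric.cthickening 1 (tsupport φ)) := hφ.compact.isCompact.cthickening
  obtain ⟨C, a, hC, ha, h⟩ := exists_taylor_bound isOpen_univ
    (contDiff_infty.1 hφ.contDiff 2).contDiffOn hT (subset_univ _)
  set b := min a 1 with hb
  have hb0 : 0 < b := lt_min ha one_pos
  have hb1 : b ≤ 1 := min_le_right _ _
  have hnn : ∀ z, 0 ≤ (tsupport φ).indicator (1 : E d → ℝ) z := fun z =>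
    indicator_nonneg (fun _ _ => zero_le_one) z
  refine ⟨C + (2 * B + D) / b ^ 2, by positivity, fun x y => ?_⟩
  by_cases hxy : x ∈ tsupport φ ∨ x + y ∈ tsupport φ
  · have h1 : 1 ≤ (tsupport φ).indicator (1 : E d → ℝ) x +
        (tsupport φ).indicator (1 : E d → ℝ) (x + y) := by
      rcases hxy with hx | hx
      · simpa [indicator_of_mem hx] using hnn (x + y)
      · simpa [indicator_of_mem hx] using hnn x
    refine le_trans ?_ (le_mul_of_one_le_right (by positivity) h1)
    by_cases hy : ‖y‖ < b
    · have hx : x ∈ Metric.cthickening 1 (tsupport φ) := by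
        rcases hxy with hx | hx
        · exact Metric.self_subset_cthickening _ hx
        · refine Metric.mem_cthickening_of_dist_le x (x + y) 1 _ hx ?_
          simp [dist_eq_norm]; linarith
      have hy1 : y ∈ Metric.ball (0 : E d) 1 := by simpa using hy.trans_le hb1
      have hmin : min 1 (‖y‖ ^ 2) = ‖y‖ ^ 2 := by
        refine min_eq_right ?_
        have := hy.trans_le hb1
        nlinarith [norm_nonneg y]
      rw [indicator_of_mem hy1, hmin]
      have := h x hx y (hy.trans_le (min_le_left _ _))
      calc _ = |φ (x + y) - φ x - fderiv ℝ φ x y| := by rw [← abs_neg]; congr 1; ring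
        _ ≤ C * ‖y‖ ^ 2 := this
        _ ≤ _ := by
          gcongr
          exact le_add_of_nonneg_right (by positivity)
    · have hmin : b ^ 2 ≤ min 1 (‖y‖ ^ 2) := by
        refine le_min (by nlinarith) ?_
        gcongr
        exact not_lt.1 hy
      have h2 : |(Metric.ball (0 : E d) 1).indicator (fun z => fderiv ℝ φ x z) y| ≤ D := by
        by_cases hy1 : y ∈ Metric.ball (0 : E d) 1
        · rw [indicator_of_mem hy1]
          refine ((fderiv ℝ φ x).le_opNorm y).trans ?_
          have : ‖y‖ ≤ 1 := by simpa using (mem_ball_zero_iff.1 hy1).le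
          calc _ ≤ D * 1 := by gcongr; exact hD x
            _ = D := mul_one D
        · rw [indicator_of_notMem hy1]; simpa using hD0
      calc _ ≤ |φ x| + |φ (x + y)| + D := by
            refine (abs_add_le _ _).trans ?_
            gcongr
            exact abs_sub _ _
        _ ≤ 2 * B + D := by linarith [hB x, hB (x + y)]
        _ = (2 * B + D) / b ^ 2 * b ^ 2 := by field_simp
        _ ≤ _ := by
          gcongr
          exact le_add_of_nonneg_left hC
  · push Not at hxy
    have h1 : φ x = 0 := image_eq_zero_of_notMem_tsupport hxy.1
    have h2 : φ (x + y) = 0 := image_eq_zero_of_notMem_tsupport hxy.2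
    have h3 : fderiv ℝ φ x = 0 :=
      image_eq_zero_of_notMem_tsupport fun h => hxy.1 (tsupport_fderiv_subset ℝ h)
    have h4 : (Metric.ball (0 : E d) 1).indicator (fun z => fderiv ℝ φ x z) y = 0 := by
      rw [h3]; simp
    rw [h1, h2, h4, indicator_of_notMem hxy.1, indicator_of_notMem hxy.2]
    simp

end IsTest

namespace LevyKernel

variable {d : ℕ} {k : ℝ → ℝ} (hk : LevyKernel d k)

include hk in
lemma measurable_cut (r : ℝ) : Measurable ((Ioi r).indicator k) :=
  hk.measurable.indicator measurableSet_Ioi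

include hk in
lemma cut_nonneg (r : ℝ) {s : ℝ} (hs : 0 ≤ s) : 0 ≤ (Ioi r).indicator k s := by
  by_cases h : s ∈ Ioi r
  · rw [indicator_of_mem h]; exact hk.nonneg s hs
  · rw [indicator_of_notMem h]

include hk in
lemma integrable_cut {r : ℝ} (hr : 0 < r) :
    Integrable (fun y : E d => (Ioi r).indicator k ‖y‖) := by
  refine (hk.integrable.const_mul (min 1 (r ^ 2))⁻¹).mono'
    ((hk.measurable_cut r).comp measurable_norm).aestronglyMeasurable (.of_forall fun y => ?_)
  have hc : 0 < min 1 (r ^ 2) := by positivity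
  have hky := hk.nonneg _ (norm_nonneg y)
  rw [Real.norm_eq_abs, abs_of_nonneg (hk.cut_nonneg r (norm_nonneg y))]
  by_cases h : r < ‖y‖
  · rw [indicator_of_mem (by exact h), ← mul_assoc]
    refine le_mul_of_one_le_left hky ?_
    rw [inv_mul_eq_div, one_le_div hc]
    gcongr
  · rw [indicator_of_notMem (by exact h)]
    positivity

include hk in
lemma measurable_levyIntegrand {φ : E d → ℝ} (hφ : IsTest φ) :
    Measurable (fun p : E d × E d => levyIntegrand k φ p.2 p.1) := by
  have h1 := hφ.continuous
  have h2 := hφ.continuous_fderiv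
  have h3 : Measurable fun p : E d × E d => fderiv ℝ φ p.2 p.1 :=
    (by fun_prop : Continuous fun p : E d × E d => fderiv ℝ φ p.2 p.1).measurable
  have h4 : (fun p : E d × E d =>
      (Metric.ball (0 : E d) 1).indicator (fun z => fderiv ℝ φ p.2 z) p.1) =
      (Prod.fst ⁻¹' Metric.ball (0 : E d) 1).indicator fun p => fderiv ℝ φ p.2 p.1 := by
    ext p; rfl
  have h5 : Measurable fun p : E d × E d =>
      (Metric.ball (0 : E d) 1).indicator (fun z => fderiv ℝ φ p.2 z) p.1 := by
    rw [h4]; exact h3.indicator (measurable_fst measurableSet_ball)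
  have h6 : Measurable fun p : E d × E d => φ p.2 - φ (p.2 + p.1) :=
    (by fun_prop : Continuous fun p : E d × E d => φ p.2 - φ (p.2 + p.1)).measurable
  exact (h6.add h5).mul (hk.measurable.comp measurable_fst.norm)

include hk in
/-- The integrand of the Lévy operator applied to a test function is integrable in the point and
the increment jointly. -/
lemma integrable_levyIntegrand {φ : E d → ℝ} (hφ : IsTest φ) :
    Integrable (fun p : E d × E d => levyIntegrand k φ p.2 p.1) (volume.prod volume) := by
  obtain ⟨C, hC, h⟩ := hφ.exists_second_difference_bound
  have hT : Integrable ((tsupport φ).indicator (1 : E d → ℝ)) :=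
    (integrable_indicator_iff (isClosed_tsupport φ).measurableSet).2
      (integrableOn_const hφ.compact.isCompact.measure_lt_top.ne)
  have h1 := (hk.integrable.const_mul C).mul_prod hT
  have h2 : Integrable (fun p : E d × E d => (C * (min 1 (‖p.1‖ ^ 2) * k ‖p.1‖)) *
      (tsupport φ).indicator (1 : E d → ℝ) (p.2 + p.1)) (volume.prod volume) := by
    have := (measurePreserving_prod_add (volume : Measure (E d))
      volume).integrable_comp_of_integrable h1
    simpa [Function.comp_def, add_comm] using this
  refine (h1.add h2).mono' (hk.measurable_levyIntegrand hφ).aestronglyMeasurable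
    (.of_forall fun p => ?_)
  have hkp := hk.nonneg _ (norm_nonneg p.1)
  rw [levyIntegrand, norm_mul, Real.norm_eq_abs, Real.norm_eq_abs, abs_of_nonneg hkp]
  refine (mul_le_mul_of_nonneg_right (h p.2 p.1) hkp).trans (le_of_eq ?_)
  simp only [Pi.add_apply]
  ring

end LevyKernel

/-- The averages of `f` with respect to the kernel `k` truncated to increments of norm larger
than `r`. -/
def avgOp {d : ℕ} (k : ℝ → ℝ) (r : ℝ) (f : E d → ℝ) (x : E d) : ℝ :=
  ∫ y, f (x + y) * (Ioi r).indicator k ‖y‖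

/-- The Lévy-type operator with kernel `k` truncated to increments of norm larger than `r`. -/
def truncOp {d : ℕ} (k : ℝ → ℝ) (r : ℝ) (f : E d → ℝ) (x : E d) : ℝ :=
  f x * (∫ y : E d, (Ioi r).indicator k ‖y‖) - avgOp k r f x

namespace LevyKernel

variable {d : ℕ} {k : ℝ → ℝ} (hk : LevyKernel d k)

include hk in
lemma integrable_prod_mul {f g : E d → ℝ} {B : ℝ} (hf : AEStronglyMeasurable f)
    (hB : ∀ x, |f x| ≤ B) (hg : Integrable g) {r : ℝ} (hr : 0 < r) :
    Integrable (fun p : E d × E d => f (p.1 + p.2) * g p.2 * (Ioi r).indicator k ‖p.1‖)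
      (volume.prod volume) := by
  have h1 := (hk.integrable_cut hr).mul_prod hg
  have h2 : AEStronglyMeasurable (fun p : E d × E d => f (p.1 + p.2)) (volume.prod volume) :=
    hf.comp_quasiMeasurePreserving (quasiMeasurePreserving_add volume volume)
  refine (h1.bdd_mul h2 (.of_forall fun p => hB _)).congr (.of_forall fun p => ?_)
  simp only
  ring

include hk in
lemma integrable_avg {f : E d → ℝ} {B : ℝ} (hf : AEStronglyMeasurable f) (hB : ∀ x, |f x| ≤ B)
    {r : ℝ} (hr : 0 < r) (x : E d) :
    Integrable (fun y => f (x + y) * (Ioi r).indicator k ‖y‖) :=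
  (hk.integrable_cut hr).bdd_mul
    (hf.comp_quasiMeasurePreserving (quasiMeasurePreserving_add_left volume x))
    (.of_forall fun _ => hB _)

include hk in
lemma truncOp_eq {f : E d → ℝ} {B : ℝ} (hf : AEStronglyMeasurable f) (hB : ∀ x, |f x| ≤ B)
    {r : ℝ} (hr : 0 < r) (x : E d) :
    truncOp k r f x = ∫ y, (f x - f (x + y)) * (Ioi r).indicator k ‖y‖ := by
  simp only [sub_mul]
  rw [truncOp, avgOp, integral_sub ((hk.integrable_cut hr).const_mul _)
    (hk.integrable_avg hf hB hr x),
    integral_const_mul]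

include hk in
lemma aestronglyMeasurable_avgOp {f : E d → ℝ} (hf : AEStronglyMeasurable f) (r : ℝ) :
    AEStronglyMeasurable (avgOp k r f) := by
  have h2 : AEStronglyMeasurable (fun p : E d × E d => f (p.1 + p.2)) (volume.prod volume) :=
    hf.comp_quasiMeasurePreserving (quasiMeasurePreserving_add volume volume)
  have h3 : AEStronglyMeasurable (fun p : E d × E d => (Ioi r).indicator k ‖p.2‖)
      (volume.prod volume) :=
    ((hk.measurable_cut r).comp measurable_snd.norm).aestronglyMeasurable
  exact (h2.mul h3).integral_prod_right'

include hk in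
lemma abs_avgOp_le {f : E d → ℝ} {B : ℝ} (hB : ∀ x, |f x| ≤ B) {r : ℝ} (hr : 0 < r) (x : E d) :
    |avgOp k r f x| ≤ B * ∫ y : E d, (Ioi r).indicator k ‖y‖ := by
  rw [← integral_const_mul, avgOp, ← Real.norm_eq_abs]
  refine norm_integral_le_of_norm_le ((hk.integrable_cut hr).const_mul B) (.of_forall fun y => ?_)
  rw [norm_mul, Real.norm_eq_abs, Real.norm_eq_abs,
    abs_of_nonneg (hk.cut_nonneg r (norm_nonneg y))]
  exact mul_le_mul_of_nonneg_right (hB _) (hk.cut_nonneg r (norm_nonneg y))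

include hk in
/-- The truncated averages are symmetric. -/
lemma integral_mul_avgOp {f g : E d → ℝ} {B : ℝ} (hf : AEStronglyMeasurable f)
    (hB : ∀ x, |f x| ≤ B) (hg : Integrable g) {r : ℝ} (hr : 0 < r) :
    ∫ x, f x * avgOp k r g x = ∫ x, g x * avgOp k r f x := by
  have h1 := hk.integrable_prod_mul hf hB hg hr
  have h2 : ∫ x, g x * avgOp k r f x =
      ∫ y, ∫ x, f (y + x) * g x * (Ioi r).indicator k ‖y‖ := by
    rw [integral_integral_swap (f := fun y x => f (y + x) * g x * (Ioi r).indicator k ‖y‖) h1]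
    refine integral_congr_ae (.of_forall fun x => ?_)
    simp only [avgOp]
    rw [← integral_const_mul]
    refine integral_congr_ae (.of_forall fun y => ?_)
    simp only
    rw [add_comm]; ring
  have h3 : Integrable (fun p : E d × E d => f p.2 * g (p.1 + p.2) * (Ioi r).indicator k ‖p.1‖)
      (volume.prod volume) := by
    have hmp : MeasurePreserving (fun p : E d × E d => (-p.1, p.1 + p.2))
        (volume.prod volume) (volume.prod volume) :=
      ((Measure.measurePreserving_neg (volume : Measure (E d))).prod
        (MeasurePreserving.id (volume : Measure (E d)))).comp
        (measurePreserving_prod_add (volume : Measure (E d)) volume)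
    have := hmp.integrable_comp_of_integrable h1
    simpa [Function.comp_def] using this
  rw [h2, ← integral_neg_eq_self (fun y => ∫ x, f (y + x) * g x * (Ioi r).indicator k ‖y‖)]
  calc ∫ x, f x * avgOp k r g x
      = ∫ x, ∫ y, f x * g (y + x) * (Ioi r).indicator k ‖y‖ := by
        refine integral_congr_ae (.of_forall fun x => ?_)
        simp only [avgOp]
        rw [← integral_const_mul]
        refine integral_congr_ae (.of_forall fun y => ?_)
        simp only
        rw [add_comm]; ring
    _ = ∫ y, ∫ x, f x * g (y + x) * (Ioi r).indicator k ‖y‖ := by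
        rw [integral_integral_swap (f := fun y x => f x * g (y + x) * (Ioi r).indicator k ‖y‖) h3]
    _ = _ := by
        refine integral_congr_ae (.of_forall fun y => ?_)
        simp only
        rw [norm_neg, ← integral_add_left_eq_self
          (fun x => f (-y + x) * g x * (Ioi r).indicator k ‖y‖) y]
        refine integral_congr_ae (.of_forall fun x => ?_)
        simp

end LevyKernel

namespace LevyKernel

variable {d : ℕ} {k : ℝ → ℝ} (hk : LevyKernel d k)

include hk in
lemma integrable_levyOp {φ : E d → ℝ} (hφ : IsTest φ) : Integrable (levyOp k φ) :=
  (hk.integrable_levyIntegrand hφ).integral_prod_right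

include hk in
lemma integrable_avgOp {g : E d → ℝ} (hg : Integrable g) {r : ℝ} (hr : 0 < r) :
    Integrable (avgOp k r g) := by
  have h1 := (hk.integrable_cut hr).mul_prod hg
  have h2 := (measurePreserving_prod_add (volume : Measure (E d))
    volume).integrable_comp_of_integrable h1
  refine h2.integral_prod_right.congr (.of_forall fun x => ?_)
  refine integral_congr_ae (.of_forall fun y => ?_)
  simp only [Function.comp_apply]
  rw [add_comm, mul_comm]

include hk in
lemma aestronglyMeasurable_truncOp {f : E d → ℝ} (hf : AEStronglyMeasurable f) (r : ℝ) :
    AEStronglyMeasurable (truncOp k r f) :=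
  (hf.mul_const _).sub (hk.aestronglyMeasurable_avgOp hf r)

include hk in
/-- The truncated operators are symmetric. -/
lemma integral_mul_truncOp {f g : E d → ℝ} {B : ℝ} (hf : AEStronglyMeasurable f)
    (hB : ∀ x, |f x| ≤ B) (hg : Integrable g) {r : ℝ} (hr : 0 < r) :
    ∫ x, f x * truncOp k r g x = ∫ x, g x * truncOp k r f x := by
  have hb : ∀ x, |avgOp k r f x| ≤ B * ∫ y : E d, (Ioi r).indicator k ‖y‖ :=
    hk.abs_avgOp_le hB hr
  have h1 : Integrable fun x => f x * (g x * ∫ y : E d, (Ioi r).indicator k ‖y‖) :=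
    (hg.mul_const _).bdd_mul hf (.of_forall hB)
  have h2 : Integrable fun x => f x * avgOp k r g x :=
    (hk.integrable_avgOp hg hr).bdd_mul hf (.of_forall hB)
  have h3 : Integrable fun x => g x * (f x * ∫ y : E d, (Ioi r).indicator k ‖y‖) :=
    h1.congr (.of_forall fun x => by simp only; ring)
  have h4 : Integrable fun x => g x * avgOp k r f x :=
    (hg.bdd_mul (hk.aestronglyMeasurable_avgOp hf r) (.of_forall hb)).congr
      (.of_forall fun x => by simp only; ring)
  simp only [truncOp, mul_sub]
  rw [integral_sub h1 h2, integral_sub h3 h4, hk.integral_mul_avgOp hf hB hg hr]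
  congr 1
  exact integral_congr_ae (.of_forall fun x => by simp only; ring)

include hk in
/-- On test functions the gradient term of the Lévy operator drops out under truncation, since it
is odd in the increment. -/
lemma truncOp_eq_integral_levyIntegrand {φ : E d → ℝ} (hφ : IsTest φ) {r : ℝ} (hr : 0 < r)
    (x : E d) :
    truncOp k r φ x = ∫ y, (norm ⁻¹' Ioi r).indicator (levyIntegrand k φ x) y := by
  obtain ⟨B, -, hB⟩ := hφ.exists_bound
  rw [hk.truncOp_eq hφ.continuous.aestronglyMeasurable hB hr]
  set g : E d → ℝ := fun y => (Metric.ball (0 : E d) 1).indicator (fun z => fderiv ℝ φ x z) y *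
    (Ioi r).indicator k ‖y‖ with hg
  have hodd : ∫ y, g y = 0 := by
    have h1 : ∀ y, g (-y) = -g y := by
      intro y
      simp only [hg, norm_neg]
      by_cases hy : y ∈ Metric.ball (0 : E d) 1
      · rw [indicator_of_mem hy, indicator_of_mem (by simpa using hy)]; simp
      · rw [indicator_of_notMem hy, indicator_of_notMem (by simpa using hy)]; simp
    have h2 := integral_neg_eq_self g volume
    simp only [h1, integral_neg] at h2
    linarith
  have hgi : Integrable g := by
    refine (hk.integrable_cut hr).bdd_mul (c := ‖fderiv ℝ φ x‖)
      ((Continuous.measurable (by fun_prop)).indicator measurableSet_ball).aestronglyMeasurable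
      (.of_forall fun y => ?_)
    by_cases hy : y ∈ Metric.ball (0 : E d) 1
    · rw [indicator_of_mem hy]
      exact (fderiv ℝ φ x).le_of_opNorm_le_of_le le_rfl (mem_ball_zero_iff.1 hy).le |>.trans
        (by simp)
    · rw [indicator_of_notMem hy]; simp
  have hfi : Integrable fun y => (φ x - φ (x + y)) * (Ioi r).indicator k ‖y‖ := by
    simp only [sub_mul]
    exact ((hk.integrable_cut hr).const_mul _).sub
      (hk.integrable_avg hφ.continuous.aestronglyMeasurable hB hr x)
  rw [← add_zero (∫ y, _), ← hodd, ← integral_add hfi hgi]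
  refine integral_congr_ae (.of_forall fun y => ?_)
  simp only [hg]
  by_cases hy : r < ‖y‖
  · rw [indicator_of_mem (show ‖y‖ ∈ Ioi r from hy),
      indicator_of_mem (show y ∈ norm ⁻¹' Ioi r from hy), levyIntegrand]
    ring
  · rw [indicator_of_notMem (show ‖y‖ ∉ Ioi r from hy),
      indicator_of_notMem (show y ∉ norm ⁻¹' Ioi r from hy)]
    simp

include hk in
lemma tendsto_integral_mul_truncOp {φ v : E d → ℝ} {B : ℝ} (hφ : IsTest φ)
    (hv : AEStronglyMeasurable v) (hB : ∀ x, |v x| ≤ B) :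
    Tendsto (fun r => ∫ x, v x * truncOp k r φ x) (𝓝[>] 0) (𝓝 (∫ x, v x * levyOp k φ x)) := by
  have hI := hk.integrable_levyIntegrand hφ
  have hv2 : AEStronglyMeasurable (fun p : E d × E d => v p.2) (volume.prod volume) := hv.comp_snd
  have hvI : Integrable (fun p : E d × E d => v p.2 * levyIntegrand k φ p.2 p.1)
      (volume.prod volume) := hI.bdd_mul hv2 (.of_forall fun p => hB _)
  have hms : ∀ r : ℝ, MeasurableSet (Prod.fst ⁻¹' (norm ⁻¹' Ioi r) : Set (E d × E d)) := fun r =>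
    measurable_fst (measurable_norm measurableSet_Ioi)
  have h1 : ∫ x, v x * levyOp k φ x =
      ∫ p : E d × E d, v p.2 * levyIntegrand k φ p.2 p.1 ∂(volume.prod volume) := by
    rw [integral_prod_symm _ hvI]
    simp only [integral_const_mul]
    rfl
  have h2 : ∀ r ∈ Ioi (0 : ℝ), ∫ x, v x * truncOp k r φ x =
      ∫ p : E d × E d, (Prod.fst ⁻¹' (norm ⁻¹' Ioi r)).indicator
        (fun p => v p.2 * levyIntegrand k φ p.2 p.1) p ∂(volume.prod volume) := by
    intro r hr
    rw [integral_prod_symm _ (hvI.indicator (hms r))]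
    refine integral_congr_ae (.of_forall fun x => ?_)
    simp only
    rw [hk.truncOp_eq_integral_levyIntegrand hφ hr, ← integral_const_mul]
    refine integral_congr_ae (.of_forall fun y => ?_)
    simp only
    by_cases hy : r < ‖y‖
    · rw [indicator_of_mem (by exact hy), indicator_of_mem (by exact hy)]
    · rw [indicator_of_notMem (by exact hy), indicator_of_notMem (by exact hy), mul_zero]
  rw [h1]
  refine Tendsto.congr' (f₁ := fun r => ∫ p : E d × E d,
    (Prod.fst ⁻¹' (norm ⁻¹' Ioi r)).indicator
        (fun p => v p.2 * levyIntegrand k φ p.2 p.1) p ∂(volume.prod volume))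
    (eventually_nhdsWithin_of_forall fun r hr => (h2 r hr).symm) ?_
  refine tendsto_integral_filter_of_dominated_convergence _
    (.of_forall fun r => (hvI.indicator (hms r)).1)
    (.of_forall fun r => .of_forall fun p => norm_indicator_le_norm_self _ _) hvI.norm
    (.of_forall fun p => ?_)
  by_cases hp : p.1 = 0
  · have h0 : v p.2 * levyIntegrand k φ p.2 p.1 = 0 := by simp [levyIntegrand, hp]
    rw [h0]
    refine tendsto_const_nhds.congr fun r => ?_
    by_cases hy : p ∈ Prod.fst ⁻¹' (norm ⁻¹' Ioi r)
    · rw [indicator_of_mem hy, h0]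
    · rw [indicator_of_notMem hy]
  · refine tendsto_const_nhds.congr' ?_
    filter_upwards [mem_nhdsWithin_of_mem_nhds (Iio_mem_nhds (norm_pos_iff.2 hp))] with r hr
    rw [indicator_of_mem (by exact hr)]

include hk in
/-- The weak formulation as a limit of truncated operators applied to the solution. -/
lemma tendsto_integral_mul_truncOp' {φ v : E d → ℝ} {B : ℝ} (hφ : IsTest φ)
    (hv : AEStronglyMeasurable v) (hB : ∀ x, |v x| ≤ B) :
    Tendsto (fun r => ∫ x, φ x * truncOp k r v x) (𝓝[>] 0) (𝓝 (∫ x, v x * levyOp k φ x)) :=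
  (hk.tendsto_integral_mul_truncOp hφ hv hB).congr' (eventually_nhdsWithin_of_forall fun _ hr =>
    hk.integral_mul_truncOp hv hB hφ.integrable hr)

include hk in
lemma integral_levyOp {φ : E d → ℝ} (hφ : IsTest φ) : ∫ x, levyOp k φ x = 0 := by
  have h := hk.tendsto_integral_mul_truncOp' (v := fun _ => 1) (B := 1) hφ
    aestronglyMeasurable_const (by simp)
  have h0 : ∀ r x, truncOp (d := d) k r (fun _ => 1) x = 0 := by
    intro r x; simp [truncOp, avgOp]
  simp only [h0, mul_zero, integral_zero, one_mul] at h
  exact tendsto_nhds_unique h tendsto_const_nhds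

end LevyKernel

/-! ### The lifting map and antisymmetric functions -/

lemma ae_ne_zero_coord (m : ℕ) : ∀ᵐ z : E (m + 1), z 0 ≠ 0 := by
  have h := Measure.addHaar_submodule (volume : Measure (E (m + 1)))
    (LinearMap.ker (EuclideanSpace.proj (𝕜 := ℝ) (0 : Fin (m + 1))).toLinearMap) (by
      intro htop
      have := LinearMap.congr_fun (LinearMap.ker_eq_top.1 htop) (EuclideanSpace.single 0 1)
      simp at this)
  rw [ae_iff]
  convert h using 2
  ext z
  simp

/-- Folding an integral over `ℝⁿ` onto the half-space. -/
lemma integral_halfspace_add_reflect {m : ℕ} {f : E (m + 1) → ℝ} (hf : Integrable f) :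
    IntegrableOn (fun z => f z + f (reflect z)) {z : E (m + 1) | 0 < z 0} ∧
    ∫ z in {z : E (m + 1) | 0 < z 0}, (f z + f (reflect z)) = ∫ z, f z := by
  have hR : Integrable (fun z => f (reflect z)) :=
    measurePreserving_reflect.integrable_comp_of_integrable hf
  refine ⟨hf.integrableOn.add hR.integrableOn, ?_⟩
  have hpre : {z : E (m + 1) | 0 < z 0} = reflect ⁻¹' {z : E (m + 1) | z 0 < 0} := by
    ext z; simp [reflect]
  have hneg : ∫ z in {z : E (m + 1) | 0 < z 0}, f (reflect z) =
      ∫ z in {z : E (m + 1) | z 0 < 0}, f z := by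
    rw [hpre]
    exact measurePreserving_reflect.setIntegral_preimage_emb
      (reflectIso m).toHomeomorph.measurableEmbedding f _
  have hcompl : ({z : E (m + 1) | 0 < z 0}ᶜ : Set (E (m + 1))) =ᵐ[volume] {z | z 0 < 0} := by
    filter_upwards [ae_ne_zero_coord m] with z hz
    simp only [eq_iff_iff]
    change (¬ (0 < z 0)) ↔ z 0 < 0
    rw [not_lt]
    exact ⟨fun h => lt_of_le_of_ne h hz, le_of_lt⟩
  rw [integral_add hf.integrableOn hR.integrableOn, hneg, ← setIntegral_congr_set hcompl,
    integral_add_compl (measurableSet_halfspace m) hf]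

lemma quasiMeasurePreserving_collapse (m : ℕ) :
    Measure.QuasiMeasurePreserving (collapse : E (m + 3) → E (m + 1)) volume volume := by
  refine ⟨measurable_collapse m, Measure.AbsolutelyContinuous.mk fun s hs h0 => ?_⟩
  have h1 := lintegral_collapse (m := m) (F := s.indicator 1) (measurable_one.indicator hs)
  have h2 : (fun x : E (m + 3) => s.indicator (1 : E (m + 1) → ℝ≥0∞) (collapse x)) =
      (collapse ⁻¹' s).indicator 1 := by ext x; rfl
  rw [h2, lintegral_indicator_one (measurable_collapse m hs)] at h1
  rw [Measure.map_apply (measurable_collapse m) hs, h1]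
  refine lintegral_eq_zero_of_ae_eq_zero (ae_restrict_of_ae ?_)
  filter_upwards [measure_eq_zero_iff_ae_notMem.1 h0] with z hz
  simp [indicator_of_notMem hz]

lemma continuous_collapse (m : ℕ) : Continuous (collapse : E (m + 3) → E (m + 1)) := by
  refine (PiLp.continuous_toLp 2 _).comp (continuous_pi fun i => ?_)
  refine Fin.cases ?_ (fun i => ?_) i
  · simp only [Fin.cons_zero]; fun_prop
  · simp only [Fin.cons_succ]; fun_prop

lemma exists_collapse_eq {m : ℕ} {z : E (m + 1)} (hz : 0 ≤ z 0) :
    ∃ x : E (m + 3), collapse x = z := by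
  refine ⟨glue (EuclideanSpace.single 0 (z 0)) (WithLp.toLp 2 fun i => z i.succ), ?_⟩
  rw [collapse_glue]
  ext i
  refine Fin.cases ?_ (fun i => ?_) i
  · simp [abs_of_nonneg hz]
  · simp

lemma collapse_zero_nonneg {m : ℕ} (x : E (m + 3)) : 0 ≤ collapse x 0 := Real.sqrt_nonneg _

lemma norm_collapse {m : ℕ} (x : E (m + 3)) : ‖collapse x‖ = ‖x‖ := by
  obtain ⟨w, y, rfl⟩ := exists_glue x
  rw [collapse_glue, ← sq_eq_sq₀ (norm_nonneg _) (norm_nonneg _), norm_sq_consE, glue,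
    norm_sq_consE, norm_sq_consE, norm_sq_consE, EuclideanSpace.norm_sq_eq w, Fin.sum_univ_three]
  simp
  ring

lemma ae_collapse_pos (m : ℕ) : ∀ᵐ x : E (m + 3), 0 < collapse x 0 := by
  filter_upwards [(quasiMeasurePreserving_collapse m).ae (ae_ne_zero_coord m)] with x hx
  exact lt_of_le_of_ne (collapse_zero_nonneg x) (Ne.symm hx)

/-- The function `1 / √(x₁² + x₂² + x₃²)` is locally integrable. -/
lemma integrable_div_collapse {m : ℕ} {φ : E (m + 3) → ℝ} (hφ : IsTest φ) :
    Integrable fun x => φ x / collapse x 0 := by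
  obtain ⟨B, hB0, hB⟩ := hφ.exists_bound
  obtain ⟨R, hR⟩ := hφ.compact.isCompact.isBounded.subset_closedBall (0 : E (m + 3))
  have hcm : Measurable fun x : E (m + 3) => collapse x 0 :=
    (by fun_prop : Measurable fun z : E (m + 1) => z 0).comp (measurable_collapse m)
  refine ⟨(hφ.continuous.measurable.div hcm).aestronglyMeasurable, ?_⟩
  set F : E (m + 1) → ℝ≥0∞ := (Metric.closedBall 0 R).indicator
    fun z => ENNReal.ofReal (B / |z 0|) with hF
  have hFm : Measurable F :=
    (Measurable.ennreal_ofReal (by fun_prop)).indicator measurableSet_closedBall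
  have h1 : ∀ x, ‖φ x / collapse x 0‖ₑ ≤ F (collapse x) := by
    intro x
    by_cases hx : x ∈ Metric.closedBall (0 : E (m + 3)) R
    · have hx' : collapse x ∈ Metric.closedBall (0 : E (m + 1)) R := by
        simpa [norm_collapse] using hx
      rw [hF, indicator_of_mem hx', ← ofReal_norm]
      refine ENNReal.ofReal_le_ofReal ?_
      rw [norm_div, Real.norm_eq_abs, Real.norm_eq_abs]
      gcongr
      exact hB x
    · have : φ x = 0 := image_eq_zero_of_notMem_tsupport fun h => hx (hR h)
      simp [this]
  rw [hasFiniteIntegral_iff_enorm]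
  refine (lintegral_mono h1).trans_lt ?_
  rw [lintegral_collapse hFm]
  calc _ ≤ ∫⁻ z in {z : E (m + 1) | 0 < z 0}, (Metric.closedBall (0 : E (m + 1)) R).indicator
        (fun _ => ENNReal.ofReal (4 * Real.pi * R * B)) z := by
        refine setLIntegral_mono' (measurableSet_halfspace m) fun z (hz : 0 < z 0) => ?_
        by_cases hzR : z ∈ Metric.closedBall (0 : E (m + 1)) R
        · rw [hF, indicator_of_mem hzR, indicator_of_mem hzR, ← ENNReal.ofReal_mul (by positivity)]
          refine ENNReal.ofReal_le_ofReal ?_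
          have h2 : z 0 ≤ R := (le_abs_self _).trans ((PiLp.norm_apply_le z 0).trans
            (by simpa using hzR))
          rw [abs_of_pos hz]
          calc _ = 4 * Real.pi * z 0 * B := by field_simp
            _ ≤ _ := by gcongr
        · rw [hF, indicator_of_notMem hzR, mul_zero]; exact zero_le
    _ ≤ ∫⁻ z, (Metric.closedBall (0 : E (m + 1)) R).indicator
        (fun _ => ENNReal.ofReal (4 * Real.pi * R * B)) z := setLIntegral_le_lintegral _ _
    _ < _ := by
        rw [lintegral_indicator_const measurableSet_closedBall]
        exact ENNReal.mul_lt_top ENNReal.ofReal_lt_top measure_closedBall_lt_top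

namespace AntisymSolution

variable {m : ℕ} {j : ℝ → ℝ} {Ω : Set (E (m + 1))} {M : ℝ} {c u : E (m + 1) → ℝ}
  (hu : AntisymSolution j Ω M c u)

include hu in
lemma div_nonneg (x : E (m + 1)) : 0 ≤ u x / x 0 := by
  rcases eq_or_ne (x 0) 0 with h | h
  · simp [h]
  · have : u x / x 0 = x 0 * u x / (x 0) ^ 2 := by field_simp
    rw [this]
    exact _root_.div_nonneg (hu.nonneg x) (sq_nonneg _)

include hu in
/-- A bounded nonnegative Borel representative of `u / x₁`. -/
lemma exists_representative : ∃ (g : E (m + 1) → ℝ) (B : ℝ), Measurable g ∧ (∀ x, 0 ≤ g x) ∧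
    (∀ x, g x ≤ B) ∧ g =ᵐ[volume] fun x => u x / x 0 := by
  set f : E (m + 1) → ℝ := fun x => u x / x 0 with hf
  set B := (eLpNorm f ∞ volume).toReal with hB
  have hbd : ∀ᵐ x, |f x| ≤ B := by
    have h := ae_le_eLpNormEssSup (f := f) (μ := volume)
    filter_upwards [h] with x hx
    rw [← eLpNorm_exponent_top] at hx
    have := ENNReal.toReal_mono hu.memLp_div.2.ne hx
    rwa [toReal_enorm] at this
  refine ⟨fun x => max 0 (min B (hu.memLp_div.1.mk f x)), B,
    measurable_const.max (measurable_const.min hu.memLp_div.1.stronglyMeasurable_mk.measurable),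
    fun x => le_max_left _ _, fun x => max_le ENNReal.toReal_nonneg (min_le_left _ _), ?_⟩
  filter_upwards [hbd, hu.memLp_div.1.ae_eq_mk] with x hx hx'
  rw [← hx', min_eq_right ((le_abs_self _).trans hx), max_eq_right (hu.div_nonneg x)]

end AntisymSolution

/-- The points of the half-space are closer to each other than to the mirror images. -/
lemma norm_sub_le_norm_reflect_sub {m : ℕ} {x z : E (m + 1)} (hx : 0 < x 0) (hz : 0 < z 0) :
    ‖z - x‖ ≤ ‖reflect z - x‖ := by
  rw [EuclideanSpace.norm_eq, EuclideanSpace.norm_eq]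
  refine Real.sqrt_le_sqrt (Finset.sum_le_sum fun i _ => ?_)
  by_cases h : i = 0
  · subst h
    simp only [reflect, PiLp.sub_apply, Function.update_self, Real.norm_eq_abs, sq_abs]
    nlinarith [mul_pos hx hz]
  · simp [reflect, h]

namespace LevyProfile

variable {m : ℕ} {j : ℝ → ℝ} (hj : LevyProfile m j)

/-- The difference of the values of the truncated profile at the distances to `x` of a point and
of its mirror image. -/
def mirrorDiff {m : ℕ} (j : ℝ → ℝ) (r : ℝ) (x z : E (m + 1)) : ℝ :=
  j (max ‖z - x‖ r) - j (max ‖reflect z - x‖ r)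

include hj in
lemma mirrorDiff_nonneg {r : ℝ} (hr : 0 < r) {x z : E (m + 1)} (hx : 0 < x 0) (hz : 0 < z 0) :
    0 ≤ mirrorDiff j r x z := by
  have := hj.antitone (lt_max_of_lt_right hr : 0 < max ‖z - x‖ r)
    (lt_max_of_lt_right hr : 0 < max ‖reflect z - x‖ r)
    (max_le_max_right r (norm_sub_le_norm_reflect_sub hx hz))
  unfold mirrorDiff
  linarith

include hj in
lemma measurable_mirrorDiff {r : ℝ} (hr : 0 < r) (x : E (m + 1)) :
    Measurable (mirrorDiff j r x) := by
  have hjm := hj.measurable_max hr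
  refine Measurable.sub ?_ ?_
  · exact hjm.comp (g := fun s => j (max s r)) (f := fun z : E (m + 1) => ‖z - x‖) (by fun_prop)
  · exact hjm.comp (g := fun s => j (max s r)) (f := fun z : E (m + 1) => ‖reflect z - x‖)
      ((measurePreserving_reflect.measurable.sub_const _).norm)

include hj in
/-- The truncated averages in `ℝ^{m+3}` of a lifted function as integrals over the half-space. -/
lemma avgOp_collapse {g : E (m + 1) → ℝ} {B : ℝ} (hg : Measurable g) (hg0 : ∀ x, 0 ≤ g x)
    (hgB : ∀ x, g x ≤ B) {r : ℝ} (hr : 0 < r) {x : E (m + 3)} (hx : 0 < collapse x 0) :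
    IntegrableOn (fun z => g z * (z 0 * mirrorDiff j r (collapse x) z))
      {z : E (m + 1) | 0 < z 0} ∧
    collapse x 0 * avgOp (nextKernel j) r (g ∘ collapse) x =
      ∫ z in {z : E (m + 1) | 0 < z 0}, g z * (z 0 * mirrorDiff j r (collapse x) z) := by
  have hk := hj.levyKernel
  set ρ := collapse x 0 with hρ
  have hgc : AEStronglyMeasurable (g ∘ collapse) (volume : Measure (E (m + 3))) :=
    (hg.comp (measurable_collapse m)).aestronglyMeasurable
  have hB : ∀ y, |(g ∘ collapse) y| ≤ B := fun y => by
    rw [Function.comp_apply, abs_of_nonneg (hg0 _)]; exact hgB _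
  have hint := hk.integrable_avg hgc hB hr x
  have hint2 : Integrable fun z => g (collapse z) * (Ioi r).indicator (nextKernel j) ‖z - x‖ := by
    have := hint.comp_sub_right x
    simpa [Function.comp_def] using this
  have h1 : avgOp (nextKernel j) r (g ∘ collapse) x =
      ∫ z, g (collapse z) * (Ioi r).indicator (nextKernel j) ‖z - x‖ := by
    rw [avgOp, ← integral_sub_right_eq_self _ x]
    simp
  have h2 := hj.lintegral_collapse_mul_cut hr hg.ennreal_ofReal hx
  have hnn : ∀ z, 0 ≤ g (collapse z) * (Ioi r).indicator (nextKernel j) ‖z - x‖ := fun z =>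
    mul_nonneg (hg0 _) (hk.cut_nonneg r (norm_nonneg _))
  have h3 : ∫⁻ z in {z : E (m + 1) | 0 < z 0},
      ENNReal.ofReal (g z * (z 0 / ρ * mirrorDiff j r (collapse x) z)) =
      ∫⁻ z, ENNReal.ofReal (g (collapse z) * (Ioi r).indicator (nextKernel j) ‖z - x‖) := by
    simp only [ENNReal.ofReal_mul (hg0 _)]
    exact h2.symm
  have hnn2 : ∀ z ∈ {z : E (m + 1) | 0 < z 0},
      0 ≤ g z * (z 0 / ρ * mirrorDiff j r (collapse x) z) := fun z (hz : 0 < z 0) =>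
    mul_nonneg (hg0 _) (mul_nonneg (by positivity) (hj.mirrorDiff_nonneg hr hx hz))
  have hae : ∀ᵐ z ∂volume.restrict {z : E (m + 1) | 0 < z 0},
      0 ≤ g z * (z 0 / ρ * mirrorDiff j r (collapse x) z) :=
    (ae_restrict_mem (measurableSet_halfspace m)).mono hnn2
  have hm : Measurable fun z : E (m + 1) => g z * (z 0 / ρ * mirrorDiff j r (collapse x) z) :=
    hg.mul (Measurable.mul (by fun_prop) (hj.measurable_mirrorDiff hr _))
  have hio : IntegrableOn (fun z => g z * (z 0 / ρ * mirrorDiff j r (collapse x) z))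
      {z : E (m + 1) | 0 < z 0} := by
    refine ⟨hm.aestronglyMeasurable, ?_⟩
    rw [hasFiniteIntegral_iff_ofReal hae, h3]
    exact (hasFiniteIntegral_iff_ofReal (.of_forall hnn)).1 hint2.2
  have h4 : ∀ z : E (m + 1), g z * (z 0 * mirrorDiff j r (collapse x) z) =
      ρ * (g z * (z 0 / ρ * mirrorDiff j r (collapse x) z)) := by
    intro z; field_simp
  simp only [h4]
  refine ⟨hio.const_mul ρ, ?_⟩
  rw [integral_const_mul, h1, integral_eq_lintegral_of_nonneg_ae (.of_forall hnn) hint2.1,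
    integral_eq_lintegral_of_nonneg_ae hae hio.1, h3]

end LevyProfile

/-! ### The equation for the lift -/

/-- The second moment of the kernel with profile `k` on the ball of radius `r`. -/
def smallMoment (d : ℕ) (k : ℝ → ℝ) (r : ℝ) : ℝ :=
  ∫ y : E d, (Metric.ball 0 r).indicator (fun y => ‖y‖ ^ 2 * k ‖y‖) y

lemma abs_indicator_moment_le {d : ℕ} {k : ℝ → ℝ} {r : ℝ} (hr : r ≤ 1) (y : E d) :
    |(Metric.ball 0 r).indicator (fun y => ‖y‖ ^ 2 * k ‖y‖) y| ≤ |min 1 (‖y‖ ^ 2) * k ‖y‖| := by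
  by_cases hy : y ∈ Metric.ball (0 : E d) r
  · rw [indicator_of_mem hy, min_eq_right]
    have := (mem_ball_zero_iff.1 hy).le.trans hr
    nlinarith [norm_nonneg y]
  · rw [indicator_of_notMem hy, abs_zero]
    exact abs_nonneg _

/-- Away from the origin the weight `min 1 |y|²` is positive and may be divided out. -/
lemma aestronglyMeasurable_profile {d : ℕ} {k : ℝ → ℝ}
    (hk : AEStronglyMeasurable (fun y : E d => min 1 (‖y‖ ^ 2) * k ‖y‖)) :
    AEStronglyMeasurable (fun y : E d => ‖y‖ ^ 2 * k ‖y‖) := by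
  have h : AEStronglyMeasurable (fun y : E d => (‖y‖ ^ 2 / min 1 (‖y‖ ^ 2)) *
      (min 1 (‖y‖ ^ 2) * k ‖y‖)) :=
    (by fun_prop : Measurable fun y : E d =>
      ‖y‖ ^ 2 / min 1 (‖y‖ ^ 2)).aestronglyMeasurable.mul hk
  refine h.congr (.of_forall fun y => ?_)
  rcases eq_or_ne y 0 with rfl | hy
  · simp
  · have : 0 < min 1 (‖y‖ ^ 2) := by positivity
    simp only
    field_simp

lemma integrable_moment {d : ℕ} {k : ℝ → ℝ}
    (hk : Integrable (fun y : E d => min 1 (‖y‖ ^ 2) * k ‖y‖)) {r : ℝ} (hr : r ≤ 1) :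
    Integrable ((Metric.ball (0 : E d) r).indicator (fun y => ‖y‖ ^ 2 * k ‖y‖)) :=
  hk.mono ((aestronglyMeasurable_profile hk.1).indicator measurableSet_ball)
    (.of_forall fun y => abs_indicator_moment_le hr y)

lemma tendsto_smallMoment {d : ℕ} {k : ℝ → ℝ}
    (hk : Integrable (fun y : E d => min 1 (‖y‖ ^ 2) * k ‖y‖)) :
    Tendsto (smallMoment d k) (𝓝[>] 0) (𝓝 0) := by
  suffices h : Tendsto (smallMoment d k) (𝓝[>] 0) (𝓝 (∫ _y : E d, (0 : ℝ))) by simpa using h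
  have hev : ∀ᶠ r : ℝ in 𝓝[>] (0 : ℝ), r ≤ 1 :=
    mem_nhdsWithin_of_mem_nhds (Iic_mem_nhds one_pos)
  refine tendsto_integral_filter_of_dominated_convergence _
    (hev.mono fun r hr => (integrable_moment hk hr).1)
    (hev.mono fun r hr => .of_forall fun y => abs_indicator_moment_le hr y) hk.norm
    (.of_forall fun y => ?_)
  rcases eq_or_ne y 0 with rfl | hy
  · refine tendsto_const_nhds.congr fun r => ?_
    simp [indicator]
  · refine tendsto_const_nhds.congr' ?_
    filter_upwards [mem_nhdsWithin_of_mem_nhds (Iio_mem_nhds (norm_pos_iff.2 hy))] with r hr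
    have : y ∉ Metric.ball (0 : E d) r := by simpa using (le_of_lt hr)
    rw [indicator_of_notMem this]

namespace LevyProfile

variable {m : ℕ} {j : ℝ → ℝ} (hj : LevyProfile m j)

include hj in
lemma aestronglyMeasurable_norm : AEStronglyMeasurable (fun y : E (m + 1) => j ‖y‖) := by
  have h := (by fun_prop : Measurable fun y : E (m + 1) => (‖y‖ ^ 2)⁻¹).aestronglyMeasurable.mul
    (aestronglyMeasurable_profile hj.integrable.1)
  refine h.congr ?_
  have hne : ∀ᵐ x : E (m + 1), x ≠ 0 := by simp [ae_iff]
  filter_upwards [hne] with y hy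
  have : ‖y‖ ≠ 0 := norm_ne_zero_iff.2 hy
  simp only [Pi.mul_apply]
  field_simp

include hj in
/-- The operator `L_n` on an antisymmetric function `u` differs from its truncation by at most the
small second moment of the kernel times a bound for the second derivatives of `u`. -/
lemma abs_levyOpAnti_sub_le {u g : E (m + 1) → ℝ} (hg : Measurable g)
    (hgu : g =ᵐ[volume] fun x => u x / x 0) (hanti : ∀ x, u (reflect x) = -u x)
    {x : E (m + 1)} {r C : ℝ} (hr : 0 < r) (hr1 : r ≤ 1)
    (hC : ∀ y, ‖y‖ < r → |u (x + y) - u x - fderiv ℝ u x y| ≤ C * ‖y‖ ^ 2)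
    (hint : IntegrableOn (fun z => g z * (z 0 * mirrorDiff j r x z)) {z : E (m + 1) | 0 < z 0}) :
    |levyOpAnti j u x - (u x * (∫ y : E (m + 1), j (max ‖y‖ r)) -
      ∫ z in {z : E (m + 1) | 0 < z 0}, g z * (z 0 * mirrorDiff j r x z))| ≤
      C * smallMoment (m + 1) j r := by
  have hum : AEStronglyMeasurable u := by
    have hm := hg.mul (by fun_prop : Measurable fun z : E (m + 1) => z 0)
    refine hm.aestronglyMeasurable.congr ?_
    filter_upwards [hgu, ae_ne_zero_coord m] with z hz hz0
    simp only [Pi.mul_apply, hz]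
    field_simp
  set D : E (m + 1) → ℝ := (Metric.ball (0 : E (m + 1)) 1).indicator (fun z => fderiv ℝ u x z)
    with hD
  have hDm : Measurable D :=
    (Continuous.measurable (by fun_prop)).indicator measurableSet_ball
  have hDle : ∀ y, ‖D y‖ ≤ ‖fderiv ℝ u x‖ := by
    intro y
    by_cases hy : y ∈ Metric.ball (0 : E (m + 1)) 1
    · rw [hD, indicator_of_mem hy]
      exact (fderiv ℝ u x).le_of_opNorm_le_of_le le_rfl (mem_ball_zero_iff.1 hy).le |>.trans
        (by simp)
    · rw [hD, indicator_of_notMem hy]; simp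
  have hJ := hj.integrable_max hr
  -- the gradient term of the truncated operator is odd
  set G : E (m + 1) → ℝ := fun y => D y * j (max ‖y‖ r) with hG
  have hGi : Integrable G := hJ.bdd_mul hDm.aestronglyMeasurable (.of_forall hDle)
  have hG0 : ∫ y, G y = 0 := by
    have h1 : ∀ y, G (-y) = -G y := by
      intro y
      simp only [hG, hD, norm_neg]
      by_cases hy : y ∈ Metric.ball (0 : E (m + 1)) 1
      · rw [indicator_of_mem hy, indicator_of_mem (by simpa using hy)]; simp
      · rw [indicator_of_notMem hy, indicator_of_notMem (by simpa using hy)]; simp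
    have h2 := integral_neg_eq_self G volume
    simp only [h1, integral_neg] at h2
    linarith
  -- the contribution of the small increments
  set Q : E (m + 1) → ℝ := fun y => (u x - u (x + y) + D y) * (j ‖y‖ - j (max ‖y‖ r)) with hQ
  have hQle : ∀ y, ‖Q y‖ ≤
      C * (Metric.ball 0 r).indicator (fun y => ‖y‖ ^ 2 * j ‖y‖) y := by
    intro y
    by_cases hy : y ∈ Metric.ball (0 : E (m + 1)) r
    · have hyr : ‖y‖ < r := mem_ball_zero_iff.1 hy
      rw [indicator_of_mem hy]
      rcases eq_or_ne y 0 with rfl | hy0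
      · simp [hQ, hD]
      have hpos : 0 < ‖y‖ := norm_pos_iff.2 hy0
      have h1 : |u x - u (x + y) + D y| ≤ C * ‖y‖ ^ 2 := by
        rw [hD, indicator_of_mem (by simpa using hyr.trans_le hr1), ← abs_neg]
        convert hC y hyr using 2
        ring
      have h2 : |j ‖y‖ - j (max ‖y‖ r)| ≤ j ‖y‖ := by
        rw [max_eq_right hyr.le]
        have := hj.antitone (mem_Ioi.2 hpos) (mem_Ioi.2 hr) hyr.le
        rw [abs_of_nonneg (by linarith)]
        linarith [hj.nonneg hr]
      rw [norm_mul, Real.norm_eq_abs, Real.norm_eq_abs, ← mul_assoc]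
      exact mul_le_mul h1 h2 (abs_nonneg _) ((abs_nonneg _).trans h1)
    · have hyr : r ≤ ‖y‖ := by simpa using hy
      rw [indicator_of_notMem hy]
      simp [hQ, max_eq_left hyr]
  have hmom := (integrable_moment hj.integrable hr1).const_mul C
  have hQi : Integrable Q := by
    refine hmom.mono' (AEStronglyMeasurable.mul ?_ ?_) (.of_forall hQle)
    · exact (aestronglyMeasurable_const.sub (hum.comp_quasiMeasurePreserving
        (quasiMeasurePreserving_add_left volume x))).add hDm.aestronglyMeasurable
    · exact hj.aestronglyMeasurable_norm.sub hJ.1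
  have hQint : |∫ y, Q y| ≤ C * smallMoment (m + 1) j r := by
    rw [smallMoment, ← integral_const_mul]
    exact norm_integral_le_of_norm_le hmom (.of_forall hQle)
  obtain ⟨hJ1, hJ2⟩ := integral_halfspace_add_reflect (hJ.comp_sub_right x)
  obtain ⟨hG1, hG2⟩ := integral_halfspace_add_reflect (hGi.comp_sub_right x)
  obtain ⟨hQ1, hQ2⟩ := integral_halfspace_add_reflect (hQi.comp_sub_right x)
  rw [integral_sub_right_eq_self (fun y : E (m + 1) => j (max ‖y‖ r)) x] at hJ2
  rw [integral_sub_right_eq_self G x, hG0] at hG2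
  rw [integral_sub_right_eq_self Q x] at hQ2
  -- each part of the integrand is summed over a point and its mirror image; by antisymmetry the
  -- values of `u` combine to the difference of the kernels
  have key : levyOpAnti j u x = (u x * (∫ y : E (m + 1), j (max ‖y‖ r)) -
      ∫ z in {z : E (m + 1) | 0 < z 0}, g z * (z 0 * mirrorDiff j r x z)) + 0 + ∫ y, Q y := by
    have e1 := integral_sub (hJ1.const_mul (u x)) hint
    have e2 := integral_add ((hJ1.const_mul (u x)).sub hint) hG1
    have e3 := integral_add (((hJ1.const_mul (u x)).sub hint).add hG1) hQ1
    simp only [Pi.add_apply, Pi.sub_apply] at e2 e3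
    rw [e2, e1, integral_const_mul, hJ2, hG2, hQ2] at e3
    rw [← e3, levyOpAnti]
    refine integral_congr_ae ?_
    filter_upwards [ae_restrict_mem (measurableSet_halfspace m), ae_restrict_of_ae hgu]
      with z (hz : 0 < z 0) hgz
    have h1 : u z = g z * z 0 := by rw [hgz]; field_simp
    simp only [levyIntegrand, hG, hQ, add_sub_cancel, hanti, h1, mirrorDiff, hD]
    ring
  rw [key]
  simpa using hQint

end LevyProfile

namespace AntisymSolution

variable {m : ℕ} {j : ℝ → ℝ} {Ω : Set (E (m + 1))} {M : ℝ} {c u : E (m + 1) → ℝ}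
  (hu : AntisymSolution j Ω M c u) (hj : LevyProfile m j)

include hu in
lemma measurable_indicator (hΩ : IsOpen Ω) : Measurable (Ω.indicator c) := by
  refine measurable_of_restrict_of_restrict_compl hΩ.measurableSet ?_ ?_
  · have : Ω.domRestrict (Ω.indicator c) = fun x : Ω => c x := by
      ext x; exact indicator_of_mem x.2 c
    rw [this]; exact hu.measurable
  · have : Ωᶜ.domRestrict (Ω.indicator c) = fun _ => 0 := by
      ext x; exact indicator_of_notMem x.2 c
    rw [this]; exact measurable_const

include hu hj in
/-- The lift `x ↦ (u / x₁)(collapse x)` is a weak solution of the lifted equation. -/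
lemma weakSolution_lift (hΩ : IsOpen Ω) :
    WeakSolution (nextKernel j) (collapse ⁻¹' Ω) (c ∘ collapse)
      (fun x => u (collapse x) / collapse x 0) := by
  intro φ hφ1 hφ2 hφΩ
  have hφ : IsTest φ := ⟨hφ1, hφ2⟩
  have hk := hj.levyKernel
  obtain ⟨g, B, hg, hg0, hgB, hgu⟩ := hu.exists_representative
  obtain ⟨Bc, hBc⟩ := hu.bounded
  set v : E (m + 3) → ℝ := g ∘ collapse with hv
  have hvu : v =ᵐ[volume] fun x => u (collapse x) / collapse x 0 :=
    (quasiMeasurePreserving_collapse m).ae_eq_comp hgu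
  have hvm : Measurable v := hg.comp (measurable_collapse m)
  have hvB : ∀ x, |v x| ≤ B := fun x => by
    rw [hv, Function.comp_apply, abs_of_nonneg (hg0 _)]; exact hgB _
  -- uniform Taylor expansion of `u` on the projection of the support of the test function
  have hS : IsCompact (collapse '' tsupport φ) := hφ2.isCompact.image (continuous_collapse m)
  obtain ⟨C, a, hC, ha, hT⟩ := exists_taylor_bound hΩ hu.contDiffOn hS (image_subset_iff.2 hφΩ)
  set ct : E (m + 3) → ℝ := Ω.indicator c ∘ collapse with hct
  have hctm : Measurable ct := (hu.measurable_indicator hΩ).comp (measurable_collapse m)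
  have hctΩ : ∀ x ∈ collapse ⁻¹' Ω, ct x = c (collapse x) := fun x hx => by
    rw [hct, Function.comp_apply, indicator_of_mem (show collapse x ∈ Ω from hx)]
  -- the truncated operators converge on the support of the test function
  have hest : ∀ r, 0 < r → r ≤ 1 → r ≤ a → ∀ x ∈ tsupport φ, 0 < collapse x 0 →
      v x = u (collapse x) / collapse x 0 →
      |truncOp (nextKernel j) r v x + ct x * v x| ≤
        C * smallMoment (m + 1) j r / collapse x 0 := by
    intro r hr hr1 hra x hx hρ hvx
    obtain ⟨hio, hav⟩ := hj.avgOp_collapse hg hg0 hgB hr hρ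
    have h1 := hj.abs_levyOpAnti_sub_le hg hgu hu.antisymm hr hr1
      (fun y hy => hT _ (mem_image_of_mem _ hx) y (hy.trans_le hra)) hio
    have heq := hu.equation (collapse x) (hφΩ hx) hρ
    rw [le_div_iff₀ hρ, ← abs_of_pos hρ, ← abs_mul]
    rw [← hav, ← hj.integral_cut_nextKernel hr] at h1
    have h2 : u (collapse x) = v x * collapse x 0 := by rw [hvx]; field_simp
    have h3 : (truncOp (nextKernel j) r v x + ct x * v x) * collapse x 0 =
        -(levyOpAnti j u (collapse x) - (u (collapse x) *
          (∫ y : E (m + 3), (Ioi r).indicator (nextKernel j) ‖y‖) -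
          collapse x 0 * avgOp (nextKernel j) r (g ∘ collapse) x)) := by
      rw [hctΩ x (hφΩ hx), truncOp]
      rw [h2] at heq ⊢
      linear_combination heq
    rw [h3, abs_neg]
    exact h1
  have hev : ∀ᶠ r : ℝ in 𝓝[>] (0 : ℝ), (0 < r ∧ r ≤ 1 ∧ r ≤ a) := by
    filter_upwards [self_mem_nhdsWithin, mem_nhdsWithin_of_mem_nhds (Iic_mem_nhds one_pos),
      mem_nhdsWithin_of_mem_nhds (Iic_mem_nhds ha)] with r h1 h2 h3
    exact ⟨h1, h2, h3⟩
  have hmom := tendsto_smallMoment hj.integrable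
  have hev2 : ∀ᶠ r : ℝ in 𝓝[>] (0 : ℝ), smallMoment (m + 1) j r ≤ 1 :=
    hmom.eventually (Iic_mem_nhds one_pos)
  have hlim := hk.tendsto_integral_mul_truncOp' hφ hvm.aestronglyMeasurable hvB
  have hgood : ∀ᵐ x : E (m + 3), 0 < collapse x 0 ∧ v x = u (collapse x) / collapse x 0 := by
    filter_upwards [ae_collapse_pos m, hvu] with x h1 h2
    exact ⟨h1, h2⟩
  have hlim2 : Tendsto (fun r => ∫ x, φ x * truncOp (nextKernel j) r v x) (𝓝[>] 0)
      (𝓝 (∫ x, φ x * -(ct x * v x))) := by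
    refine tendsto_integral_filter_of_dominated_convergence
      (fun x => |φ x| * (|Bc| * B) + |φ x / collapse x 0| * C) ?_ ?_ ?_ ?_
    · exact .of_forall fun r => hφ.continuous.aestronglyMeasurable.mul
        (hk.aestronglyMeasurable_truncOp hvm.aestronglyMeasurable r)
    · filter_upwards [hev, hev2] with r ⟨h1, h2, h3⟩ h4
      filter_upwards [hgood] with x ⟨hx1, hx2⟩
      by_cases hx : x ∈ tsupport φ
      · have h5 := hest r h1 h2 h3 x hx hx1 hx2
        have h6 : |ct x * v x| ≤ |Bc| * B := by
          rw [abs_mul]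
          refine mul_le_mul ?_ (hvB x) (abs_nonneg _) (abs_nonneg _)
          rw [hctΩ x (hφΩ hx)]
          exact (hBc _ (hφΩ hx)).trans (le_abs_self _)
        have h7 : C * smallMoment (m + 1) j r / collapse x 0 ≤ C / collapse x 0 := by
          gcongr
          exact mul_le_of_le_one_right hC h4
        have h8 : |truncOp (nextKernel j) r v x| ≤ |Bc| * B + C / collapse x 0 := by
          calc |truncOp (nextKernel j) r v x|
              = |(truncOp (nextKernel j) r v x + ct x * v x) - ct x * v x| := by
                congr 1; ring
            _ ≤ _ := abs_sub _ _
            _ ≤ _ := by linarith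
        rw [norm_mul, Real.norm_eq_abs, Real.norm_eq_abs, abs_div, abs_of_pos hx1]
        calc _ ≤ |φ x| * (|Bc| * B + C / collapse x 0) := by gcongr
          _ = _ := by ring
      · have : φ x = 0 := image_eq_zero_of_notMem_tsupport hx
        simp [this]
    · exact (hφ.integrable.abs.mul_const _).add ((integrable_div_collapse hφ).abs.mul_const _)
    · filter_upwards [hgood] with x ⟨hx1, hx2⟩
      by_cases hx : x ∈ tsupport φ
      · refine Tendsto.const_mul _ ?_
        rw [tendsto_iff_dist_tendsto_zero]
        have h0 : Tendsto (fun r => C * smallMoment (m + 1) j r / collapse x 0) (𝓝[>] 0)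
            (𝓝 0) := by
          simpa using (hmom.const_mul C).div_const (collapse x 0)
        refine squeeze_zero' (.of_forall fun _ => dist_nonneg) ?_ h0
        filter_upwards [hev] with r ⟨h1, h2, h3⟩
        rw [Real.dist_eq, sub_neg_eq_add]
        exact hest r h1 h2 h3 x hx hx1 hx2
      · have : φ x = 0 := image_eq_zero_of_notMem_tsupport hx
        simp [this]
  have huniq := tendsto_nhds_unique hlim hlim2
  have h1 : ∫ x, u (collapse x) / collapse x 0 * levyOp (nextKernel j) φ x =
      ∫ x, v x * levyOp (nextKernel j) φ x := by
    refine integral_congr_ae ?_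
    filter_upwards [hvu] with x hx
    rw [hx]
  have h2 : ∫ x in collapse ⁻¹' Ω, (c ∘ collapse) x * (u (collapse x) / collapse x 0) * φ x =
      ∫ x, φ x * (ct x * v x) := by
    rw [← integral_indicator ((measurable_collapse m) hΩ.measurableSet)]
    refine integral_congr_ae ?_
    filter_upwards [hvu] with x hx
    by_cases hxΩ : x ∈ collapse ⁻¹' Ω
    · rw [indicator_of_mem hxΩ, hctΩ x hxΩ, hx, Function.comp_apply]; ring
    · have : φ x = 0 := image_eq_zero_of_notMem_tsupport fun h => hxΩ (hφΩ h)
      rw [indicator_of_notMem hxΩ, this, zero_mul]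
  rw [h1, h2, huniq]
  simp only [mul_neg, integral_neg]
  ring

end AntisymSolution

/-! ### Bounded weak solutions and their mollification -/

lemma SupLeInf.of_forall {X : Type*} {A : ℝ} {K : Set X} {f : X → ℝ} (hA : 0 < A)
    (h : ∀ x ∈ K, ∀ y ∈ K, f x ≤ A * f y) : SupLeInf A K f := by
  have hA0 : ENNReal.ofReal A ≠ 0 := by simpa using hA
  refine iSup₂_le fun x hx => ?_
  rw [mul_comm, ← ENNReal.div_le_iff_le_mul (Or.inl hA0) (Or.inl ENNReal.ofReal_ne_top)]
  · refine le_iInf₂ fun y hy => ?_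
    refine ENNReal.div_le_of_le_mul ?_
    rw [mul_comm, ← ENNReal.ofReal_mul hA.le]
    exact ENNReal.ofReal_le_ofReal (h x hx y hy)

lemma SupLeInf.le_mul {X : Type*} {A : ℝ} {K : Set X} {f : X → ℝ} (hA : 0 < A)
    (hf : ∀ x, 0 ≤ f x) (h : SupLeInf A K f) {x y : X} (hx : x ∈ K) (hy : y ∈ K) :
    f x ≤ A * f y := by
  have h1 : ENNReal.ofReal (f x) ≤ ENNReal.ofReal A * ENNReal.ofReal (f y) :=
    (le_iSup₂ (f := fun x (_ : x ∈ K) => ENNReal.ofReal (f x)) x hx).trans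
      (h.trans (by gcongr; exact iInf₂_le y hy))
  rw [← ENNReal.ofReal_mul hA.le] at h1
  exact (ENNReal.ofReal_le_ofReal_iff (mul_nonneg hA.le (hf y))).1 h1

/-- `v` is a bounded nonnegative weak solution of `L v + f = 0` in `Ω`, where `|f| ≤ M v`. -/
structure BoundedWeakSolution {d : ℕ} (k : ℝ → ℝ) (Ω : Set (E d)) (M B : ℝ) (v f : E d → ℝ) :
    Prop where
  aesm : AEStronglyMeasurable v
  nonneg : ∀ x, 0 ≤ v x
  le : ∀ x, v x ≤ B
  aesm_rhs : AEStronglyMeasurable f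
  abs_rhs_le : ∀ x, |f x| ≤ M * v x
  eq : ∀ φ, IsTest φ → tsupport φ ⊆ Ω → (∫ x, v x * levyOp k φ x) + ∫ x, f x * φ x = 0

/-- The Harnack inequality applied to a solution of `L w + F = 0` with `|F| ≤ M w`: such an
equation has the form `L w + c w = 0` with `c = F / w`. -/
lemma HarnackConstant.le_mul {d : ℕ} {k : ℝ → ℝ} {U K : Set (E d)} {M A B : ℝ}
    (h : HarnackConstant k U K M A) (hU : IsOpen U) {w F : E d → ℝ} (hw2 : ContDiffOn ℝ 2 w U)
    (hwm : AEStronglyMeasurable w) (hw0 : ∀ x, 0 ≤ w x) (hwB : ∀ᵐ x, w x ≤ B)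
    (hFm : AEStronglyMeasurable F) (hF : ∀ x ∈ U, |F x| ≤ M * w x) (hM : 0 ≤ M)
    (heq : ∀ φ, IsTest φ → tsupport φ ⊆ U → (∫ x, w x * levyOp k φ x) + ∫ x, F x * φ x = 0)
    {x y : E d} (hx : x ∈ K) (hy : y ∈ K) : w x ≤ A * w y := by
  refine SupLeInf.le_mul h.1 hw0 (h.2 (fun x => F x / w x) w ?_ ?_ hw2 ?_ hw0 ?_) hx hy
  all_goals
    have hcb : ∀ᵐ x ∂volume.restrict U, ‖F x / w x‖ ≤ M := by
      refine (ae_restrict_mem hU.measurableSet).mono fun x hx => ?_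
      rw [Real.norm_eq_abs, abs_div, abs_of_nonneg (hw0 x)]
      exact div_le_of_le_mul₀ (hw0 x) hM (hF x hx)
  · exact memLp_top_of_bound
      (hFm.aemeasurable.div hwm.aemeasurable).aestronglyMeasurable.restrict M hcb
  · exact eLpNormEssSup_le_of_ae_bound hcb
  · refine memLp_top_of_bound hwm B ?_
    filter_upwards [hwB] with x hx
    rwa [Real.norm_eq_abs, abs_of_nonneg (hw0 x)]
  · intro φ h1 h2 h3
    rw [← heq φ ⟨h1, h2⟩ h3, ← integral_indicator hU.measurableSet]
    congr 1
    refine integral_congr_ae (.of_forall fun x => ?_)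
    simp only
    by_cases hx : x ∈ U
    · rw [indicator_of_mem hx]
      -- where `w` vanishes, so does `F`
      rcases eq_or_ne (w x) 0 with h0 | h0
      · have := hF x hx
        rw [h0, mul_zero] at this
        simp [abs_nonpos_iff.1 this]
      · field_simp
    · have : φ x = 0 := image_eq_zero_of_notMem_tsupport fun h => hx (h3 h)
      simp [this]

/-- The mollification of `v` by the normalized bump function `η`. -/
def mollify {d : ℕ} (η : ContDiffBump (0 : E d)) (v : E d → ℝ) (x : E d) : ℝ :=
  ∫ t, η.normed volume t * v (x - t)

section mollify

variable {d : ℕ} (η : ContDiffBump (0 : E d)) {v : E d → ℝ} {B : ℝ}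

lemma locallyIntegrable_of_bounded (hv : AEStronglyMeasurable v) (hB : ∀ x, |v x| ≤ B) :
    LocallyIntegrable v :=
  (memLp_top_of_bound hv B (.of_forall hB)).locallyIntegrable le_top

lemma contDiff_mollify (hv : AEStronglyMeasurable v) (hB : ∀ x, |v x| ≤ B) :
    ContDiff ℝ ∞ (mollify η v) :=
  η.hasCompactSupport_normed.contDiff_convolution_left (ContinuousLinearMap.lsmul ℝ ℝ)
    η.contDiff_normed (locallyIntegrable_of_bounded hv hB)

lemma integrable_mollify (hv : AEStronglyMeasurable v) (hB : ∀ x, |v x| ≤ B) (x : E d) :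
    Integrable fun t => η.normed volume t * v (x - t) := by
  have h := η.integrable_normed (μ := (volume : Measure (E d)))
  refine (h.bdd_mul (c := B) (hv.comp_quasiMeasurePreserving
    (quasiMeasurePreserving_sub_left volume x)) (.of_forall fun t => hB _)).congr
    (.of_forall fun t => ?_)
  simp only [Function.comp_apply]
  ring

lemma mollify_nonneg (h0 : ∀ x, 0 ≤ v x) (x : E d) : 0 ≤ mollify η v x :=
  integral_nonneg fun t => mul_nonneg (η.nonneg_normed t) (h0 _)

lemma abs_mollify_le {f : E d → ℝ} {M : ℝ} (hv : AEStronglyMeasurable v) (hB : ∀ x, |v x| ≤ B)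
    (hf : ∀ x, |f x| ≤ M * v x) (x : E d) : |mollify η f x| ≤ M * mollify η v x := by
  rw [mollify, mollify, ← integral_const_mul, ← Real.norm_eq_abs]
  refine norm_integral_le_of_norm_le ((integrable_mollify η hv hB x).const_mul M)
    (.of_forall fun t => ?_)
  rw [norm_mul, Real.norm_eq_abs, Real.norm_eq_abs, abs_of_nonneg (η.nonneg_normed t)]
  calc _ ≤ η.normed volume t * (M * v (x - t)) :=
        mul_le_mul_of_nonneg_left (hf _) (η.nonneg_normed t)
    _ = _ := by ring

lemma mollify_le (hB : ∀ x, |v x| ≤ B) (x : E d) :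
    |mollify η v x| ≤ B := by
  have := abs_mollify_le η (v := fun _ => 1) (f := v) (M := B) (B := 1)
    aestronglyMeasurable_const (by simp) (by simpa using hB) x
  simpa [mollify, η.integral_normed] using this

lemma abs_mollify_sub_le (hv : AEStronglyMeasurable v) (hB : ∀ x, |v x| ≤ B) {x : E d} {a δ : ℝ}
    (h : ∀ t, ‖t‖ < η.rOut → |v (x - t) - a| ≤ δ) : |mollify η v x - a| ≤ δ := by
  have h1 : a = ∫ t, η.normed volume t * a := by
    rw [integral_mul_const, η.integral_normed, one_mul]
  have h2 := η.integrable_normed (μ := (volume : Measure (E d)))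
  have h3 : mollify η v x - a = ∫ t, η.normed volume t * (v (x - t) - a) := by
    nth_rewrite 1 [h1]
    rw [mollify, ← integral_sub (integrable_mollify η hv hB x) (h2.mul_const a)]
    simp only [mul_sub]
  have h4 : δ = ∫ t, η.normed volume t * δ := by
    rw [integral_mul_const, η.integral_normed, one_mul]
  rw [h3, h4, ← Real.norm_eq_abs]
  refine norm_integral_le_of_norm_le (h2.mul_const δ) (.of_forall fun t => ?_)
  rw [norm_mul, Real.norm_eq_abs, Real.norm_eq_abs, abs_of_nonneg (η.nonneg_normed t)]
  by_cases ht : ‖t‖ < η.rOut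
  · exact mul_le_mul_of_nonneg_left (h t ht) (η.nonneg_normed t)
  · have : η.normed volume t = 0 := by
      have : t ∉ Function.support (η.normed volume) := by
        rw [η.support_normed_eq]; simpa using ht
      simpa using this
    simp [this]

/-- Mollification as an average of translations, tested against an integrable function. -/
lemma integral_mollify_mul (hv : AEStronglyMeasurable v) (hB : ∀ x, |v x| ≤ B) {ψ : E d → ℝ}
    (hψ : Integrable ψ) :
    ∫ x, mollify η v x * ψ x = ∫ t, η.normed volume t * ∫ x, v x * ψ (x + t) := by
  have h := η.integrable_normed (μ := (volume : Measure (E d)))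
  have h1 : Integrable (fun p : E d × E d => v (p.2 - p.1) * (η.normed volume p.1 * ψ p.2))
      (volume.prod volume) := by
    refine (h.mul_prod hψ).bdd_mul (c := B) (hv.comp_quasiMeasurePreserving ?_)
      (.of_forall fun p => hB _)
    exact (quasiMeasurePreserving_sub volume volume).comp
      Measure.measurePreserving_swap.quasiMeasurePreserving
  calc ∫ x, mollify η v x * ψ x
      = ∫ x, ∫ t, v (x - t) * (η.normed volume t * ψ x) := by
        refine integral_congr_ae (.of_forall fun x => ?_)
        simp only [mollify]
        rw [← integral_mul_const]
        exact integral_congr_ae (.of_forall fun t => by simp only; ring)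
    _ = ∫ t, ∫ x, v (x - t) * (η.normed volume t * ψ x) :=
        (integral_integral_swap
          (f := fun t x => v (x - t) * (η.normed volume t * ψ x)) h1).symm
    _ = _ := by
        refine integral_congr_ae (.of_forall fun t => ?_)
        simp only
        rw [← integral_const_mul, ← integral_add_right_eq_self _ t]
        refine integral_congr_ae (.of_forall fun x => ?_)
        simp only [add_sub_cancel_right]
        ring

end mollify

lemma IsTest.translate {d : ℕ} {φ : E d → ℝ} (hφ : IsTest φ) (t : E d) :
    IsTest fun x => φ (x + t) :=
  ⟨hφ.contDiff.comp (by fun_prop), hφ.compact.comp_homeomorph (Homeomorph.addRight t)⟩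

lemma levyOp_translate {d : ℕ} (k : ℝ → ℝ) (φ : E d → ℝ) (t x : E d) :
    levyOp k (fun x => φ (x + t)) x = levyOp k φ (x + t) := by
  simp only [levyOp, levyIntegrand, fderiv_comp_add_right, add_right_comm]

namespace BoundedWeakSolution

variable {d : ℕ} {k : ℝ → ℝ} {Ω : Set (E d)} {M B : ℝ} {v f : E d → ℝ}
  (h : BoundedWeakSolution k Ω M B v f)

include h in
lemma abs_le (x : E d) : |v x| ≤ B := by
  rw [abs_of_nonneg (h.nonneg x)]; exact h.le x

include h in
lemma abs_rhs_le' (hM : 0 ≤ M) (x : E d) : |f x| ≤ M * B :=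
  (h.abs_rhs_le x).trans (by gcongr; exact h.le x)

include h in
/-- The equation is preserved by mollification, away from the boundary of `Ω`. -/
lemma mollify_eq (hk : LevyKernel d k) (hM : 0 ≤ M) (η : ContDiffBump (0 : E d)) {φ : E d → ℝ}
    (hφ : IsTest φ) (hφΩ : ∀ x ∈ tsupport φ, ∀ t, ‖t‖ < η.rOut → x - t ∈ Ω) :
    (∫ x, mollify η v x * levyOp k φ x) + ∫ x, mollify η f x * φ x = 0 := by
  rw [integral_mollify_mul η h.aesm h.abs_le (hk.integrable_levyOp hφ),
    integral_mollify_mul η h.aesm_rhs (h.abs_rhs_le' hM) hφ.integrable,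
    add_eq_zero_iff_eq_neg, ← integral_neg]
  refine integral_congr_ae (.of_forall fun t => ?_)
  simp only
  by_cases ht : ‖t‖ < η.rOut
  · have hsub : tsupport (fun x => φ (x + t)) ⊆ Ω := by
      intro x hx
      have := tsupport_comp_subset_preimage φ (f := fun x => x + t) (by fun_prop) hx
      simpa using hφΩ _ this t ht
    have h1 := h.eq _ (hφ.translate t) hsub
    simp only [levyOp_translate] at h1
    rw [add_eq_zero_iff_eq_neg.1 h1]
    ring
  · have : η.normed volume t = 0 := by
      have : t ∉ Function.support (η.normed volume) := by
        rw [η.support_normed_eq]; simpa using ht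
      simpa using this
    simp [this]

end BoundedWeakSolution

/-! ### Harnack constants of relatively compact subsets -/

/-- A bump function supported in the ball of radius `ε`. -/
def bump (d : ℕ) {ε : ℝ} (hε : 0 < ε) : ContDiffBump (0 : E d) :=
  ⟨ε / 2, ε, by positivity, by linarith⟩

lemma tendsto_mollify_bump {d : ℕ} {v : E d → ℝ} {B : ℝ} (hv : AEStronglyMeasurable v)
    (hB : ∀ x, |v x| ≤ B) {x : E d} (hx : ContinuousAt v x) :
    Tendsto (fun n : ℕ => mollify (bump d (Nat.one_div_pos_of_nat (α := ℝ) (n := n))) v x) atTop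
      (𝓝 (v x)) := by
  rw [Metric.tendsto_atTop]
  intro δ hδ
  obtain ⟨ε, hε, h⟩ := Metric.continuousAt_iff.1 hx (δ / 2) (by positivity)
  obtain ⟨N, hN⟩ := exists_nat_one_div_lt hε
  refine ⟨N, fun n hn => ?_⟩
  rw [Real.dist_eq]
  refine (abs_mollify_sub_le _ hv hB (δ := δ / 2) fun t ht => ?_).trans_lt (by linarith)
  refine (h ?_).le
  rw [dist_eq_norm, sub_sub_cancel_left, norm_neg]
  refine (ht.trans_le ?_).trans hN
  exact Nat.one_div_le_one_div hn

namespace BoundedWeakSolution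

variable {d : ℕ} {k : ℝ → ℝ} {Ω : Set (E d)} {M B : ℝ} {v f : E d → ℝ}
  (h : BoundedWeakSolution k Ω M B v f)

include h in
/-- A Harnack constant for a relatively compact open subset `U` of `Ω` applies to continuous weak
solutions in `Ω`, since these are limits of their mollifications, which solve an equation with the
same bound on the potential in `U`. -/
lemma le_mul_of_subset (hk : LevyKernel d k) (hM : 0 ≤ M) (hΩ : IsOpen Ω) {U K : Set (E d)}
    (hU : IsOpen U) (hUc : IsCompact (closure U)) (hUΩ : closure U ⊆ Ω) {A : ℝ}
    (hA : HarnackConstant k U K M A) {x y : E d} (hx : x ∈ K) (hy : y ∈ K)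
    (hvx : ContinuousAt v x) (hvy : ContinuousAt v y) : v x ≤ A * v y := by
  obtain ⟨ε, hε, hεΩ⟩ := hUc.exists_cthickening_subset_open hΩ hUΩ
  refine le_of_tendsto_of_tendsto (tendsto_mollify_bump h.aesm h.abs_le hvx)
    ((tendsto_mollify_bump h.aesm h.abs_le hvy).const_mul A) ?_
  obtain ⟨N, hN⟩ := exists_nat_one_div_lt hε
  filter_upwards [eventually_ge_atTop N] with n hn
  set η := bump d (Nat.one_div_pos_of_nat (α := ℝ) (n := n)) with hη
  have hηε : η.rOut ≤ ε := (Nat.one_div_le_one_div hn).trans hN.le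
  refine hA.le_mul hU (contDiff_infty.1 (contDiff_mollify η h.aesm h.abs_le) 2).contDiffOn
    (contDiff_mollify η h.aesm h.abs_le).continuous.aestronglyMeasurable
    (mollify_nonneg η h.nonneg) (B := B)
    (.of_forall fun x => (le_abs_self _).trans (mollify_le η h.abs_le x))
    (contDiff_mollify η h.aesm_rhs (h.abs_rhs_le' hM)).continuous.aestronglyMeasurable
    (fun x _ => abs_mollify_le η h.aesm h.abs_le h.abs_rhs_le x) hM (fun φ hφ hφU => ?_) hx hy
  refine h.mollify_eq hk hM η hφ fun x hx t ht => hεΩ ?_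
  refine Metric.mem_cthickening_of_dist_le _ x _ _ (subset_closure (hφU hx)) ?_
  rw [dist_eq_norm, sub_sub_cancel_left, norm_neg]
  exact ht.le.trans hηε

end BoundedWeakSolution

namespace AntisymSolution

variable {m : ℕ} {j : ℝ → ℝ} {Ω : Set (E (m + 1))} {M : ℝ} {c u : E (m + 1) → ℝ}
  (hu : AntisymSolution j Ω M c u) (hj : LevyProfile m j)

include hu in
lemma continuousAt_div (hΩ : IsOpen Ω) {x : E (m + 1)} (hx : x ∈ Ω) (hx0 : 0 < x 0) :
    ContinuousAt (fun x => u x / x 0) x :=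
  (hu.contDiffOn.continuousOn.continuousAt (hΩ.mem_nhds hx)).div (by fun_prop) hx0.ne'

include hu in
lemma exists_bound_div (hΩ : IsOpen Ω) : ∃ B : ℝ, 0 ≤ B ∧ (∀ᵐ x, u x / x 0 ≤ B) ∧
    ∀ x ∈ Ω, 0 < x 0 → u x / x 0 ≤ B := by
  obtain ⟨g, B, hg, hg0, hgB, hgu⟩ := hu.exists_representative
  have hae : ∀ᵐ x, u x / x 0 ≤ B := by
    filter_upwards [hgu] with x hx
    rw [← hx]; exact hgB x
  refine ⟨B, (hg0 0).trans (hgB 0), hae, fun x hx hx0 => ?_⟩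
  by_contra! hlt
  have h1 : ∀ᶠ z in 𝓝 x, B < u z / z 0 :=
    (hu.continuousAt_div hΩ hx hx0).eventually (Ioi_mem_nhds hlt)
  have h2 : volume {z : E (m + 1) | ¬u z / z 0 ≤ B} = 0 := ae_iff.1 hae
  have h3 : {z : E (m + 1) | ¬u z / z 0 ≤ B} ∈ 𝓝 x := h1.mono fun z hz => not_le.2 hz
  exact (Measure.measure_pos_of_mem_nhds volume h3).ne' h2

include hu hj in
/-- Every bounded representative of the lift is a bounded nonnegative weak solution. -/
lemma exists_boundedWeakSolution (hΩ : IsOpen Ω) (hM : 0 ≤ M) {w : E (m + 3) → ℝ} {B : ℝ}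
    (hw : w =ᵐ[volume] fun x => u (collapse x) / collapse x 0) (hw0 : ∀ x, 0 ≤ w x)
    (hwB : ∀ x, w x ≤ B) :
    ∃ f, BoundedWeakSolution (nextKernel j) (collapse ⁻¹' Ω) M B w f := by
  have hwm : AEStronglyMeasurable w := by
    obtain ⟨g, B, hg, hg0, hgB, hgu⟩ := hu.exists_representative
    exact (hg.comp (measurable_collapse m)).aestronglyMeasurable.congr
      (((quasiMeasurePreserving_collapse m).ae_eq_comp hgu).trans hw.symm)
  -- on the lifted domain, clamping the potential to `[-M, M]` changes it only on a null set
  set ct : E (m + 3) → ℝ := fun x => max (-M) (min M (Ω.indicator c (collapse x))) with hct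
  have hctm : Measurable ct := measurable_const.max
    (measurable_const.min ((hu.measurable_indicator hΩ).comp (measurable_collapse m)))
  have hctM : ∀ x, |ct x| ≤ M := fun x =>
    abs_le.2 ⟨le_max_left _ _, max_le (by linarith) (min_le_left _ _)⟩
  have hΩm : MeasurableSet (collapse ⁻¹' Ω : Set (E (m + 3))) :=
    measurable_collapse m hΩ.measurableSet
  have hctc : ∀ᵐ x : E (m + 3), x ∈ collapse ⁻¹' Ω → ct x = c (collapse x) := by
    have h1 : ∀ᵐ z : E (m + 1), z ∈ {x ∈ Ω | 0 < x 0} → |c z| ≤ M := by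
      have hms : MeasurableSet {x ∈ Ω | 0 < x 0} :=
        hΩ.measurableSet.inter (measurableSet_halfspace m)
      rw [← ae_restrict_iff' hms]
      have h2 := ae_le_eLpNormEssSup (f := c) (μ := volume.restrict {x ∈ Ω | 0 < x 0})
      filter_upwards [h2] with z hz
      have h3 := hz.trans (eLpNorm_exponent_top (f := c) ▸ hu.norm_le)
      rw [← ofReal_norm, Real.norm_eq_abs] at h3
      exact (ENNReal.ofReal_le_ofReal_iff hM).1 h3
    filter_upwards [(quasiMeasurePreserving_collapse m).ae h1, ae_collapse_pos m] with x hx hx0 hxΩ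
    have h2 := abs_le.1 (hx ⟨hxΩ, hx0⟩)
    rw [hct]
    simp only
    rw [indicator_of_mem (show collapse x ∈ Ω from hxΩ), min_eq_right h2.2, max_eq_right h2.1]
  refine ⟨(collapse ⁻¹' Ω).indicator fun x => ct x * w x, hwm, hw0, hwB,
    (hctm.aestronglyMeasurable.mul hwm).indicator hΩm, fun x => ?_, fun φ hφ hφΩ => ?_⟩
  · by_cases hx : x ∈ collapse ⁻¹' Ω
    · rw [indicator_of_mem hx, abs_mul, abs_of_nonneg (hw0 x)]
      exact mul_le_mul_of_nonneg_right (hctM x) (hw0 x)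
    · rw [indicator_of_notMem hx, abs_zero]
      exact mul_nonneg hM (hw0 x)
  · rw [← hu.weakSolution_lift hj hΩ φ hφ.contDiff hφ.compact hφΩ, ← integral_indicator hΩm]
    congr 1
    · refine integral_congr_ae ?_
      filter_upwards [hw] with x hx
      rw [hx]
    · refine integral_congr_ae ?_
      filter_upwards [hw, hctc] with x hx hcx
      by_cases hxΩ : x ∈ collapse ⁻¹' Ω
      · rw [indicator_of_mem hxΩ, indicator_of_mem hxΩ, hcx hxΩ, hx, Function.comp_apply]
      · rw [indicator_of_notMem hxΩ, indicator_of_notMem hxΩ, zero_mul]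

include hu in
lemma div_fold (x : E (m + 1)) : u (fold x) / fold x 0 = u x / x 0 := by
  have h0 : fold x 0 = |x 0| := by simp [fold]
  rcases le_total 0 (x 0) with h | h
  · have : fold x = x := by
      ext i
      by_cases hi : i = 0
      · subst hi; simp [fold, abs_of_nonneg h]
      · simp [fold, hi]
    rw [this]
  · have : fold x = reflect x := by
      ext i
      by_cases hi : i = 0
      · subst hi; simp [fold, reflect, abs_of_nonpos h]
      · simp [fold, reflect, hi]
    rw [h0, this, hu.antisymm, abs_of_nonpos h, neg_div_neg_eq]

include hu in
/-- The Harnack bound for `u / x₁` follows from the one for the lift off the axis. -/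
lemma harnackBound_of_lift {K : Set (E (m + 1))} {A : ℝ} (hA : 0 < A)
    (h : ∀ x ∈ collapse ⁻¹' (fold '' K), ∀ y ∈ collapse ⁻¹' (fold '' K), 0 < collapse x 0 →
      0 < collapse y 0 →
      u (collapse x) / collapse x 0 ≤ A * (u (collapse y) / collapse y 0)) :
    AntisymHarnackBound A K u := by
  refine SupLeInf.of_forall hA fun x hx y hy => ?_
  have h0 : ∀ x : E (m + 1), fold x 0 = |x 0| := fun x => by simp [fold]
  obtain ⟨xt, hxt⟩ := exists_collapse_eq (z := fold x) (by rw [h0]; positivity)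
  obtain ⟨yt, hyt⟩ := exists_collapse_eq (z := fold y) (by rw [h0]; positivity)
  have := h xt (by rw [mem_preimage, hxt]; exact mem_image_of_mem _ hx.1)
    yt (by rw [mem_preimage, hyt]; exact mem_image_of_mem _ hy.1)
    (by rw [hxt, h0]; exact abs_pos.2 hx.2) (by rw [hyt, h0]; exact abs_pos.2 hy.2)
  rwa [hxt, hyt, hu.div_fold, hu.div_fold] at this

include hu hj in
/-- A Harnack constant for a relatively compact open subset of the lifted domain is a constant for
the antisymmetric problem. The lift is continuous off the axis, and only values there are
compared. -/
lemma harnackBound_of_subset (hΩ : IsOpen Ω) (hM : 0 ≤ M) {K : Set (E (m + 1))}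
    (hfold : fold '' K ⊆ Ω) {U : Set (E (m + 3))} {A : ℝ}
    (hU : IsOpen U) (hUc : IsCompact (closure U)) (hUΩ : closure U ⊆ collapse ⁻¹' Ω)
    (hA : HarnackConstant (nextKernel j) U (collapse ⁻¹' (fold '' K)) M A) :
    AntisymHarnackBound A K u := by
  obtain ⟨B, hB0, hae, hB⟩ := hu.exists_bound_div hΩ
  set w : E (m + 3) → ℝ := fun x => min B (u (collapse x) / collapse x 0) with hw
  have hwu : w =ᵐ[volume] fun x => u (collapse x) / collapse x 0 := by
    filter_upwards [(quasiMeasurePreserving_collapse m).ae hae] with x hx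
    exact min_eq_right hx
  obtain ⟨f, hf⟩ := hu.exists_boundedWeakSolution hj hΩ hM hwu
    (fun x => le_min hB0 (hu.div_nonneg _)) (fun x => min_le_left _ _)
  have hcont : ∀ x ∈ collapse ⁻¹' (fold '' K), 0 < collapse x 0 → ContinuousAt w x :=
    fun x hx hx0 => continuousAt_const.min (ContinuousAt.comp (f := collapse)
      (hu.continuousAt_div hΩ (hfold hx) hx0) (continuous_collapse m).continuousAt)
  refine hu.harnackBound_of_lift hA.1 fun x hx y hy hx0 hy0 => ?_
  have := hf.le_mul_of_subset hj.levyKernel hM (hΩ.preimage (continuous_collapse m)) hU hUc hUΩ hA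
    hx hy (hcont x hx hx0) (hcont y hy hy0)
  simp only [hw] at this
  rwa [min_eq_right (hB _ (hfold hx) hx0), min_eq_right (hB _ (hfold hy) hy0)] at this

end AntisymSolution

/-! ### Connectedness of the lifted sets -/

lemma HarnackConstant.mono {d : ℕ} {k : ℝ → ℝ} {U K Q : Set (E d)} {M A : ℝ}
    (h : HarnackConstant k U Q M A) (hKQ : K ⊆ Q) : HarnackConstant k U K M A := by
  refine ⟨h.1, fun c v h1 h2 h3 h4 h5 h6 => ?_⟩
  have h7 := h.2 c v h1 h2 h3 h4 h5 h6
  unfold SupLeInf at h7 ⊢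
  have e1 : ⨆ x ∈ K, ENNReal.ofReal (v x) ≤ ⨆ x ∈ Q, ENNReal.ofReal (v x) := biSup_mono hKQ
  have e2 : ⨅ x ∈ Q, ENNReal.ofReal (v x) ≤ ⨅ x ∈ K, ENNReal.ofReal (v x) := biInf_mono hKQ
  exact e1.trans (h7.trans (by gcongr))

/-- A compact subset of a connected subset of an open set is contained in a compact connected
subset of that open set: finitely many balls, joined by paths. -/
lemma exists_isCompact_isConnected {d : ℕ} {T S O : Set (E d)} (hT : IsCompact T)
    (hT0 : T.Nonempty) (hTS : T ⊆ S) (hS : IsPreconnected S) (hSO : S ⊆ O) (hO : IsOpen O) :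
    ∃ Q, IsCompact Q ∧ IsConnected Q ∧ T ⊆ Q ∧ Q ⊆ O := by
  obtain ⟨x₀, hx₀⟩ := hT0
  set W := connectedComponentIn O x₀ with hW
  have hWo : IsOpen W := hO.connectedComponentIn
  have hSW : S ⊆ W := hS.subset_connectedComponentIn (hTS hx₀) hSO
  have hWO : W ⊆ O := connectedComponentIn_subset O x₀
  have hWp : IsPathConnected W := hWo.isConnected_iff_isPathConnected.1
    ⟨⟨x₀, hSW (hTS hx₀)⟩, isPreconnected_connectedComponentIn⟩
  have h1 : ∀ x ∈ T, ∃ r, 0 < r ∧ Metric.closedBall x r ⊆ W := fun x hx =>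
    Metric.nhds_basis_closedBall.mem_iff.1 (hWo.mem_nhds (hSW (hTS hx)))
  choose! r hr hrW using h1
  obtain ⟨t, htT, ht⟩ := hT.elim_nhds_subcover (fun x => Metric.closedBall x (r x))
    fun x hx => Metric.closedBall_mem_nhds x (hr x hx)
  have h2 : ∀ x ∈ T, ∃ Γ : Set (E d), IsCompact Γ ∧ IsPreconnected Γ ∧ x₀ ∈ Γ ∧ x ∈ Γ ∧ Γ ⊆ W := by
    intro x hx
    obtain ⟨γ, hγ⟩ := hWp.joinedIn x₀ (hSW (hTS hx₀)) x (hSW (hTS hx))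
    exact ⟨range γ, isCompact_range γ.continuous, isPreconnected_range γ.continuous,
      ⟨0, γ.source⟩, ⟨1, γ.target⟩, range_subset_iff.2 hγ⟩
  choose! Γ hΓc hΓp hΓ0 hΓx hΓW using h2
  have hsub : ∀ x ∈ T, x ∈ Metric.closedBall x (r x) := fun x hx =>
    Metric.mem_closedBall_self (hr x hx).le
  obtain ⟨y, hy, -⟩ := mem_iUnion₂.1 (ht hx₀)
  refine ⟨⋃ x ∈ t, (Metric.closedBall x (r x) ∪ Γ x), ?_, ⟨?_, ?_⟩, ?_, ?_⟩
  · exact t.isCompact_biUnion fun x hx =>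
      (isCompact_closedBall _ _).union (hΓc x (htT x hx))
  · exact ⟨x₀, mem_iUnion₂.2 ⟨y, hy, Or.inr (hΓ0 y (htT y hy))⟩⟩
  · have h3 : ∀ x ∈ t, IsPreconnected (Metric.closedBall x (r x) ∪ Γ x) := fun x hx =>
      IsPreconnected.union x (hsub x (htT x hx)) (hΓx x (htT x hx))
        (convex_closedBall _ _).isPreconnected (hΓp x (htT x hx))
    refine isPreconnected_of_forall x₀ fun z hz => ?_
    obtain ⟨x, hx, hzx⟩ := mem_iUnion₂.1 hz
    exact ⟨_, subset_iUnion₂_of_subset x hx Subset.rfl, Or.inr (hΓ0 x (htT x hx)), hzx, h3 x hx⟩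
  · exact ht.trans (iUnion₂_mono fun x _ => subset_union_left)
  · exact iUnion₂_subset fun x hx => union_subset ((hrW x (htT x hx)).trans hWO)
      ((hΓW x (htT x hx)).trans hWO)

lemma continuous_consE (d : ℕ) : Continuous (fun p : ℝ × E d => consE p.1 p.2) := by
  refine (PiLp.continuous_toLp 2 _).comp (continuous_pi fun i => ?_)
  refine Fin.cases ?_ (fun i => ?_) i
  · simp only [Fin.cons_zero]; fun_prop
  · simp only [Fin.cons_succ]; fun_prop

lemma continuous_glue (m : ℕ) : Continuous (fun p : E 3 × E m => glue p.1 p.2) := by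
  unfold glue
  refine (continuous_consE _).comp (Continuous.prodMk (by fun_prop) ?_)
  refine (continuous_consE _).comp (Continuous.prodMk (by fun_prop) ?_)
  exact (continuous_consE _).comp (Continuous.prodMk (by fun_prop) (by fun_prop))

/-- The preimage of a connected set of the closed half-space under `collapse` is connected, being
the image of its product with the unit sphere of `ℝ³`. -/
lemma isPreconnected_preimage_collapse {m : ℕ} {S : Set (E (m + 1))} (hS : IsPreconnected S)
    (hS0 : ∀ x ∈ S, 0 ≤ x 0) : IsPreconnected (collapse ⁻¹' S : Set (E (m + 3))) := by
  have hsph : IsPreconnected (Metric.sphere (0 : E 3) 1) := by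
    refine isPreconnected_sphere ?_ 0 1
    rw [← Module.finrank_eq_rank ℝ (E 3)]
    simp
  set Φ : E 3 × E (m + 1) → E (m + 3) := fun p =>
    glue (p.2 0 • p.1) (WithLp.toLp 2 fun i => p.2 i.succ) with hΦ
  have hΦc : Continuous Φ := (continuous_glue m).comp
    (Continuous.prodMk (by fun_prop) (by fun_prop))
  have himg : collapse ⁻¹' S = Φ '' (Metric.sphere (0 : E 3) 1 ×ˢ S) := by
    refine Subset.antisymm (fun x hx => ?_) ?_
    · obtain ⟨w, y, rfl⟩ := exists_glue x
      rw [mem_preimage, collapse_glue] at hx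
      have h1 : ∃ θ : E 3, ‖θ‖ = 1 ∧ ‖w‖ • θ = w := by
        rcases eq_or_ne w 0 with rfl | hw
        · exact ⟨EuclideanSpace.single 0 1, by simp, by simp⟩
        · have hw' : ‖w‖ ≠ 0 := norm_ne_zero_iff.2 hw
          refine ⟨‖w‖⁻¹ • w, ?_, smul_inv_smul₀ hw' w⟩
          rw [norm_smul, norm_inv, norm_norm, inv_mul_cancel₀ hw']
      obtain ⟨θ, hθ, hθw⟩ := h1
      refine ⟨(θ, consE ‖w‖ y), ⟨by simpa using hθ, hx⟩, ?_⟩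
      simp only [hΦ, consE_zero, consE_succ, hθw]
    · rintro _ ⟨⟨θ, z⟩, ⟨hθ, hz⟩, rfl⟩
      have hθ' : ‖θ‖ = 1 := by simpa using hθ
      have : collapse (Φ (θ, z)) = z := by
        rw [hΦ]
        simp only
        rw [collapse_glue, norm_smul, hθ', Real.norm_eq_abs, abs_of_nonneg (hS0 z hz), mul_one]
        ext i
        refine Fin.cases ?_ (fun i => ?_) i <;> simp
      rw [mem_preimage, this]
      exact hz
  rw [himg]
  exact (hsph.prod hS).image _ hΦc.continuousOn

lemma continuous_fold (m : ℕ) : Continuous (fold : E (m + 1) → E (m + 1)) := by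
  refine (PiLp.continuous_toLp 2 _).comp (continuous_pi fun i => ?_)
  by_cases h : i = 0
  · subst h; simp only [Function.update_self]; fun_prop
  · simp only [Function.update_of_ne h]; fun_prop

lemma isCompact_preimage_collapse {m : ℕ} {S : Set (E (m + 1))} (hS : IsCompact S) :
    IsCompact (collapse ⁻¹' S : Set (E (m + 3))) := by
  refine Metric.isCompact_of_isClosed_isBounded (hS.isClosed.preimage (continuous_collapse m)) ?_
  obtain ⟨R, hR⟩ := hS.isBounded.subset_closedBall (0 : E (m + 1))
  refine Metric.isBounded_closedBall.subset (t := Metric.closedBall 0 R) fun x hx => ?_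
  have := hR hx
  simpa [norm_collapse] using this

/-- The Harnack inequality for `L_{n+2}` yields a constant for the antisymmetric problem. -/
lemma exists_harnackBound_of_satisfiesHarnack {m : ℕ} {j : ℝ → ℝ} (hj : LevyProfile m j)
    {Ω K S : Set (E (m + 1))} (hΩ : IsOpen Ω) (hK : IsCompact K) {M : ℝ} (hM : 0 ≤ M)
    (hH : SatisfiesHarnack (m + 3) (nextKernel j)) (hS : IsPreconnected S) (hKS : fold '' K ⊆ S)
    (hSΩ : S ⊆ {x ∈ Ω | 0 ≤ x 0}) :
    ∃ A : ℝ, 0 < A ∧ ∀ c u : E (m + 1) → ℝ, AntisymSolution j Ω M c u →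
      AntisymHarnackBound A K u := by
  rcases K.eq_empty_or_nonempty with rfl | ⟨x₀, hx₀⟩
  · exact ⟨1, one_pos, fun c u _ => SupLeInf.of_forall one_pos fun x hx => hx.1.elim⟩
  have hΩo : IsOpen (collapse ⁻¹' Ω : Set (E (m + 3))) := hΩ.preimage (continuous_collapse m)
  obtain ⟨y₀, hy₀⟩ := exists_collapse_eq (z := fold x₀) (by simp [fold])
  obtain ⟨Q, hQc, hQ, hKQ, hQΩ⟩ := exists_isCompact_isConnected
    (isCompact_preimage_collapse (hK.image (continuous_fold m)))
    ⟨y₀, by rw [mem_preimage, hy₀]; exact mem_image_of_mem _ hx₀⟩ (preimage_mono hKS)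
    (isPreconnected_preimage_collapse hS fun x hx => (hSΩ hx).2)
    (preimage_mono fun x hx => (hSΩ hx).1) hΩo
  obtain ⟨U, hU, hQU, hUΩ, hUc⟩ := exists_open_between_and_isCompact_closure hQc hΩo hQΩ
  obtain ⟨A, hA⟩ := hH U Q M hU hQc hQ hQU hM
  exact ⟨A, hA.1, fun c u hu => hu.harnackBound_of_subset hj hΩ hM
    (hKS.trans fun x hx => (hSΩ hx).1) hU hUc hUΩ (hA.mono hKQ)⟩

/-! ### The lift across the axis -/

/-- A continuous function on an open set takes values in a closed set if it does so almost
everywhere. -/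
lemma forall_mem_of_ae_mem {d : ℕ} {O : Set (E d)} (hO : IsOpen O) {f : E d → ℝ}
    (hf : ContinuousOn f O) {C : Set ℝ} (hC : IsClosed C) (h : ∀ᵐ x, x ∈ O → f x ∈ C) {x : E d}
    (hx : x ∈ O) : f x ∈ C := by
  by_contra hxC
  have h1 : ∀ᶠ z in 𝓝 x, f z ∈ Cᶜ :=
    (hf.continuousAt (hO.mem_nhds hx)).eventually (hC.isOpen_compl.mem_nhds hxC)
  have h2 : {z | ¬(z ∈ O → f z ∈ C)} ∈ 𝓝 x := by
    filter_upwards [h1, hO.mem_nhds hx] with z hz1 hz2 hz3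
    exact hz1 (hz3 hz2)
  exact (Measure.measure_pos_of_mem_nhds volume h2).ne' (ae_iff.1 h)

/-- The extension of `u / x₁` by `∂₁ u` to the hyperplane `{x₁ = 0}`. -/
def divExtend {m : ℕ} (u : E (m + 1) → ℝ) (z : E (m + 1)) : ℝ :=
  if z 0 = 0 then fderiv ℝ u z (EuclideanSpace.single 0 1) else u z / z 0

namespace AntisymSolution

variable {m : ℕ} {j : ℝ → ℝ} {Ω : Set (E (m + 1))} {M : ℝ} {c u : E (m + 1) → ℝ}
  (hu : AntisymSolution j Ω M c u) (hj : LevyProfile m j)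

include hu hj in
/-- A continuous extension of the lift across the axis is, in the preimage of `Ω`, a bounded
nonnegative weak solution. -/
lemma exists_boundedWeakSolution_extending (hΩ : IsOpen Ω) (hM : 0 ≤ M) {v : E (m + 3) → ℝ}
    (hv : ContinuousOn v (collapse ⁻¹' Ω))
    (hvu : ∀ x ∈ collapse ⁻¹' Ω, collapse x 0 ≠ 0 → v x = u (collapse x) / collapse x 0) :
    ∃ w f B, BoundedWeakSolution (nextKernel j) (collapse ⁻¹' Ω) M B w f ∧
      ∀ x ∈ collapse ⁻¹' Ω, w x = v x := by
  classical
  obtain ⟨B, hB0, hae, hB⟩ := hu.exists_bound_div hΩ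
  have hΩo : IsOpen (collapse ⁻¹' Ω : Set (E (m + 3))) := hΩ.preimage (continuous_collapse m)
  set w : E (m + 3) → ℝ := fun x =>
    if x ∈ collapse ⁻¹' Ω then v x else min B (u (collapse x) / collapse x 0) with hw
  have hwv : ∀ x ∈ collapse ⁻¹' Ω, w x = v x := fun x hx => if_pos hx
  have hmem : ∀ x ∈ collapse ⁻¹' Ω, v x ∈ Icc 0 B := by
    intro x hx
    refine forall_mem_of_ae_mem hΩo hv isClosed_Icc ?_ hx
    filter_upwards [ae_collapse_pos m] with z hz0 hz
    rw [hvu z hz hz0.ne']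
    exact ⟨hu.div_nonneg _, hB _ hz hz0⟩
  have hw1 : ∀ x, w x ∈ Icc 0 B := by
    intro x
    by_cases hx : x ∈ collapse ⁻¹' Ω
    · rw [hwv x hx]; exact hmem x hx
    · simp only [hw, if_neg hx]
      exact ⟨le_min hB0 (hu.div_nonneg _), min_le_left _ _⟩
  have hwu : w =ᵐ[volume] fun x => u (collapse x) / collapse x 0 := by
    filter_upwards [(quasiMeasurePreserving_collapse m).ae hae, ae_collapse_pos m] with x hx hx0
    by_cases hxΩ : x ∈ collapse ⁻¹' Ω
    · rw [hwv x hxΩ, hvu x hxΩ hx0.ne']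
    · simp only [hw, if_neg hxΩ]
      exact min_eq_right hx
  obtain ⟨f, hf⟩ := hu.exists_boundedWeakSolution hj hΩ hM hwu (fun x => (hw1 x).1)
    (fun x => (hw1 x).2)
  exact ⟨w, f, B, hf, hwv⟩

include hu hj in
/-- If the lift is of class `C²`, it is itself an admissible solution in the Harnack inequality. -/
lemma harnackBound_of_liftC2 (hΩ : IsOpen Ω) (hM : 0 ≤ M) {K : Set (E (m + 1))}
    (hfold : fold '' K ⊆ Ω) {A : ℝ} (hC2 : LiftC2 Ω u)
    (hA : HarnackConstant (nextKernel j) (collapse ⁻¹' Ω) (collapse ⁻¹' (fold '' K)) M A) :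
    AntisymHarnackBound A K u := by
  obtain ⟨v, hv, hvu⟩ := hC2
  obtain ⟨w, f, B, hf, hwv⟩ :=
    hu.exists_boundedWeakSolution_extending hj hΩ hM hv.continuousOn hvu
  refine hu.harnackBound_of_lift hA.1 fun x hx y hy hx0 hy0 => ?_
  have := hA.le_mul (hΩ.preimage (continuous_collapse m)) (hv.congr hwv) hf.aesm hf.nonneg
    (.of_forall hf.le) hf.aesm_rhs (fun x _ => hf.abs_rhs_le x) hM hf.eq hx hy
  rwa [hwv x (hfold hx), hwv y (hfold hy), hvu x (hfold hx) hx0.ne',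
    hvu y (hfold hy) hy0.ne'] at this

include hu in
/-- The quotient `u / x₁`, extended by `∂₁ u`, is locally Lipschitz. Near the hyperplane it is the
average of `∂₁ u` over the segment to the orthogonal projection. -/
lemma exists_lipschitz_divExtend (hΩ : IsOpen Ω) {z₀ : E (m + 1)} (hz : z₀ ∈ Ω) (hz0 : 0 ≤ z₀ 0) :
    ∃ (C a : ℝ), 0 ≤ C ∧ 0 < a ∧ ∀ z ∈ Metric.ball z₀ a, ∀ w ∈ Metric.ball z₀ a,
      |divExtend u z - divExtend u w| ≤ C * ‖z - w‖ := by
  rcases hz0.eq_or_lt with hz0 | hz0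
  · have h1 : ContDiffAt ℝ 1 (fderiv ℝ u) z₀ :=
      (hu.contDiffOn.fderiv_of_isOpen hΩ (by norm_num)).contDiffAt (hΩ.mem_nhds hz)
    obtain ⟨C, t, ht, hC⟩ := h1.exists_lipschitzOnWith
    obtain ⟨a, ha, hat⟩ := Metric.mem_nhds_iff.1 (inter_mem ht (hΩ.mem_nhds hz))
    refine ⟨C, a, C.2, ha, fun z hz w hw => ?_⟩
    set e : E (m + 1) := EuclideanSpace.single 0 1 with he
    -- the segment from the projection of `z` to `z`
    set P : E (m + 1) → ℝ → E (m + 1) := fun z s => z + ((s - 1) * z 0) • e with hP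
    have hP0 : ∀ z s, P z s 0 = s * z 0 := by intro z s; simp [hP, he]; ring
    have hPi : ∀ z s, ∀ i, i ≠ 0 → P z s i = z i := by intro z s i hi; simp [hP, he, hi]
    have hball : ∀ z ∈ Metric.ball z₀ a, ∀ s ∈ Icc (0 : ℝ) 1, P z s ∈ Metric.ball z₀ a := by
      intro z hz s hs
      rw [mem_ball_iff_norm] at hz ⊢
      refine lt_of_le_of_lt ?_ hz
      rw [EuclideanSpace.norm_eq, EuclideanSpace.norm_eq]
      refine Real.sqrt_le_sqrt (Finset.sum_le_sum fun i _ => ?_)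
      by_cases hi : i = 0
      · subst hi
        simp only [PiLp.sub_apply, hP0, ← hz0, sub_zero, norm_mul, Real.norm_eq_abs]
        rw [abs_of_nonneg hs.1]
        have : s * |z 0| ≤ |z 0| := mul_le_of_le_one_left (abs_nonneg _) hs.2
        have h0 : 0 ≤ s * |z 0| := mul_nonneg hs.1 (abs_nonneg _)
        gcongr
      · simp only [PiLp.sub_apply, hPi z s i hi]; rfl
    have hdist : ∀ z w : E (m + 1), ∀ s ∈ Icc (0 : ℝ) 1, ‖P z s - P w s‖ ≤ ‖z - w‖ := by
      intro z w s hs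
      rw [EuclideanSpace.norm_eq, EuclideanSpace.norm_eq]
      refine Real.sqrt_le_sqrt (Finset.sum_le_sum fun i _ => ?_)
      by_cases hi : i = 0
      · subst hi
        simp only [PiLp.sub_apply, hP0, ← mul_sub, norm_mul, Real.norm_eq_abs]
        rw [abs_of_nonneg hs.1]
        have : s * |z 0 - w 0| ≤ |z 0 - w 0| := mul_le_of_le_one_left (abs_nonneg _) hs.2
        have h0 : 0 ≤ s * |z 0 - w 0| := mul_nonneg hs.1 (abs_nonneg _)
        gcongr
      · simp only [PiLp.sub_apply, hPi z s i hi, hPi w s i hi]; rfl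
    -- `ψ z` has the derivative `∂₁ u` along the segment also for `z 0 = 0`, where the segment
    -- degenerates, and goes from `0` to `divExtend u z`
    set ψ : E (m + 1) → ℝ → ℝ := fun z s =>
      if z 0 = 0 then s * fderiv ℝ u z e else u (P z s) / z 0 with hψ
    have hψ' : ∀ z ∈ Metric.ball z₀ a, ∀ s ∈ Icc (0 : ℝ) 1,
        HasDerivAt (ψ z) (fderiv ℝ u (P z s) e) s := by
      intro z hz s hs
      by_cases h0 : z 0 = 0
      · have hPz : P z s = z := by simp [hP, h0]
        simp only [hψ, if_pos h0, hPz]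
        simpa using (hasDerivAt_id s).mul_const (fderiv ℝ u z e)
      · have hd : HasFDerivAt u (fderiv ℝ u (P z s)) (P z s) :=
          ((hu.contDiffOn.contDiffAt (hΩ.mem_nhds (hat (hball z hz s hs)).2)).differentiableAt
            (by norm_num)).hasFDerivAt
        have hl : HasDerivAt (P z) (z 0 • e) s := by
          have h3 : HasDerivAt (fun s : ℝ => ((s - 1) * z 0) • e) (z 0 • e) s := by
            simpa using (((hasDerivAt_id s).sub_const 1).mul_const (z 0)).smul_const e
          exact h3.const_add z
        have h2 := (hd.comp_hasDerivAt s hl).div_const (z 0)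
        have h3 : ψ z = fun s => u (P z s) / z 0 := by
          funext s; simp only [hψ, if_neg h0]
        rw [h3]
        refine h2.congr_deriv ?_
        rw [map_smul, smul_eq_mul]
        field_simp
    have hψ0 : ∀ z, ψ z 0 = 0 := by
      intro z
      by_cases h0 : z 0 = 0
      · simp [hψ, h0]
      · -- `u` vanishes on the hyperplane by antisymmetry
        have h1 : reflect (P z 0) = P z 0 := by
          ext i
          by_cases hi : i = 0
          · subst hi; simp [reflect, hP0]
          · simp [reflect, hi]
        have h2 := hu.antisymm (P z 0)
        rw [h1] at h2
        have h3 : u (P z 0) = 0 := by linarith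
        simp [hψ, h0, h3]
    have hψ1 : ∀ z, ψ z 1 = divExtend u z := by
      intro z
      have : P z 1 = z := by simp [hP]
      simp only [hψ, divExtend, this, one_mul, he]
    have hmv := norm_image_sub_le_of_norm_deriv_le_segment_01'
      (f := fun s => ψ z s - ψ w s) (f' := fun s => fderiv ℝ u (P z s) e - fderiv ℝ u (P w s) e)
      (C := C * ‖z - w‖)
      (fun s hs => ((hψ' z hz s hs).sub (hψ' w hw s hs)).hasDerivWithinAt) ?_
    · simpa [hψ0, hψ1] using hmv
    · intro s hs
      have hs' : s ∈ Icc (0 : ℝ) 1 := ⟨hs.1, hs.2.le⟩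
      change ‖(fderiv ℝ u (P z s) - fderiv ℝ u (P w s)) e‖ ≤ _
      refine ((fderiv ℝ u (P z s) - fderiv ℝ u (P w s)).le_opNorm e).trans ?_
      have he1 : ‖e‖ = 1 := by simp [he]
      rw [he1, mul_one, ← dist_eq_norm]
      refine (hC.dist_le_mul _ (hat (hball z hz s hs')).1 _ (hat (hball w hw s hs')).1).trans ?_
      rw [dist_eq_norm]
      gcongr
      exact hdist z w s hs'
  · have h1 : ContDiffAt ℝ 1 (fun z => u z / z 0) z₀ := by
      refine ((hu.contDiffOn.contDiffAt (hΩ.mem_nhds hz)).of_le (by norm_num)).div ?_ hz0.ne'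
      exact ContDiff.contDiffAt (by fun_prop)
    obtain ⟨C, t, ht, hC⟩ := h1.exists_lipschitzOnWith
    have hpos : {z : E (m + 1) | 0 < z 0} ∈ 𝓝 z₀ :=
      (isOpen_lt continuous_const (by fun_prop)).mem_nhds hz0
    obtain ⟨a, ha, hat⟩ := Metric.mem_nhds_iff.1 (inter_mem ht hpos)
    refine ⟨C, a, C.2, ha, fun z hz w hw => ?_⟩
    have h2 : ∀ z ∈ Metric.ball z₀ a, divExtend u z = u z / z 0 := fun z hz =>
      if_neg (ne_of_gt (hat hz).2)
    rw [h2 z hz, h2 w hw, ← dist_eq_norm, ← Real.dist_eq]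
    exact hC.dist_le_mul _ (hat hz).1 _ (hat hw).1

end AntisymSolution

lemma norm_collapse_sub_le {m : ℕ} (x y : E (m + 3)) : ‖collapse x - collapse y‖ ≤ ‖x - y‖ := by
  obtain ⟨w, x', rfl⟩ := exists_glue x
  obtain ⟨p, y', rfl⟩ := exists_glue y
  rw [collapse_glue, collapse_glue, norm_consE_sub, norm_glue_sub]
  refine Real.sqrt_le_sqrt ?_
  gcongr ?_ + _
  rw [← sq_abs]
  gcongr
  exact abs_norm_sub_norm_le w p

/-- The function `v` is locally Lipschitz on `Ω`, in the form of an estimate on balls. -/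
def LocLipschitzOn {d : ℕ} (v : E d → ℝ) (Ω : Set (E d)) : Prop :=
  ∀ x ∈ Ω, ∃ C a : ℝ, 0 ≤ C ∧ 0 < a ∧ ∀ p ∈ Metric.ball x a, ∀ q ∈ Metric.ball x a,
    |v p - v q| ≤ C * ‖p - q‖

lemma LocLipschitzOn.continuousOn {d : ℕ} {v : E d → ℝ} {Ω : Set (E d)}
    (h : LocLipschitzOn v Ω) : ContinuousOn v Ω := by
  intro x hx
  obtain ⟨C, a, hC, ha, hL⟩ := h x hx
  refine ContinuousAt.continuousWithinAt ?_
  rw [ContinuousAt, tendsto_iff_dist_tendsto_zero]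
  have h0 : Tendsto (fun p => C * ‖p - x‖) (𝓝 x) (𝓝 0) := by
    have : Continuous fun p : E d => C * ‖p - x‖ := by fun_prop
    simpa using this.tendsto x
  refine squeeze_zero' (.of_forall fun _ => dist_nonneg) ?_ h0
  filter_upwards [Metric.ball_mem_nhds x ha] with p hp
  exact hL p hp x (Metric.mem_ball_self ha)

lemma AntisymSolution.locLipschitzOn_lift {m : ℕ} {j : ℝ → ℝ} {Ω : Set (E (m + 1))} {M : ℝ}
    {c u : E (m + 1) → ℝ} (hu : AntisymSolution j Ω M c u) (hΩ : IsOpen Ω) :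
    LocLipschitzOn (fun x : E (m + 3) => divExtend u (collapse x)) (collapse ⁻¹' Ω) := by
  intro x hx
  obtain ⟨C, a, hC, ha, hL⟩ := hu.exists_lipschitz_divExtend hΩ hx (collapse_zero_nonneg x)
  have hb : ∀ p ∈ Metric.ball x a, collapse p ∈ Metric.ball (collapse x) a := fun p hp => by
    rw [mem_ball_iff_norm] at hp ⊢
    exact (norm_collapse_sub_le p x).trans_lt hp
  refine ⟨C, a, hC, ha, fun p hp q hq => (hL _ (hb p hp) _ (hb q hq)).trans ?_⟩
  gcongr
  exact norm_collapse_sub_le p q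

/-! ### Commutators with cut-off functions -/

/-- Translation is continuous in `L¹`. -/
lemma tendsto_integral_abs_translate_sub {d : ℕ} {g : E d → ℝ} (hg : Integrable g) :
    Tendsto (fun t => ∫ y, |g (y + t) - g y|) (𝓝 0) (𝓝 0) := by
  have hmp : ∀ t : E d, MeasurePreserving (ContinuousMap.addRight t) volume volume := fun t =>
    measurePreserving_add_right volume t
  have hc : Continuous fun t : E d => (ContinuousMap.addRight t : C(E d, E d)) :=
    (ContinuousMap.curry ⟨fun p : E d × E d => p.2 + p.1, by fun_prop⟩).continuous
  have h1 := (continuous_const (y := hg.toL1 g)).compMeasurePreservingLp hc hmp ENNReal.one_ne_top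
  have h2 := (tendsto_iff_dist_tendsto_zero.1 (h1.tendsto 0))
  refine h2.congr fun t => ?_
  rw [dist_eq_norm, L1.norm_eq_integral_norm]
  refine integral_congr_ae ?_
  have e1 : ∀ t, Lp.compMeasurePreserving _ (hmp t) (hg.toL1 g) =ᵐ[volume] fun y => g (y + t) :=
    fun t => (Lp.coeFn_compMeasurePreserving _ (hmp t)).trans
      ((hmp t).quasiMeasurePreserving.ae_eq_comp hg.coeFn_toL1)
  filter_upwards [Lp.coeFn_sub (Lp.compMeasurePreserving _ (hmp t) (hg.toL1 g))
    (Lp.compMeasurePreserving _ (hmp 0) (hg.toL1 g)), e1 t, e1 0] with y h1 h2 h3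
  rw [h1, Pi.sub_apply, h2, h3, add_zero, Real.norm_eq_abs]

lemma IsTest.mul {d : ℕ} {χ φ : E d → ℝ} (hχ : IsTest χ) (hφ : IsTest φ) :
    IsTest fun x => χ x * φ x :=
  ⟨hχ.contDiff.mul hφ.contDiff, hχ.compact.mul_right⟩

lemma mollify_sub {d : ℕ} (η : ContDiffBump (0 : E d)) {v w : E d → ℝ} {B D : ℝ}
    (hv : AEStronglyMeasurable v) (hB : ∀ x, |v x| ≤ B) (hw : AEStronglyMeasurable w)
    (hD : ∀ x, |w x| ≤ D) (x : E d) :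
    mollify η (fun z => v z - w z) x = mollify η v x - mollify η w x := by
  simp only [mollify, mul_sub]
  exact integral_sub (integrable_mollify η hv hB x) (integrable_mollify η hw hD x)

namespace LevyKernel

variable {d : ℕ} {k : ℝ → ℝ} (hk : LevyKernel d k)

include hk in
/-- The truncated averages of bounded functions are uniformly continuous. -/
lemma exists_abs_avgOp_sub_le {v : E d → ℝ} {B : ℝ} (hv : AEStronglyMeasurable v)
    (hB : ∀ x, |v x| ≤ B) {r : ℝ} (hr : 0 < r) {δ : ℝ} (hδ : 0 < δ) :
    ∃ ε, 0 < ε ∧ ∀ z t, ‖t‖ < ε → |avgOp k r v (z - t) - avgOp k r v z| ≤ δ := by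
  set c : E d → ℝ := fun y => (Ioi r).indicator k ‖y‖ with hc
  have hci : Integrable c := hk.integrable_cut hr
  have h1 := (tendsto_integral_abs_translate_sub hci).const_mul B
  rw [mul_zero] at h1
  obtain ⟨ε, hε, h2⟩ := Metric.eventually_nhds_iff.1 (h1.eventually (Iio_mem_nhds hδ))
  refine ⟨ε, hε, fun z t ht => ?_⟩
  have h3 : avgOp k r v (z - t) = ∫ y, v (z + y) * c (y + t) := by
    rw [avgOp, ← integral_add_right_eq_self _ t]
    refine integral_congr_ae (.of_forall fun y => ?_)
    simp only [hc]
    congr 2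
    abel
  have h4 : Integrable fun y => v (z + y) * c (y + t) :=
    (hci.comp_add_right t).bdd_mul (hv.comp_quasiMeasurePreserving
      (quasiMeasurePreserving_add_left volume z)) (.of_forall fun _ => hB _)
  rw [h3, avgOp, ← integral_sub h4 (hk.integrable_avg hv hB hr z)]
  refine le_trans ?_ (h2 (y := t) (by simpa using ht)).le
  rw [← integral_const_mul, ← Real.norm_eq_abs]
  refine norm_integral_le_of_norm_le (((hci.comp_add_right t).sub hci).abs.const_mul B)
    (.of_forall fun y => ?_)
  rw [← mul_sub, norm_mul, Real.norm_eq_abs, Real.norm_eq_abs]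
  exact mul_le_mul_of_nonneg_right (hB _) (abs_nonneg _)

include hk in
lemma avgOp_mollify {v : E d → ℝ} {B : ℝ} (hv : AEStronglyMeasurable v)
    (hB : ∀ x, |v x| ≤ B) {r : ℝ} (hr : 0 < r) (η : ContDiffBump (0 : E d)) (z : E d) :
    avgOp k r (mollify η v) z = mollify η (avgOp k r v) z := by
  have hη := η.integrable_normed (μ := (volume : Measure (E d)))
  have h1 : Integrable (fun p : E d × E d => v (z + p.1 - p.2) *
      ((Ioi r).indicator k ‖p.1‖ * η.normed volume p.2)) (volume.prod volume) := by
    refine ((hk.integrable_cut hr).mul_prod hη).bdd_mul (c := B)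
      (hv.comp_quasiMeasurePreserving ?_) (.of_forall fun p => hB _)
    have := (quasiMeasurePreserving_add_left (volume : Measure (E d)) z).comp
      (quasiMeasurePreserving_sub (volume : Measure (E d)) volume)
    simpa [Function.comp_def, add_sub_assoc] using this
  calc avgOp k r (mollify η v) z
      = ∫ y, ∫ t, v (z + y - t) * ((Ioi r).indicator k ‖y‖ * η.normed volume t) := by
        refine integral_congr_ae (.of_forall fun y => ?_)
        simp only [mollify]
        rw [← integral_mul_const]
        exact integral_congr_ae (.of_forall fun t => by simp only; ring)
    _ = ∫ t, ∫ y, v (z + y - t) * ((Ioi r).indicator k ‖y‖ * η.normed volume t) :=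
        integral_integral_swap
          (f := fun y t => v (z + y - t) * ((Ioi r).indicator k ‖y‖ * η.normed volume t)) h1
    _ = _ := by
        refine integral_congr_ae (.of_forall fun t => ?_)
        simp only [avgOp]
        rw [← integral_const_mul]
        refine integral_congr_ae (.of_forall fun y => ?_)
        simp only
        rw [add_sub_right_comm]
        ring

end LevyKernel

/-- The commutator of the truncated averages with the multiplication by `χ`, applied to `w`. -/
def commOp {d : ℕ} (k : ℝ → ℝ) (r : ℝ) (χ w : E d → ℝ) (z : E d) : ℝ :=
  χ z * avgOp k r w z - avgOp k r (fun x => χ x * w x) z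

namespace LevyKernel

variable {d : ℕ} {k : ℝ → ℝ} (hk : LevyKernel d k)

include hk in
/-- Between two radii, the gradient term may be added to the commutator, being odd. -/
lemma commOp_sub {χ w : E d → ℝ} {B D : ℝ} (hχ : IsTest χ) (hD : ∀ x, |χ x| ≤ D)
    (hw : AEStronglyMeasurable w) (hB : ∀ x, |w x| ≤ B) {s r : ℝ} (hs : 0 < s) (hsr : s ≤ r)
    (z : E d) :
    commOp k s χ w z - commOp k r χ w z = ∫ y, (norm ⁻¹' Ioc s r).indicator (fun y =>
      (w (z + y) * (χ z - χ (z + y)) + w z * fderiv ℝ χ z y) * k ‖y‖) y := by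
  have hr := hs.trans_le hsr
  have hD0 : 0 ≤ D := (abs_nonneg _).trans (hD 0)
  have hχw : AEStronglyMeasurable fun x => χ x * w x := hχ.continuous.aestronglyMeasurable.mul hw
  have hχB : ∀ x, |χ x * w x| ≤ D * B := fun x => by
    rw [abs_mul]; exact mul_le_mul (hD x) (hB x) (abs_nonneg _) hD0
  have i1 : ∀ r, 0 < r → Integrable fun y =>
      χ z * (w (z + y) * (Ioi r).indicator k ‖y‖) - χ (z + y) * w (z + y) *
        (Ioi r).indicator k ‖y‖ := fun r hr =>
    ((hk.integrable_avg hw hB hr z).const_mul _).sub (hk.integrable_avg hχw hχB hr z)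
  have e1 : ∀ r, 0 < r → commOp k r χ w z = ∫ y, (χ z * (w (z + y) * (Ioi r).indicator k ‖y‖) -
      χ (z + y) * w (z + y) * (Ioi r).indicator k ‖y‖) := fun r hr => by
    rw [integral_sub ((hk.integrable_avg hw hB hr z).const_mul _)
      (hk.integrable_avg hχw hχB hr z), integral_const_mul]
    rfl
  have hms : MeasurableSet (norm ⁻¹' Ioc s r : Set (E d)) := measurable_norm measurableSet_Ioc
  set G : E d → ℝ := (norm ⁻¹' Ioc s r).indicator fun y => w z * fderiv ℝ χ z y * k ‖y‖ with hG
  have hGi : Integrable G := by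
    refine ((hk.integrable_cut hs).const_mul (|w z| * (‖fderiv ℝ χ z‖ * r))).mono' ?_
      (.of_forall fun y => ?_)
    · have h1 : Measurable fun y => w z * fderiv ℝ χ z y :=
        (by fun_prop : Continuous fun y => w z * fderiv ℝ χ z y).measurable
      exact ((h1.mul (hk.measurable.comp measurable_norm)).indicator hms).aestronglyMeasurable
    · by_cases hy : y ∈ norm ⁻¹' Ioc s r
      · have hky := hk.nonneg _ (norm_nonneg y)
        rw [hG, indicator_of_mem hy, indicator_of_mem (show ‖y‖ ∈ Ioi s from hy.1), norm_mul,
          norm_mul, Real.norm_eq_abs, Real.norm_eq_abs (k _), abs_of_nonneg hky]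
        gcongr
        exact (fderiv ℝ χ z).le_of_opNorm_le_of_le le_rfl hy.2
      · rw [hG, indicator_of_notMem hy, norm_zero]
        have := hk.cut_nonneg s (norm_nonneg y)
        positivity
  have hG0 : ∫ y, G y = 0 := by
    have h1 : ∀ y, G (-y) = -G y := by
      intro y
      simp only [hG, indicator, mem_preimage, norm_neg, map_neg]
      split_ifs <;> ring
    have h2 := integral_neg_eq_self G volume
    simp only [h1, integral_neg] at h2
    linarith
  rw [e1 s hs, e1 r hr, ← integral_sub (i1 s hs) (i1 r hr), ← add_zero (∫ y, _), ← hG0,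
    ← integral_add (f := fun y => _ - _) ((i1 s hs).sub (i1 r hr)) hGi]
  refine integral_congr_ae (.of_forall fun y => ?_)
  simp only [hG, indicator, mem_preimage, mem_Ioc, mem_Ioi]
  by_cases h1 : s < ‖y‖
  · by_cases h2 : r < ‖y‖
    · simp [h1, h2, not_le.2 h2]
    · simp only [h1, h2, not_lt.1 h2, and_self, if_true, if_false]
      ring
  · have h2 : ¬r < ‖y‖ := fun h => h1 (hsr.trans_lt h)
    simp [h1, h2]

include hk in
lemma aestronglyMeasurable_commOp {χ w : E d → ℝ} (hχ : IsTest χ) (hw : AEStronglyMeasurable w)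
    (r : ℝ) : AEStronglyMeasurable (commOp k r χ w) :=
  (hχ.continuous.aestronglyMeasurable.mul (hk.aestronglyMeasurable_avgOp hw r)).sub
    (hk.aestronglyMeasurable_avgOp (hχ.continuous.aestronglyMeasurable.mul hw) r)

include hk in
lemma integrable_mul_truncOp {φ w : E d → ℝ} {B : ℝ} (hφ : IsTest φ)
    (hw : AEStronglyMeasurable w) (hB : ∀ x, |w x| ≤ B) {r : ℝ} (hr : 0 < r) :
    Integrable fun x => φ x * truncOp k r w x := by
  have h1 : AEStronglyMeasurable (truncOp k r w) :=
    (hw.mul_const _).sub (hk.aestronglyMeasurable_avgOp hw r)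
  refine hφ.integrable.mul_bdd (c := B * (∫ y : E d, (Ioi r).indicator k ‖y‖) +
    B * ∫ y : E d, (Ioi r).indicator k ‖y‖) h1 (.of_forall fun x => ?_)
  refine (norm_sub_le _ _).trans (add_le_add ?_ (hk.abs_avgOp_le hB hr x))
  have h0 : 0 ≤ ∫ y : E d, (Ioi r).indicator k ‖y‖ :=
    integral_nonneg fun y => hk.cut_nonneg r (norm_nonneg y)
  rw [norm_mul, Real.norm_eq_abs, Real.norm_eq_abs, abs_of_nonneg h0]
  exact mul_le_mul_of_nonneg_right (hB x) h0

include hk in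
/-- The multiplication by `χ` commutes with the operator, applied to `w` in the weak sense, up to a
bounded function. Its bound consists of a bound for the commutator with increments larger than `r`
and a bound for the second order increments of norm at most `r`. -/
lemma exists_commutator {χ w : E d → ℝ} {B D C r : ℝ} (hχ : IsTest χ)
    (hw : AEStronglyMeasurable w) (hB : ∀ x, |w x| ≤ B) (hr : 0 < r) (hC : 0 ≤ C)
    (hH : ∀ z y, ‖y‖ ≤ r →
      |w (z + y) * (χ z - χ (z + y)) + w z * fderiv ℝ χ z y| ≤ C * ‖y‖ ^ 2)
    (hD : ∀ z, |commOp k r χ w z| ≤ D) {ρ : ℝ} (hρ : r < ρ) (hρ1 : ρ ≤ 1) :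
    ∃ g, AEStronglyMeasurable g ∧ (∀ z, |g z| ≤ D + C * smallMoment d k ρ) ∧
      ∀ φ, IsTest φ → (∫ x, χ x * w x * levyOp k φ x) =
        (∫ x, w x * levyOp k (fun x => χ x * φ x) x) + ∫ x, g x * φ x := by
  obtain ⟨b, hb0, hb⟩ := hχ.exists_bound
  have hχw : AEStronglyMeasurable fun x => χ x * w x := hχ.continuous.aestronglyMeasurable.mul hw
  have hχB : ∀ x, |χ x * w x| ≤ b * B := fun x => by
    rw [abs_mul]; exact mul_le_mul (hb x) (hB x) (abs_nonneg _) hb0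
  set H : E d → E d → ℝ := fun z y =>
    (w (z + y) * (χ z - χ (z + y)) + w z * fderiv ℝ χ z y) * k ‖y‖ with hHdef
  set m : E d → ℝ := fun y => C * (Metric.ball 0 ρ).indicator (fun y => ‖y‖ ^ 2 * k ‖y‖) y
    with hm
  have hmi : Integrable m := (integrable_moment hk.integrable hρ1).const_mul C
  have hmint : ∫ y, m y = C * smallMoment d k ρ := by rw [hm, integral_const_mul, smallMoment]
  have hHle : ∀ z s y, ‖(norm ⁻¹' Ioc s r).indicator (H z) y‖ ≤ m y := by
    intro z s y
    have hky := hk.nonneg _ (norm_nonneg y)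
    by_cases hy : y ∈ norm ⁻¹' Ioc s r
    · rw [indicator_of_mem hy, hm]
      simp only
      rw [indicator_of_mem (mem_ball_zero_iff.2 (hy.2.trans_lt hρ)), hHdef]
      simp only
      rw [norm_mul, Real.norm_eq_abs, Real.norm_eq_abs, abs_of_nonneg hky, ← mul_assoc]
      exact mul_le_mul_of_nonneg_right (hH z y hy.2) hky
    · rw [indicator_of_notMem hy, norm_zero]
      exact mul_nonneg hC (indicator_nonneg (fun y _ => by
        have := hk.nonneg _ (norm_nonneg y); positivity) y)
  have hHm : ∀ z s, AEStronglyMeasurable ((norm ⁻¹' Ioc s r).indicator (H z)) := fun z s => by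
    have h1 : AEStronglyMeasurable fun y => w (z + y) :=
      hw.comp_quasiMeasurePreserving (quasiMeasurePreserving_add_left volume z)
    have h2 : Continuous fun y => χ z - χ (z + y) := by have := hχ.continuous; fun_prop
    have h3 : Continuous fun y => w z * fderiv ℝ χ z y := by fun_prop
    exact (((h1.mul h2.aestronglyMeasurable).add h3.aestronglyMeasurable).mul
      (hk.measurable.comp measurable_norm).aestronglyMeasurable).indicator
      (measurable_norm measurableSet_Ioc)
  have hN : ∀ z s, |∫ y, (norm ⁻¹' Ioc s r).indicator (H z) y| ≤ C * smallMoment d k ρ :=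
    fun z s => by
      rw [← hmint]; exact norm_integral_le_of_norm_le hmi (.of_forall (hHle z s))
  have hcomm : ∀ᶠ s : ℝ in 𝓝[>] 0, ∀ z, commOp k s χ w z =
      commOp k r χ w z + ∫ y, (norm ⁻¹' Ioc s r).indicator (H z) y := by
    filter_upwards [Ioc_mem_nhdsGT hr] with s hs z
    rw [← hk.commOp_sub hχ hb hw hB hs.1 hs.2 z, add_sub_cancel]
  set g : E d → ℝ := fun z =>
    commOp k r χ w z + ∫ y, (norm ⁻¹' Ioc 0 r).indicator (H z) y with hg
  have hlim : ∀ z, Tendsto (fun s => commOp k s χ w z) (𝓝[>] 0) (𝓝 (g z)) := by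
    intro z
    refine Tendsto.congr' (hcomm.mono fun s hs => (hs z).symm) (tendsto_const_nhds.add ?_)
    refine tendsto_integral_filter_of_dominated_convergence m (.of_forall (hHm z))
      (.of_forall fun s => .of_forall (hHle z s)) hmi (.of_forall fun y => ?_)
    refine tendsto_const_nhds.congr' ?_
    rcases eq_or_ne y 0 with rfl | hy
    · filter_upwards [self_mem_nhdsWithin] with s hs
      have hs' : (0 : ℝ) < s := hs
      simp [indicator, hs'.le]
    · filter_upwards [mem_nhdsWithin_of_mem_nhds (Iio_mem_nhds (norm_pos_iff.2 hy))] with s hs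
      have hs' : s < ‖y‖ := hs
      simp [indicator, hs', hy]
  have hgm : AEStronglyMeasurable g :=
    aestronglyMeasurable_of_tendsto_ae (𝓝[>] (0 : ℝ))
      (fun s => hk.aestronglyMeasurable_commOp hχ hw s) (.of_forall hlim)
  refine ⟨g, hgm, fun z => (abs_add_le _ _).trans (add_le_add (hD z) (hN z 0)), fun φ hφ => ?_⟩
  have h1 := (hk.tendsto_integral_mul_truncOp' hφ hχw hχB).sub
    (hk.tendsto_integral_mul_truncOp' (hχ.mul hφ) hw hB)
  have h2 : Tendsto (fun s => ∫ x, commOp k s χ w x * φ x) (𝓝[>] 0) (𝓝 (∫ x, g x * φ x)) := by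
    refine tendsto_integral_filter_of_dominated_convergence
      (fun x => (D + C * smallMoment d k ρ) * |φ x|)
      (.of_forall fun s => (hk.aestronglyMeasurable_commOp hχ hw s).mul
        hφ.continuous.aestronglyMeasurable) ?_ (hφ.integrable.abs.const_mul _)
      (.of_forall fun x => (hlim x).mul_const _)
    filter_upwards [hcomm] with s hs
    refine .of_forall fun x => ?_
    rw [norm_mul, Real.norm_eq_abs, Real.norm_eq_abs, hs]
    gcongr
    exact (abs_add_le _ _).trans (add_le_add (hD x) (hN x s))
  have h3 := tendsto_nhds_unique (h1.congr' ?_) h2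
  · linarith
  · filter_upwards [self_mem_nhdsWithin] with s hs
    rw [← integral_sub (hk.integrable_mul_truncOp hφ hχw hχB hs)
      (hk.integrable_mul_truncOp (hχ.mul hφ) hw hB hs)]
    refine integral_congr_ae (.of_forall fun x => ?_)
    simp only [truncOp, commOp]
    ring

end LevyKernel

/-! ### Mollification on the support of a cut-off function -/

/-- A locally Lipschitz function is Lipschitz, at a uniform scale, near a compact set. -/
lemma LocLipschitzOn.exists_uniform {d : ℕ} {v : E d → ℝ} {Ω S : Set (E d)}
    (h : LocLipschitzOn v Ω) (hΩ : IsOpen Ω) (hS : IsCompact S) (hSΩ : S ⊆ Ω) :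
    ∃ C a : ℝ, 0 ≤ C ∧ 0 < a ∧ ∀ x ∈ S, Metric.ball x a ⊆ Ω ∧
      ∀ p ∈ Metric.ball x a, ∀ q ∈ Metric.ball x a, |v p - v q| ≤ C * ‖p - q‖ := by
  refine hS.induction_on (p := fun S => ∃ C a : ℝ, 0 ≤ C ∧ 0 < a ∧ ∀ x ∈ S, Metric.ball x a ⊆ Ω ∧
      ∀ p ∈ Metric.ball x a, ∀ q ∈ Metric.ball x a, |v p - v q| ≤ C * ‖p - q‖) ?_ ?_ ?_ ?_
  · exact ⟨0, 1, le_rfl, one_pos, fun x hx => hx.elim⟩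
  · rintro s t hst ⟨C, a, hC, ha, h⟩
    exact ⟨C, a, hC, ha, fun x hx => h x (hst hx)⟩
  · rintro s t ⟨C, a, hC, ha, h⟩ ⟨C', a', hC', ha', h'⟩
    have e1 : ∀ x : E d, Metric.ball x (min a a') ⊆ Metric.ball x a := fun x =>
      Metric.ball_subset_ball (min_le_left _ _)
    have e2 : ∀ x : E d, Metric.ball x (min a a') ⊆ Metric.ball x a' := fun x =>
      Metric.ball_subset_ball (min_le_right _ _)
    refine ⟨max C C', min a a', le_max_of_le_left hC, lt_min ha ha', ?_⟩
    rintro x (hx | hx)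
    · refine ⟨(e1 x).trans (h x hx).1, fun p hp q hq =>
        ((h x hx).2 p (e1 x hp) q (e1 x hq)).trans ?_⟩
      gcongr; exact le_max_left _ _
    · refine ⟨(e2 x).trans (h' x hx).1, fun p hp q hq =>
        ((h' x hx).2 p (e2 x hp) q (e2 x hq)).trans ?_⟩
      gcongr; exact le_max_right _ _
  · intro x₀ hx₀
    obtain ⟨C, a, hC, ha, hL⟩ := h x₀ (hSΩ hx₀)
    obtain ⟨b, hb, hbΩ⟩ := Metric.isOpen_iff.1 hΩ x₀ (hSΩ hx₀)
    set e := min a b / 2 with he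
    have hmin : 0 < min a b := lt_min ha hb
    have hsub : ∀ x ∈ Metric.ball x₀ e, Metric.ball x e ⊆ Metric.ball x₀ (min a b) := by
      intro x hx p hp
      rw [Metric.mem_ball] at hx hp ⊢
      linarith [dist_triangle p x x₀]
    refine ⟨Metric.ball x₀ e, mem_nhdsWithin_of_mem_nhds (Metric.ball_mem_nhds _ (by positivity)),
      C, e, hC, by positivity, fun x hx => ⟨?_, fun p hp q hq => hL p ?_ q ?_⟩⟩
    · exact (hsub x hx).trans ((Metric.ball_subset_ball (min_le_right _ _)).trans hbΩ)
    · exact Metric.ball_subset_ball (min_le_left _ _) (hsub x hx hp)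
    · exact Metric.ball_subset_ball (min_le_left _ _) (hsub x hx hq)

lemma IsTest.exists_lipschitz {d : ℕ} {χ : E d → ℝ} (hχ : IsTest χ) :
    ∃ L : ℝ, 0 ≤ L ∧ ∀ x y, |χ x - χ y| ≤ L * ‖x - y‖ := by
  obtain ⟨L, hL⟩ := ContDiff.lipschitzWith_of_hasCompactSupport hχ.compact hχ.contDiff (by simp)
  refine ⟨L, L.2, fun x y => ?_⟩
  rw [← Real.dist_eq, ← dist_eq_norm]
  exact hL.dist_le_mul x y

namespace BoundedWeakSolution

variable {d : ℕ} {k : ℝ → ℝ} {Ω : Set (E d)} {M B : ℝ} {v f : E d → ℝ}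
  (h : BoundedWeakSolution k Ω M B v f)

include h in
/-- A locally Lipschitz solution can be replaced by a mollification on the support of a cut-off
function `χ`, with an arbitrarily small error in the solution and in the equation. The error in the
equation is the commutator of the operator with `χ`, applied to the difference `w` of the
mollification and the solution: `w` has Lipschitz constants bounded independently of the
mollification, which controls small increments, and large increments see only averages of `w`. -/
lemma exists_mollify (hk : LevyKernel d k) (hM : 0 ≤ M) (hΩ : IsOpen Ω) (hv : LocLipschitzOn v Ω)
    {χ : E d → ℝ} (hχ : IsTest χ) (hχΩ : tsupport χ ⊆ Ω) (hχ1 : ∀ x, |χ x| ≤ 1) {δ : ℝ}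
    (hδ : 0 < δ) :
    ∃ (η : ContDiffBump (0 : E d)) (g : E d → ℝ), AEStronglyMeasurable g ∧ (∀ x, |g x| ≤ δ) ∧
      (∀ x ∈ tsupport χ, |mollify η v x - v x| ≤ δ) ∧
      ∀ φ, IsTest φ → (∫ x, χ x * (mollify η v x - v x) * levyOp k φ x) +
        (∫ x, χ x * (mollify η f x - f x) * φ x) = ∫ x, g x * φ x := by
  have hB0 : 0 ≤ B := (abs_nonneg _).trans (h.abs_le 0)
  obtain ⟨Λ, a, hΛ, ha, hL⟩ := hv.exists_uniform hΩ hχ.compact.isCompact hχΩ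
  obtain ⟨L, hL0, hLχ⟩ := hχ.exists_lipschitz
  obtain ⟨C2, hC2, hχ2⟩ := hχ.exists_second_difference_bound
  set C := 2 * Λ * L + 2 * B * (2 * C2) with hCdef
  have hC : 0 ≤ C := by positivity
  -- the scale that separates small and large increments
  obtain ⟨ρ, hρ0, hρ1, hρa, hρδ⟩ : ∃ ρ : ℝ, 0 < ρ ∧ ρ ≤ 1 ∧ ρ ≤ a / 4 ∧
      C * smallMoment d k ρ ≤ δ / 2 := by
    have h1 := (tendsto_smallMoment hk.integrable).const_mul C
    rw [mul_zero] at h1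
    have h2 := h1.eventually (Iio_mem_nhds (half_pos hδ))
    have h3 : ∀ᶠ ρ : ℝ in 𝓝[>] 0, ρ ≤ min 1 (a / 4) :=
      mem_nhdsWithin_of_mem_nhds (Iic_mem_nhds (by positivity))
    obtain ⟨ρ, h2, h3, h4⟩ := (h2.and (h3.and self_mem_nhdsWithin)).exists
    exact ⟨ρ, h4, h3.trans (min_le_left _ _), h3.trans (min_le_right _ _), le_of_lt h2⟩
  set r := ρ / 2 with hrdef
  have hr : 0 < r := by positivity
  set κ := ∫ y : E d, (Ioi r).indicator k ‖y‖ with hκ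
  have hκ0 : 0 ≤ κ := integral_nonneg fun y => hk.cut_nonneg r (norm_nonneg y)
  obtain ⟨ε₁, hε₁, hav⟩ := hk.exists_abs_avgOp_sub_le h.aesm h.abs_le hr (δ := δ / 4)
    (by positivity)
  -- the radius `ε` of the mollifier makes `w` at most `τ` on the support of `χ`, whose truncated
  -- averages are then at most `δ / 4`, and changes the truncated averages of `v` by at most `δ / 4`
  set τ := min δ (δ / (4 * (κ + 1))) with hτ
  have hτ0 : 0 < τ := by positivity
  set ε := min (min ε₁ (a / 4)) (τ / (Λ + 1)) with hε
  have hε0 : 0 < ε := by positivity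
  have hεa : ε ≤ a / 4 := (min_le_left _ _).trans (min_le_right _ _)
  have hετ : Λ * ε ≤ τ := by
    have h1 : ε * (Λ + 1) ≤ τ := by
      rw [← le_div_iff₀ (by positivity)]; exact min_le_right _ _
    nlinarith
  set η := bump d hε0 with hη
  have hηε : η.rOut = ε := rfl
  set w : E d → ℝ := fun x => mollify η v x - v x with hw
  have hwm : AEStronglyMeasurable w :=
    (contDiff_mollify η h.aesm h.abs_le).continuous.aestronglyMeasurable.sub h.aesm
  have hwB : ∀ x, |w x| ≤ 2 * B := fun x => by
    refine (abs_sub _ _).trans ?_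
    linarith [mollify_le η h.abs_le x, h.abs_le x]
  have hwτ : ∀ x ∈ tsupport χ, |w x| ≤ τ := fun x hx => by
    refine (abs_mollify_sub_le η h.aesm h.abs_le fun t ht => ?_).trans hετ
    rw [hηε] at ht
    refine ((hL x hx).2 _ ?_ x (Metric.mem_ball_self ha)).trans ?_
    · rw [mem_ball_iff_norm, sub_sub_cancel_left, norm_neg]; linarith
    · rw [sub_sub_cancel_left, norm_neg]
      gcongr
  -- the Lipschitz bound for `w` does not depend on `ε`
  have hwL : ∀ z y, ‖y‖ ≤ r → (z ∈ tsupport χ ∨ z + y ∈ tsupport χ) →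
      |w (z + y) - w z| ≤ 2 * Λ * ‖y‖ := by
    intro z y hy hz
    obtain ⟨x, hx, hzx⟩ : ∃ x ∈ tsupport χ, ‖z - x‖ ≤ r := by
      rcases hz with hz | hz
      · exact ⟨z, hz, by simpa using hr.le⟩
      · exact ⟨z + y, hz, by simpa using hy⟩
    have hm1 : AEStronglyMeasurable fun p => v (p + y) :=
      h.aesm.comp_quasiMeasurePreserving (quasiMeasurePreserving_add_right volume y)
    have hm2 : AEStronglyMeasurable fun p => v (p + y) - v p := hm1.sub h.aesm
    have e1 : w (z + y) - w z = mollify η (fun p => v (p + y) - v p) z - (v (z + y) - v z) := by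
      rw [mollify_sub η hm1 (fun _ => h.abs_le _) h.aesm h.abs_le]
      simp only [hw, mollify, sub_add_eq_add_sub]
      ring
    have hb : ∀ t : E d, ‖t‖ < ε → |v (z - t + y) - v (z - t)| ≤ Λ * ‖y‖ := by
      intro t ht
      have h1 : ‖z - t - x‖ ≤ r + ε := by
        rw [sub_right_comm]; exact (norm_sub_le _ _).trans (add_le_add hzx ht.le)
      have h2 : ‖z - t + y - x‖ ≤ r + ε + r := by
        rw [add_sub_right_comm]; exact (norm_add_le _ _).trans (add_le_add h1 hy)
      refine ((hL x hx).2 _ ?_ _ ?_).trans (le_of_eq ?_)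
      · rw [mem_ball_iff_norm]; linarith
      · rw [mem_ball_iff_norm]; linarith
      · rw [add_sub_cancel_left]
    rw [e1]
    refine abs_mollify_sub_le η hm2 (B := B + B) (fun p => (abs_sub _ _).trans
      (add_le_add (h.abs_le _) (h.abs_le _))) fun t ht => ?_
    have h0 := hb 0 (by simpa using hε0)
    rw [sub_zero] at h0
    refine (abs_sub _ _).trans ?_
    linarith [hb t ht]
  have hH : ∀ z y, ‖y‖ ≤ r →
      |w (z + y) * (χ z - χ (z + y)) + w z * fderiv ℝ χ z y| ≤ C * ‖y‖ ^ 2 := by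
    intro z y hy
    by_cases hz : z ∈ tsupport χ ∨ z + y ∈ tsupport χ
    · have hy1 : y ∈ Metric.ball (0 : E d) 1 := by
        rw [mem_ball_zero_iff]; linarith
      have h1 := hχ2 z y
      rw [indicator_of_mem hy1] at h1
      have h2 : |χ z - χ (z + y) + fderiv ℝ χ z y| ≤ 2 * C2 * ‖y‖ ^ 2 := by
        have hi : ∀ x, (tsupport χ).indicator (1 : E d → ℝ) x ≤ 1 := fun x =>
          indicator_le_self' (fun _ _ => zero_le_one) x
        have hi0 : ∀ x, 0 ≤ (tsupport χ).indicator (1 : E d → ℝ) x := fun x =>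
          indicator_nonneg (fun _ _ => zero_le_one) x
        refine h1.trans ?_
        calc _ ≤ C2 * ‖y‖ ^ 2 * (1 + 1) := by
              exact mul_le_mul (mul_le_mul_of_nonneg_left (min_le_right _ _) hC2)
                (add_le_add (hi _) (hi _)) (add_nonneg (hi0 _) (hi0 _)) (by positivity)
          _ = _ := by ring
      have h3 : |χ z - χ (z + y)| ≤ L * ‖y‖ := by simpa using hLχ z (z + y)
      calc _ = |(w (z + y) - w z) * (χ z - χ (z + y)) +
            w z * (χ z - χ (z + y) + fderiv ℝ χ z y)| := by congr 1; ring
        _ ≤ 2 * Λ * ‖y‖ * (L * ‖y‖) + 2 * B * (2 * C2 * ‖y‖ ^ 2) := by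
            refine (abs_add_le _ _).trans ?_
            rw [abs_mul, abs_mul]
            gcongr
            · exact hwL z y hy hz
            · exact hwB z
        _ = _ := by rw [hCdef]; ring
    · push Not at hz
      have h3 : fderiv ℝ χ z = 0 :=
        image_eq_zero_of_notMem_tsupport fun h => hz.1 (tsupport_fderiv_subset ℝ h)
      rw [image_eq_zero_of_notMem_tsupport hz.1, image_eq_zero_of_notMem_tsupport hz.2, h3]
      simpa using by positivity
  have hD : ∀ z, |commOp k r χ w z| ≤ δ / 2 := by
    intro z
    have h1 : |avgOp k r w z| ≤ δ / 4 := by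
      have e1 : avgOp k r w z = mollify η (avgOp k r v) z - avgOp k r v z := by
        rw [← hk.avgOp_mollify h.aesm h.abs_le hr]
        simp only [avgOp, hw, sub_mul]
        exact integral_sub (hk.integrable_avg
          (contDiff_mollify η h.aesm h.abs_le).continuous.aestronglyMeasurable
          (mollify_le η h.abs_le) hr z) (hk.integrable_avg h.aesm h.abs_le hr z)
      rw [e1]
      exact abs_mollify_sub_le η (hk.aestronglyMeasurable_avgOp h.aesm r)
        (hk.abs_avgOp_le h.abs_le hr) fun t ht =>
          hav z t (ht.trans_le ((min_le_left _ _).trans (min_le_left _ _)))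
    have h2 : |avgOp k r (fun x => χ x * w x) z| ≤ δ / 4 := by
      refine (hk.abs_avgOp_le (B := τ) (fun x => ?_) hr z).trans ?_
      · by_cases hx : x ∈ tsupport χ
        · rw [abs_mul]
          exact (mul_le_of_le_one_left (abs_nonneg _) (hχ1 x)).trans (hwτ x hx)
        · rw [image_eq_zero_of_notMem_tsupport hx, zero_mul, abs_zero]; exact hτ0.le
      · calc τ * κ ≤ δ / (4 * (κ + 1)) * (κ + 1) := by
              gcongr
              · exact min_le_right _ _
              · linarith
          _ = δ / 4 := by field_simp
    refine (abs_sub _ _).trans ?_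
    have h3 : |χ z * avgOp k r w z| ≤ δ / 4 := by
      rw [abs_mul]
      exact (mul_le_of_le_one_left (abs_nonneg _) (hχ1 z)).trans h1
    linarith
  obtain ⟨g, hg, hgle, heq⟩ := hk.exists_commutator hχ hwm hwB hr hC hH hD (ρ := ρ)
    (by linarith) hρ1
  refine ⟨η, g, hg, fun x => (hgle x).trans (by linarith), fun x hx =>
    (hwτ x hx).trans (min_le_left _ _), fun φ hφ => ?_⟩
  have hχφ := hχ.mul hφ
  have hsub : tsupport (fun x => χ x * φ x) ⊆ tsupport χ := tsupport_mul_subset_left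
  have e1 := h.eq _ hχφ (hsub.trans hχΩ)
  have e2 := h.mollify_eq hk hM η hχφ fun x hx t ht => (hL x (hsub hx)).1 (by
    rw [hηε] at ht
    rw [mem_ball_iff_norm, sub_sub_cancel_left, norm_neg]; linarith)
  have hLi := hk.integrable_levyOp hχφ
  have e3 : ∫ x, w x * levyOp k (fun x => χ x * φ x) x =
      (∫ x, mollify η v x * levyOp k (fun x => χ x * φ x) x) -
        ∫ x, v x * levyOp k (fun x => χ x * φ x) x := by
    simp only [hw, sub_mul]
    exact integral_sub
      (hLi.bdd_mul (contDiff_mollify η h.aesm h.abs_le).continuous.aestronglyMeasurable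
        (.of_forall (mollify_le η h.abs_le))) (hLi.bdd_mul h.aesm (.of_forall h.abs_le))
  have e4 : ∫ x, χ x * (mollify η f x - f x) * φ x =
      (∫ x, mollify η f x * (χ x * φ x)) - ∫ x, f x * (χ x * φ x) := by
    rw [← integral_sub
      (hχφ.integrable.bdd_mul (contDiff_mollify η h.aesm_rhs
        (h.abs_rhs_le' hM)).continuous.aestronglyMeasurable
        (.of_forall (mollify_le η (h.abs_rhs_le' hM))))
      (hχφ.integrable.bdd_mul h.aesm_rhs (.of_forall (h.abs_rhs_le' hM)))]
    exact integral_congr_ae (.of_forall fun x => by simp only; ring)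
  have e5 := heq φ hφ
  simp only [hw] at e5 e3
  rw [e5, e4]
  linarith

end BoundedWeakSolution

/-! ### Approximation in the whole domain -/

/-- An exhaustion of an open set by compact sets. -/
lemma exists_compact_exhaustion {d : ℕ} {Ω : Set (E d)} (hΩ : IsOpen Ω) :
    ∃ S : ℕ → Set (E d), (∀ n, IsCompact (S n)) ∧ (∀ n, S n ⊆ interior (S (n + 1))) ∧
      ⋃ n, S n = Ω := by
  have := hΩ.locallyCompactSpace
  set K : CompactExhaustion Ω := CompactExhaustion.choice Ω
  refine ⟨fun n => Subtype.val '' K n, fun n => (K.isCompact n).image continuous_subtype_val,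
    fun n => ?_, ?_⟩
  · refine (image_mono (K.subset_interior_succ n)).trans (interior_maximal ?_ ?_)
    · exact image_mono interior_subset
    · exact hΩ.isOpenMap_subtype_val _ isOpen_interior
  · rw [← image_iUnion, K.iUnion_eq, image_univ, Subtype.range_coe]

/-- A smooth locally finite partition of unity of an open set into functions with compact support
in it. -/
lemma exists_partition_of_unity {d : ℕ} {Ω : Set (E d)} (hΩ : IsOpen Ω) :
    ∃ χ : ℕ → E d → ℝ, (∀ i, IsTest (χ i)) ∧ (∀ i, tsupport (χ i) ⊆ Ω) ∧ (∀ i x, 0 ≤ χ i x) ∧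
      (∀ n x, ∑ i ∈ Finset.range n, χ i x ≤ 1) ∧
      ∀ x ∈ Ω, ∃ N, ∀ᶠ z in 𝓝 x, (∀ i ≥ N, χ i z = 0) ∧ ∑ i ∈ Finset.range N, χ i z = 1 := by
  obtain ⟨S, hSc, hSS, hS⟩ := exists_compact_exhaustion hΩ
  have hSΩ : ∀ n, S n ⊆ Ω := fun n => hS ▸ subset_iUnion S n
  have hmono : Monotone S := monotone_nat_of_le_succ fun n => (hSS n).trans interior_subset
  have h1 : ∀ n, ∃ ψ : E d → ℝ, ContDiff ℝ ∞ ψ ∧ (∀ x ∈ S n, ψ x = 1) ∧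
      (∀ x ∉ S (n + 1), ψ x = 0) ∧ ∀ x, ψ x ∈ Icc 0 1 := by
    intro n
    obtain ⟨ψ, h1, h2, h3⟩ := exists_contMDiffMap_one_nhds_of_subset_interior (n := (⊤ : ℕ∞))
      (modelWithCornersSelf ℝ (E d)) (hSc n).isClosed (hSS n)
    exact ⟨ψ, ψ.contMDiff.contDiff, fun x hx => subset_of_mem_nhdsSet h1 hx, h2, h3⟩
  choose ψ hψ hψ1 hψ0 hψI using h1
  -- the partition of unity consists of the differences of consecutive cut-off functions
  set Ψ : ℕ → E d → ℝ := fun n => Nat.casesOn n 0 ψ with hΨ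
  have hΨs : ∀ n, Ψ (n + 1) = ψ n := fun n => rfl
  have hΨ0 : Ψ 0 = 0 := rfl
  have hΨC : ∀ n, ContDiff ℝ ∞ (Ψ n) := fun n => by
    cases n with
    | zero => exact contDiff_const
    | succ n => exact hψ n
  have hΨz : ∀ n, ∀ x ∉ S n, Ψ n x = 0 := fun n x hx => by
    cases n with
    | zero => rfl
    | succ n => exact hψ0 n x hx
  have hΨI : ∀ n x, Ψ n x ∈ Icc (0 : ℝ) 1 := fun n x => by
    cases n with
    | zero => simp [hΨ0]
    | succ n => exact hψI n x
  have hsum : ∀ n x, ∑ i ∈ Finset.range n, (Ψ (i + 1) x - Ψ i x) = Ψ n x := fun n x => by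
    rw [Finset.sum_range_sub (fun i => Ψ i x), hΨ0, Pi.zero_apply, sub_zero]
  have hsupp : ∀ i, tsupport (fun x => Ψ (i + 1) x - Ψ i x) ⊆ S (i + 1) := fun i => by
    refine closure_minimal (fun x hx => ?_) (hSc _).isClosed
    by_contra hx'
    exact hx (by simp only [hΨz _ x hx', hΨz i x fun h => hx' (hmono i.le_succ h), sub_zero])
  refine ⟨fun i x => Ψ (i + 1) x - Ψ i x, fun i => ⟨(hΨC (i + 1)).sub (hΨC i), ?_⟩,
    fun i => (hsupp i).trans (hSΩ _), fun i x => ?_, fun n x => ?_, fun x hx => ?_⟩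
  · exact (hSc (i + 1)).of_isClosed_subset (isClosed_tsupport _) (hsupp i)
  · simp only
    by_cases hx : x ∈ S i
    · rw [hΨs, hψ1 i x hx]; linarith [(hΨI i x).2]
    · rw [hΨz i x hx]; linarith [(hΨI (i + 1) x).1]
  · rw [hsum]; exact (hΨI n x).2
  · rw [← hS] at hx
    obtain ⟨n, hn⟩ := mem_iUnion.1 hx
    have h2 : ∀ z ∈ S (n + 1), ∀ i ≥ n + 2, Ψ i z = 1 := by
      intro z hz i hi
      obtain ⟨l, rfl⟩ : ∃ l, i = l + 1 := ⟨i - 1, by omega⟩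
      exact hψ1 l z (hmono (by omega) hz)
    refine ⟨n + 2, ?_⟩
    filter_upwards [mem_interior_iff_mem_nhds.1 (hSS n hn)] with z hz
    refine ⟨fun i hi => ?_, ?_⟩
    · simp only [h2 z hz i hi, h2 z hz (i + 1) (by omega), sub_self]
    · rw [hsum]; exact h2 z hz _ le_rfl

namespace BoundedWeakSolution

variable {d : ℕ} {k : ℝ → ℝ} {Ω : Set (E d)} {M B : ℝ} {v f : E d → ℝ}
  (h : BoundedWeakSolution k Ω M B v f)

include h in
/-- A locally Lipschitz solution is, if `M > 0`, the uniform limit of functions of class `C²` in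
the whole open set that satisfy equations with the same bound on the potential. They are obtained
by mollifying with a partition of unity, at scales shrinking towards the boundary. The small
constant that is added to the solution absorbs, since `M > 0`, the error in the equation. -/
lemma exists_contDiffOn_approx (hk : LevyKernel d k) (hM : 0 < M) (hΩ : IsOpen Ω)
    (hv : LocLipschitzOn v Ω) {δ : ℝ} (hδ : 0 < δ) :
    ∃ (w F : E d → ℝ) (D : ℝ), ContDiffOn ℝ 2 w Ω ∧ AEStronglyMeasurable w ∧ (∀ x, 0 ≤ w x) ∧
      (∀ x, w x ≤ D) ∧ AEStronglyMeasurable F ∧ (∀ x ∈ Ω, |F x| ≤ M * w x) ∧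
      (∀ φ, IsTest φ → tsupport φ ⊆ Ω →
        (∫ x, w x * levyOp k φ x) + ∫ x, F x * φ x = 0) ∧ ∀ x, |w x - v x| ≤ 2 * δ := by
  obtain ⟨χ, hχ, hχΩ, hχ0, hχ1, hloc⟩ := exists_partition_of_unity hΩ
  have hχle : ∀ i x, |χ i x| ≤ 1 := fun i x => by
    rw [abs_of_nonneg (hχ0 i x)]
    exact (Finset.single_le_sum (f := fun i => χ i x) (fun i _ => hχ0 i x)
      (Finset.self_mem_range_succ i)).trans (hχ1 (i + 1) x)
  set τ := min δ (M * δ) with hτ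
  have hτ0 : 0 < τ := by positivity
  set ε : ℕ → ℝ := fun i => τ / 2 / 2 ^ i with hε
  have hε0 : ∀ i, 0 < ε i := fun i => by positivity
  have hεsum : HasSum ε τ := hasSum_geometric_two' τ
  choose η g hgm hg hηv heq using fun i =>
    h.exists_mollify hk hM.le hΩ hv (hχ i) (hχΩ i) (hχle i) (hε0 i)
  set vη : ℕ → E d → ℝ := fun i => mollify (η i) v with hvη
  set fη : ℕ → E d → ℝ := fun i => mollify (η i) f with hfη
  have hvm : ∀ i, AEStronglyMeasurable (vη i) := fun i =>
    (contDiff_mollify (η i) h.aesm h.abs_le).continuous.aestronglyMeasurable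
  have hfm : ∀ i, AEStronglyMeasurable (fη i) := fun i =>
    (contDiff_mollify (η i) h.aesm_rhs (h.abs_rhs_le' hM.le)).continuous.aestronglyMeasurable
  set p : ℕ → E d → ℝ := fun i x => χ i x * (vη i x - v x) with hp
  set q : ℕ → E d → ℝ := fun i x => χ i x * (fη i x - f x) with hq
  have hpm : ∀ i, AEStronglyMeasurable (p i) := fun i =>
    (hχ i).continuous.aestronglyMeasurable.mul ((hvm i).sub h.aesm)
  have hqm : ∀ i, AEStronglyMeasurable (q i) := fun i =>
    (hχ i).continuous.aestronglyMeasurable.mul ((hfm i).sub h.aesm_rhs)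
  have hpε : ∀ i x, |p i x| ≤ ε i := by
    intro i x
    by_cases hx : x ∈ tsupport (χ i)
    · rw [hp]
      simp only
      rw [abs_mul]
      exact (mul_le_of_le_one_left (abs_nonneg _) (hχle i x)).trans (hηv i x hx)
    · simp only [hp, image_eq_zero_of_notMem_tsupport hx, zero_mul, abs_zero]
      exact (hε0 i).le
  have hqle : ∀ i x, |q i x| ≤ χ i x * (2 * (M * B)) := by
    intro i x
    rw [hq]
    simp only
    rw [abs_mul, abs_of_nonneg (hχ0 i x)]
    refine mul_le_mul_of_nonneg_left ((abs_sub _ _).trans ?_) (hχ0 i x)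
    linarith [mollify_le (η i) (h.abs_rhs_le' hM.le) x, h.abs_rhs_le' hM.le x]
  have hMB : 0 ≤ M * B := (abs_nonneg _).trans (h.abs_rhs_le' hM.le 0)
  have hps : ∀ x, Summable fun i => p i x := fun x =>
    Summable.of_norm_bounded hεsum.summable fun i => hpε i x
  have hgs : ∀ x, Summable fun i => g i x := fun x =>
    Summable.of_norm_bounded hεsum.summable fun i => hg i x
  have hqs : ∀ x, Summable fun i => q i x := by
    intro x
    by_cases hx : x ∈ Ω
    · obtain ⟨N, hN⟩ := hloc x hx
      refine summable_of_ne_finset_zero (s := Finset.range N) fun i hi => ?_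
      simp only [hq, hN.self_of_nhds.1 i (by simpa using hi), zero_mul]
    · refine summable_zero.congr fun i => ?_
      simp only [hq, image_eq_zero_of_notMem_tsupport fun h => hx (hχΩ i h), zero_mul]
  have hparte : ∀ (a : ℕ → ℝ) (n : ℕ), (∀ i, |a i| ≤ ε i) → |∑ i ∈ Finset.range n, a i| ≤ τ :=
    fun a n ha => (Finset.abs_sum_le_sum_abs _ _).trans ((Finset.sum_le_sum fun i _ => ha i).trans
      (sum_le_hasSum _ (fun i _ => (hε0 i).le) hεsum))
  have hsumε : ∀ (a : ℕ → ℝ), (∀ i, |a i| ≤ ε i) → |∑' i, a i| ≤ τ := fun a ha =>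
    tsum_of_norm_bounded (f := a) hεsum ha
  have hqsum : ∀ n x, |∑ i ∈ Finset.range n, q i x| ≤ 2 * (M * B) := fun n x => by
    refine (Finset.abs_sum_le_sum_abs _ _).trans ((Finset.sum_le_sum fun i _ => hqle i x).trans ?_)
    rw [← Finset.sum_mul]
    exact mul_le_of_le_one_left (by positivity) (hχ1 n x)
  -- the approximations and their partial sums
  set w : E d → ℝ := fun x => δ + v x + ∑' i, p i x with hw
  set F : E d → ℝ := fun x => f x + ∑' i, q i x - ∑' i, g i x with hF
  set P : ℕ → E d → ℝ := fun n x => δ + v x + ∑ i ∈ Finset.range n, p i x with hP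
  set Q : ℕ → E d → ℝ := fun n x =>
    f x + ∑ i ∈ Finset.range n, q i x - ∑ i ∈ Finset.range n, g i x with hQ
  have hPlim : ∀ x, Tendsto (fun n => P n x) atTop (𝓝 (w x)) := fun x =>
    tendsto_const_nhds.add (hps x).hasSum.tendsto_sum_nat
  have hQlim : ∀ x, Tendsto (fun n => Q n x) atTop (𝓝 (F x)) := fun x =>
    (tendsto_const_nhds.add (hqs x).hasSum.tendsto_sum_nat).sub (hgs x).hasSum.tendsto_sum_nat
  have hPm : ∀ n, AEStronglyMeasurable (P n) := fun n =>
    (aestronglyMeasurable_const.add h.aesm).add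
      (Finset.aestronglyMeasurable_fun_sum _ fun i _ => hpm i)
  have hQm : ∀ n, AEStronglyMeasurable (Q n) := fun n =>
    (h.aesm_rhs.add (Finset.aestronglyMeasurable_fun_sum _ fun i _ => hqm i)).sub
      (Finset.aestronglyMeasurable_fun_sum _ fun i _ => hgm i)
  have hPB : ∀ n x, |P n x| ≤ δ + B + τ := fun n x => by
    refine (abs_add_le _ _).trans (add_le_add ((abs_add_le _ _).trans ?_)
      (hparte _ n fun i => hpε i x))
    rw [abs_of_pos hδ]
    exact add_le_add le_rfl (h.abs_le x)
  have hQB : ∀ n x, |Q n x| ≤ M * B + 2 * (M * B) + τ := fun n x =>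
    (abs_sub _ _).trans (add_le_add ((abs_add_le _ _).trans
      (add_le_add (h.abs_rhs_le' hM.le x) (hqsum n x))) (hparte _ n fun i => hg i x))
  have hPQ : ∀ φ, IsTest φ → tsupport φ ⊆ Ω → ∀ n,
      (∫ x, P n x * levyOp k φ x) + ∫ x, Q n x * φ x = 0 := by
    intro φ hφ hφΩ n
    have hL := hk.integrable_levyOp hφ
    induction n with
    | zero =>
      have h1 : ∫ x, P 0 x * levyOp k φ x =
          δ * (∫ x, levyOp k φ x) + ∫ x, v x * levyOp k φ x := by
        rw [← integral_const_mul, ← integral_add (hL.const_mul δ)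
          (hL.bdd_mul h.aesm (.of_forall h.abs_le))]
        refine integral_congr_ae (.of_forall fun x => ?_)
        simp only [hP, Finset.range_zero, Finset.sum_empty]
        ring
      have h2 : ∫ x, Q 0 x * φ x = ∫ x, f x * φ x :=
        integral_congr_ae (.of_forall fun x => by simp [hQ])
      rw [h1, h2, hk.integral_levyOp hφ, mul_zero, zero_add]
      exact h.eq φ hφ hφΩ
    | succ n ih =>
      have i1 : Integrable fun x => p n x * levyOp k φ x :=
        hL.bdd_mul (hpm n) (.of_forall (hpε n))
      have i2 : Integrable fun x => q n x * φ x :=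
        hφ.integrable.bdd_mul (hqm n) (c := 2 * (M * B)) (.of_forall fun x =>
          (hqle n x).trans (mul_le_of_le_one_left (by positivity)
            ((le_abs_self _).trans (hχle n x))))
      have i3 : Integrable fun x => g n x * φ x :=
        hφ.integrable.bdd_mul (hgm n) (.of_forall (hg n))
      have i4 : Integrable fun x => P n x * levyOp k φ x :=
        hL.bdd_mul (hPm n) (.of_forall (hPB n))
      have i5 : Integrable fun x => Q n x * φ x :=
        hφ.integrable.bdd_mul (hQm n) (.of_forall (hQB n))
      have h1 : ∫ x, P (n + 1) x * levyOp k φ x =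
          (∫ x, P n x * levyOp k φ x) + ∫ x, p n x * levyOp k φ x := by
        rw [← integral_add i4 i1]
        refine integral_congr_ae (.of_forall fun x => ?_)
        simp only [hP, Finset.sum_range_succ]
        ring
      have h2 : ∫ x, Q (n + 1) x * φ x =
          (∫ x, Q n x * φ x) + ((∫ x, q n x * φ x) - ∫ x, g n x * φ x) := by
        rw [← integral_sub i2 i3, ← integral_add (g := fun x => _ - _) i5 (i2.sub i3)]
        refine integral_congr_ae (.of_forall fun x => ?_)
        simp only [hQ, Finset.sum_range_succ]
        ring
      have h3 : (∫ x, p n x * levyOp k φ x) + (∫ x, q n x * φ x) = ∫ x, g n x * φ x := heq n φ hφ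
      rw [h1, h2]
      linarith
  -- in `Ω` the solution cancels from the sum
  have hwΩ : ∀ x ∈ Ω, ∃ N, ∀ᶠ z in 𝓝 x, ∑ i ∈ Finset.range N, χ i z = 1 ∧
      w z = δ + ∑ i ∈ Finset.range N, χ i z * vη i z ∧
      F z = (∑ i ∈ Finset.range N, χ i z * fη i z) - ∑' i, g i z := by
    intro x hx
    obtain ⟨N, hN⟩ := hloc x hx
    refine ⟨N, hN.mono fun z hz => ⟨hz.2, ?_, ?_⟩⟩
    · have h1 : ∑' i, p i z = ∑ i ∈ Finset.range N, p i z := tsum_eq_sum fun i hi => by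
        simp only [hp, hz.1 i (by simpa using hi), zero_mul]
      simp only [hw, h1]
      simp only [hp, mul_sub, Finset.sum_sub_distrib]
      rw [← Finset.sum_mul, hz.2]
      ring
    · have h1 : ∑' i, q i z = ∑ i ∈ Finset.range N, q i z := tsum_eq_sum fun i hi => by
        simp only [hq, hz.1 i (by simpa using hi), zero_mul]
      simp only [hF, h1]
      simp only [hq, mul_sub, Finset.sum_sub_distrib]
      rw [← Finset.sum_mul, hz.2]
      ring
  have hwm : AEStronglyMeasurable w :=
    aestronglyMeasurable_of_tendsto_ae atTop hPm (.of_forall hPlim)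
  have hFm : AEStronglyMeasurable F :=
    aestronglyMeasurable_of_tendsto_ae atTop hQm (.of_forall hQlim)
  have hpτ : ∀ x, |∑' i, p i x| ≤ τ := fun x => hsumε _ fun i => hpε i x
  refine ⟨w, F, δ + B + τ, fun x hx => ?_, hwm, fun x => ?_, fun x => ?_, hFm, fun x hx => ?_,
    fun φ hφ hφΩ => ?_, fun x => ?_⟩
  · obtain ⟨N, hN⟩ := hwΩ x hx
    refine ContDiffAt.contDiffWithinAt (ContDiffAt.congr_of_eventuallyEq
      (f := fun z => δ + ∑ i ∈ Finset.range N, χ i z * vη i z) (ContDiff.contDiffAt ?_)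
      (hN.mono fun z hz => hz.2.1))
    exact contDiff_const.add (ContDiff.sum fun i _ => contDiff_infty.1
      ((hχ i).contDiff.mul (contDiff_mollify (η i) h.aesm h.abs_le)) 2)
  · have h1 := _root_.abs_le.1 (hpτ x)
    have h2 : τ ≤ δ := min_le_left _ _
    simp only [hw]
    linarith [h.nonneg x]
  · have h1 := _root_.abs_le.1 (hpτ x)
    simp only [hw]
    linarith [h.le x]
  · obtain ⟨N, hN⟩ := hwΩ x hx
    obtain ⟨-, h1, h2⟩ := hN.self_of_nhds
    have h3 : |∑ i ∈ Finset.range N, χ i x * fη i x| ≤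
        M * ∑ i ∈ Finset.range N, χ i x * vη i x := by
      refine (Finset.abs_sum_le_sum_abs _ _).trans ?_
      rw [Finset.mul_sum]
      refine Finset.sum_le_sum fun i _ => ?_
      rw [abs_mul, abs_of_nonneg (hχ0 i x)]
      calc _ ≤ χ i x * (M * vη i x) := mul_le_mul_of_nonneg_left
            (abs_mollify_le (η i) h.aesm h.abs_le h.abs_rhs_le x) (hχ0 i x)
        _ = _ := by ring
    have h4 : |∑' i, g i x| ≤ τ := hsumε _ fun i => hg i x
    have h5 : τ ≤ M * δ := min_le_right _ _
    rw [h1, h2, mul_add]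
    exact (abs_sub _ _).trans (by linarith)
  · have h1 : Tendsto (fun n => ∫ x, P n x * levyOp k φ x) atTop
        (𝓝 (∫ x, w x * levyOp k φ x)) := by
      have hL := hk.integrable_levyOp hφ
      refine tendsto_integral_of_dominated_convergence (fun x => (δ + B + τ) * |levyOp k φ x|)
        (fun n => (hPm n).mul hL.1) (hL.abs.const_mul _) (fun n => .of_forall fun x => ?_)
        (.of_forall fun x => (hPlim x).mul_const _)
      rw [norm_mul, Real.norm_eq_abs, Real.norm_eq_abs]
      exact mul_le_mul_of_nonneg_right (hPB n x) (abs_nonneg _)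
    have h2 : Tendsto (fun n => ∫ x, Q n x * φ x) atTop (𝓝 (∫ x, F x * φ x)) := by
      refine tendsto_integral_of_dominated_convergence
        (fun x => (M * B + 2 * (M * B) + τ) * |φ x|)
        (fun n => (hQm n).mul hφ.integrable.1) (hφ.integrable.abs.const_mul _)
        (fun n => .of_forall fun x => ?_) (.of_forall fun x => (hQlim x).mul_const _)
      rw [norm_mul, Real.norm_eq_abs, Real.norm_eq_abs]
      exact mul_le_mul_of_nonneg_right (hQB n x) (abs_nonneg _)
    have h3 := h1.add h2
    simp only [hPQ φ hφ hφΩ] at h3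
    exact tendsto_nhds_unique h3 tendsto_const_nhds
  · have h1 : w x - v x = δ + ∑' i, p i x := by simp only [hw]; ring
    rw [h1]
    refine (abs_add_le _ _).trans ?_
    rw [abs_of_pos hδ]
    linarith [hpτ x, (min_le_left _ _ : τ ≤ δ)]

include h in
/-- A Harnack constant for `Ω` itself applies to locally Lipschitz weak solutions in `Ω`, if the
bound for the potential is positive. -/
lemma le_mul_of_pos (hk : LevyKernel d k) (hM : 0 < M) (hΩ : IsOpen Ω) (hv : LocLipschitzOn v Ω)
    {K : Set (E d)} {A : ℝ} (hA : HarnackConstant k Ω K M A) {x y : E d} (hx : x ∈ K)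
    (hy : y ∈ K) : v x ≤ A * v y := by
  have hA0 := hA.1
  refine le_of_forall_pos_le_add fun e he => ?_
  set δ := e / (2 * (1 + A)) with hδ
  have hδ0 : 0 < δ := by positivity
  obtain ⟨w, F, D, h1, h2, h3, h4, h5, h6, h7, h8⟩ := h.exists_contDiffOn_approx hk hM hΩ hv hδ0
  have h9 := hA.le_mul hΩ h1 h2 h3 (.of_forall h4) h5 h6 hM.le h7 hx hy
  have h10 := _root_.abs_le.1 (h8 x)
  have h11 : A * w y ≤ A * (v y + 2 * δ) := by
    gcongr
    linarith [(_root_.abs_le.1 (h8 y)).2]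
  have h12 : 2 * δ * (1 + A) = e := by rw [hδ]; field_simp
  linarith

end BoundedWeakSolution

lemma LocLipschitzOn.congr {d : ℕ} {v w : E d → ℝ} {Ω : Set (E d)} (h : LocLipschitzOn v Ω)
    (hΩ : IsOpen Ω) (hvw : ∀ x ∈ Ω, w x = v x) : LocLipschitzOn w Ω := by
  intro x hx
  obtain ⟨C, a, hC, ha, hL⟩ := h x hx
  obtain ⟨b, hb, hbΩ⟩ := Metric.isOpen_iff.1 hΩ x hx
  refine ⟨C, min a b, hC, lt_min ha hb, fun p hp q hq => ?_⟩
  have hsub := Metric.ball_subset_ball (x := x) (min_le_right a b)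
  have hsub' := Metric.ball_subset_ball (x := x) (min_le_left a b)
  rw [hvw p (hbΩ (hsub hp)), hvw q (hbΩ (hsub hq))]
  exact hL p (hsub' hp) q (hsub' hq)

/-- If `M > 0`, a Harnack constant for the lifted domain is a constant for the antisymmetric
problem. -/
lemma AntisymSolution.harnackBound_of_pos {m : ℕ} {j : ℝ → ℝ} {Ω : Set (E (m + 1))} {M : ℝ}
    {c u : E (m + 1) → ℝ} (hu : AntisymSolution j Ω M c u) (hj : LevyProfile m j)
    (hΩ : IsOpen Ω) (hM : 0 < M) {K : Set (E (m + 1))} (hfold : fold '' K ⊆ Ω) {A : ℝ}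
    (hA : HarnackConstant (nextKernel j) (collapse ⁻¹' Ω) (collapse ⁻¹' (fold '' K)) M A) :
    AntisymHarnackBound A K u := by
  have hΩo : IsOpen (collapse ⁻¹' Ω : Set (E (m + 3))) := hΩ.preimage (continuous_collapse m)
  have hv := hu.locLipschitzOn_lift hΩ
  have hvu : ∀ x : E (m + 3), collapse x 0 ≠ 0 →
      divExtend u (collapse x) = u (collapse x) / collapse x 0 := fun x hx => if_neg hx
  obtain ⟨w, f, B, hf, hwv⟩ := hu.exists_boundedWeakSolution_extending hj hΩ hM.le
    hv.continuousOn fun x _ hx => hvu x hx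
  refine hu.harnackBound_of_lift hA.1 fun x hx y hy hx0 hy0 => ?_
  have := hf.le_mul_of_pos hj.levyKernel hM hΩo (hv.congr hΩo hwv) hA hx hy
  rwa [hwv x (hfold hx), hwv y (hfold hy), hvu x hx0.ne', hvu y hy0.ne'] at this

end AntisymHarnack

end

theorem mainTheorem7 (m : ℕ) (j : ℝ → ℝ)
    (hj_int : MeasureTheory.Integrable
      (fun x : AntisymHarnack.E (m + 1) => min 1 (‖x‖ ^ 2) * j ‖x‖) MeasureTheory.volume)
    (hj_diff : ∀ r : ℝ, 0 < r → DifferentiableAt ℝ j r)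
    (hj_anti : AntitoneOn j (Set.Ioi 0))
    (Ω K : Set (AntisymHarnack.E (m + 1))) (hΩ : IsOpen Ω) (hK : IsCompact K) (hKΩ : K ⊆ Ω)
    (hfold : AntisymHarnack.fold '' K ⊆ Ω) (M : ℝ) (hM : 0 ≤ M) :
    -- if `L_{n+2}` satisfies the Harnack inequality, there is a constant that depends only on
    -- `K`, `Ω` and `M`
    (AntisymHarnack.SatisfiesHarnack (m + 3) (AntisymHarnack.nextKernel j) →
      (∃ S : Set (AntisymHarnack.E (m + 1)), IsPreconnected S ∧ AntisymHarnack.fold '' K ⊆ S ∧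
        S ⊆ {x ∈ Ω | 0 ≤ x 0}) →
      ∃ A : ℝ, 0 < A ∧ ∀ c u : AntisymHarnack.E (m + 1) → ℝ,
        AntisymHarnack.AntisymSolution j Ω M c u → AntisymHarnack.AntisymHarnackBound A K u) ∧
    -- every constant of the Harnack inequality for `L_{n+2}` on the lifted sets is such a constant
    (∀ A : ℝ, AntisymHarnack.HarnackConstant (AntisymHarnack.nextKernel j)
        (AntisymHarnack.collapse ⁻¹' Ω)
        (AntisymHarnack.collapse ⁻¹' (AntisymHarnack.fold '' K)) M A →
      ∀ c u : AntisymHarnack.E (m + 1) → ℝ, AntisymHarnack.AntisymSolution j Ω M c u →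
        (0 < M ∨ AntisymHarnack.LiftC2 Ω u) → AntisymHarnack.AntisymHarnackBound A K u) ∧
    (∀ (U : Set (AntisymHarnack.E (m + 3))) (A : ℝ), IsOpen U →
      AntisymHarnack.collapse ⁻¹' (AntisymHarnack.fold '' K) ⊆ U →
      IsCompact (closure U) → closure U ⊆ AntisymHarnack.collapse ⁻¹' Ω →
      AntisymHarnack.HarnackConstant (AntisymHarnack.nextKernel j) U
        (AntisymHarnack.collapse ⁻¹' (AntisymHarnack.fold '' K)) M A →
      ∀ c u : AntisymHarnack.E (m + 1) → ℝ, AntisymHarnack.AntisymSolution j Ω M c u →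
        AntisymHarnack.AntisymHarnackBound A K u) := by
  have hj : AntisymHarnack.LevyProfile m j := ⟨hj_int, hj_diff, hj_anti⟩
  refine ⟨fun hH ⟨S, hS, hKS, hSΩ⟩ =>
      AntisymHarnack.exists_harnackBound_of_satisfiesHarnack hj hΩ hK hM hH hS hKS hSΩ,
    fun A hA c u hu h => ?_, fun U A hU _ hUc hUΩ hA c u hu =>
      hu.harnackBound_of_subset hj hΩ hM hfold hU hUc hUΩ hA⟩
  rcases h with hM0 | hC2
  · exact hu.harnackBound_of_pos hj hΩ hM0 hfold hA
  · exact hu.harnackBound_of_liftC2 hj hΩ hM hfold hC2 hA
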